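/- **Setting.** A *bilinear group generator* outputs, for security parameter $\lambda$, a random description of size polynomial in $\lambda$ of cyclic groups $\mathbb G,\mathbb G_T$ of order $N=p_1p_2p_3$ ($p_1,p_2,p_3$ distinct primes), with a bilinear map $e:\mathbb G\times\mathbb G\to\mathbb G_T$ such that some $e(g,g)$ has order $N$. Group elements are encoded as strings; the group operations and $e$ are efficiently computable; the description contains $N$ and generators of $\mathbb G$ and $\mathbb G_T$. $\mathbb G_{p_i}$ denotes the subgroup of $\mathbb G$ of order $p_i$. Let $\mathbf H:\mathbb G_T\to\{0,1\}^\lambda$ be drawn from an efficiently computable pairwise independent family. PPT means probabilistic polynomial time. All "random" choices are uniform and independent. **Assumptions.** Let $g_1,g_3$ be random generators of $\mathbb G_{p_1},\mathbb G_{p_3}$, and let $X_i\in\mathbb G_{p_1}$, $R_i\in\mathbb G_{p_2}$, $Y_i\in\mathbb G_{p_3}$ be random. For a PPT algorithm $\mathcal B$, $\mathrm{Adv}^{SD}_{\mathcal B}(\lambda)$ is the absolute difference of the probabilities that $\mathcal B$ outputs $0$ on $((N,\mathbb G,\mathbb G_T,e),g_1,g_3,Z)$ with $Z=X_1$ and with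 $Z=X_1R_1$; $\mathrm{Adv}^{GSD}_{\mathcal B}(\lambda)$ is the same for $((N,\mathbb G,\mathbb G_T,e),g_1,g_3,X_1R_1,R_2Y_1,Z)$ with $Z=X_2Y_2$ and with $Z=X_2R_3Y_2$. The SD (GSD) assumption says that this advantage is negligible in $\lambda$ for every PPT $\mathcal B$. **Scheme $\mathrm{DBE}_{SS}$** ($L\ge 1$ users). - *Setup*$(1^\lambda,1^L)$: generate the groups; choose random generators $g$ of $\mathbb G_{p_1}$ and $Y$ of $\mathbb G_{p_3}$, random $\alpha\in\mathbb Z_N$, $u\in\mathbb G_{p_1}$, $Y_1,\dots,Y_{2L}\in\mathbb G_{p_3}$, and $\mathbf H$. Put $A_k=g^{\alpha^k}$, $U_k=u^{\alpha^k}Y_k$. Output $PP=((N,\mathbb G,\mathbb G_T,e),g,Y,\{A_k\}_{1\le k\le L},\{U_k\}_{1\le k\le 2L,\,k\ne L+1},\Omega=e(g,U_{L+1}),\mathbf H)$. - *GenKey*$(i,PP)$: for random $\gamma_i\in\mathbb Z_N$ and fresh random $Y_1,\dots,Y_L\in\mathbb G_{p_3}$, output $USK_i=U_{L+1-i}^{\gamma_i}Y_{L+1-i}$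 and $UPK_i=(V_i=g^{\gamma_i},\{V_{i,k}=U_k^{\gamma_i}Y_k\}_{1\le k\le L,\,k\ne L+1-i})$. - *IsValid*$(j,UPK_j,PP)$: check $e(V_j,U_L)=e(A_{L-k},V_{j,k})$ for all $k\in\{1,\dots,L\}\setminus\{L+1-j\}$, where $A_0=g$. - *Encaps*$(S,\{UPK_j\}_{j\in S},PP)$: for random $t\in\mathbb Z_N$, output the header $CH=(g^t,(\prod_{j\in S}A_jV_j)^t)$ and the session key $CK=\mathbf H(\Omega^t)$. - *Decaps*$(S,CH,i,USK_i,\{UPK_j\}_{j\in S},PP)$, $CH=(C_1,C_2)$: output $\bot$ if $i\notin S$, and otherwise $\mathbf H\big(e(C_2,U_{L+1-i})\cdot e(C_1,USK_i\cdot\prod_{j\in S\setminus\{i\}}U_{L+1-i+j}V_{j,L+1-i})^{-1}\big)$. **Semi-static security.** The adversary $\mathcal A$, given $1^\lambda,1^L$, commits to a set $\tilde S\subseteq\{1,\dots,L\}$; it receives $PP$ and honestly generated $UPK_j$ for all $j\in\tilde S$; it submits $S^*\subseteq\tilde S$; it receives the header $CH^*$ of a fresh encapsulation $(CH^*,CK^*)$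 for $S^*$ together with $CK^*$ if $\mu=0$, or a random key if $\mu=1$, for a random bit $\mu$; it outputs $\mu'$. Its advantage is $\mathrm{Adv}^{SS}_{\mathcal A}(\lambda)=|\Pr[\mu=\mu']-\tfrac12|$. The scheme is semi-statically secure if for every number of users $L=L(\lambda)\ge1$ such that $1^\lambda\mapsto 1^{L(\lambda)}$ is computable in polynomial time, and every PPT $\mathcal A$, this advantage is negligible in $\lambda$. **Theorem.** 1. A ciphertext header consists of $2$ group elements, a private key of $1$, a public key of $L$, and the public parameters contain $3L+2$ group elements (besides the descriptions of the groups and of $\mathbf H$). 2. There is an absolute constant $C$ such that for every bilinear group generator, every hash family, every $L=L(\lambda)\ge 1$ as above and every PPT adversary $\mathcal A$ there are PPT algorithms $\mathcal B_1,\mathcal B_2$ with, for all $\lambda$, $$\mathrm{Adv}^{SS}_{\mathcal A}(\lambda)\le \mathrm{Adv}^{SD}_{\mathcal B_1}(\lambda)+2L\cdot\mathrm{Adv}^{GSD}_{\mathcal B_2}(\lambda)+\mathbb E\Big[C\,\frac{L^2}{p_2}+\frac12\sqrt{\frac{2^{\lambda}}{p_2}}\,\Big],$$ where the expectation is over the prime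 $p_2$ produced by the group generator. 3. If $\mathbb E[2^\lambda/p_2]$ is negligible in $\lambda$ and the SD and GSD assumptions hold, then $\mathrm{DBE}_{SS}$ is semi-statically secure. -/

import Mathlib

/-! ## A machine model with a step count

Programs are WHILE programs over binary trees. A command is charged for the size of every tree it
writes, so that running time is polynomially related to Turing machine time and the size of an
output never exceeds the size of the input plus the running time. -/

/-- Binary trees, the data on which programs operate. -/
inductive Data : Type
  | nil : Data
  | cons : Data → Data → Data

namespace Data

/-- Number of nodes. -/
def size : Data → ℕ
  | nil => 1
  | cons a b => a.size + b.size + 1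

def hd : Data → Data
  | nil => nil
  | cons a _ => a

def tl : Data → Data
  | nil => nil
  | cons _ b => b

/-- A tree read as a bit: `nil` is `0`, anything else is `1`. -/
def toBool : Data → Bool
  | nil => false
  | cons _ _ => true

/-- The `k`-th entry (from `0`) of a tree read as a list; `nil` beyond its end. -/
def nth (d : Data) (k : ℕ) : Data := (tl^[k] d).hd

def list (l : List Data) : Data := l.foldr cons nil

def ofBool : Bool → Data
  | false => nil
  | true => cons nil nil

/-- The unary string `1^n`. -/
def unary (n : ℕ) : Data := list (List.replicate n nil)

def bits (l : List Bool) : Data := list (l.map ofBool)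

/-- A family indexed by a finite set of integers, listed in increasing order of the index. -/
def family (s : Finset ℕ) (f : s → Data) : Data :=
  list ((s.sort (· ≤ ·)).attach.map fun k => f ⟨k.1, (Finset.mem_sort _).1 k.2⟩)

end Data

/-- The content of the registers `0, 1, 2, …`. -/
abbrev Store : Type := ℕ → Data

inductive Expr : Type
  | var : ℕ → Expr
  | nil : Expr
  | cons : Expr → Expr → Expr
  | hd : Expr → Expr
  | tl : Expr → Expr

def Expr.value (σ : Store) : Expr → Data
  | var x => σ x
  | nil => Data.nil
  | cons a b => Data.cons (a.value σ) (b.value σ)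
  | hd a => (a.value σ).hd
  | tl a => (a.value σ).tl

inductive Cmd : Type
  | assign : ℕ → Expr → Cmd
  | seq : Cmd → Cmd → Cmd
  | ite : ℕ → Cmd → Cmd → Cmd
  | loop : ℕ → Cmd → Cmd

/-- `c.Run σ n τ`: started in the store `σ`, the program `c` halts after `n` steps in the store
`τ`. The tests of `ite x` and `loop x` ask whether register `x` differs from `nil`. -/
inductive Cmd.Run : Cmd → Store → ℕ → Store → Prop
  | assign (x : ℕ) (a : Expr) (σ : Store) :
      Run (.assign x a) σ (1 + (a.value σ).size) (Function.update σ x (a.value σ))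
  | seq {c d : Cmd} {σ τ ρ : Store} {m n : ℕ} :
      Run c σ m τ → Run d τ n ρ → Run (.seq c d) σ (m + n) ρ
  | ite_true {x : ℕ} {c d : Cmd} {σ τ : Store} {n : ℕ} :
      σ x ≠ Data.nil → Run c σ n τ → Run (.ite x c d) σ (n + 1) τ
  | ite_false {x : ℕ} {c d : Cmd} {σ τ : Store} {n : ℕ} :
      σ x = Data.nil → Run d σ n τ → Run (.ite x c d) σ (n + 1) τ
  | loop_done {x : ℕ} {c : Cmd} {σ : Store} :
      σ x = Data.nil → Run (.loop x c) σ 1 σ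
  | loop_step {x : ℕ} {c : Cmd} {σ τ ρ : Store} {m n : ℕ} :
      σ x ≠ Data.nil → Run c σ m τ → Run (.loop x c) τ n ρ → Run (.loop x c) σ (m + n + 1) ρ

/-- The initial store: the input is in register `0`, all other registers are empty. -/
def Store.start (d : Data) : Store := Function.update (fun _ => Data.nil) 0 d

/-- `f` is computed by a program that halts on every input, within a number of steps that is
polynomial in the size of the input, with the output in register `0`. -/
def PolyTime (f : Data → Data) : Prop :=
  ∃ (c : Cmd) (q : Polynomial ℕ), ∀ d : Data, ∃ (n : ℕ) (τ : Store),
    c.Run (Store.start d) n τ ∧ τ 0 = f d ∧ n ≤ q.eval d.size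

/-- The operation `inp i ↦ out i`, in the structure with description `desc i`, is efficiently
computable: some polynomial-time algorithm computes it on all valid inputs. On other strings
its output is arbitrary, but still of size polynomial in the size of the description. -/
def EfficientOp {ι : Type} (desc inp out : ι → Data) : Prop :=
  ∃ f : Data → Data, PolyTime f ∧
    (∃ s : Polynomial ℕ, ∀ d x : Data, (f (Data.cons d x)).size ≤ s.eval d.size) ∧
    ∀ i, f (Data.cons (desc i) (inp i)) = out i

/-- `κ ↦ 1^(L κ)` is computable in time polynomial in `κ`. -/
def EfficientCount (L : ℕ → ℕ) : Prop :=
  ∃ f : Data → Data, PolyTime f ∧ ∀ κ, f (Data.unary κ) = Data.unary (L κ)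

/-- Negligible functions. -/
def Negligible (f : ℕ → ℝ) : Prop :=
  Asymptotics.SuperpolynomialDecay Filter.atTop (fun n : ℕ => (n : ℝ)) f

/-! ## Probability -/

/-- The uniform distribution on a finite non-empty type. -/
noncomputable def unif (α : Type) [Finite α] [Nonempty α] : PMF α :=
  letI := Fintype.ofFinite α
  PMF.uniformOfFintype α

/-- Expectation of a real function. -/
noncomputable def expect {α : Type} (p : PMF α) (f : α → ℝ) : ℝ := ∑' a, (p a).toReal * f a

theorem tsum_pi_prod_eq_one {ι : Type} [Fintype ι] :
    ∀ {α : ι → Type} (p : ∀ i, PMF (α i)), ∑' f : (∀ i, α i), ∏ i, p i (f i) = 1 := by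
  classical
  refine Fintype.induction_empty_option
    (P := fun ι _ => ∀ {α : ι → Type} (p : ∀ i, PMF (α i)), ∑' f : (∀ i, α i), ∏ i, p i (f i) = 1)
    ?_ ?_ ?_ ι
  · intro β γ _ e h α p
    let _ := Fintype.ofEquiv γ e.symm
    have h1 := h (α := fun b => α (e b)) (fun b => p (e b))
    rw [← (Equiv.piCongrLeft α e).tsum_eq, ← h1]
    refine tsum_congr fun f => ?_
    rw [← e.prod_comp]
    refine (Finset.prod_congr (by ext; simp) fun b _ => ?_)
    rw [Equiv.piCongrLeft_apply_apply]
  · intro α p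
    simp
  · intro β _ h α p
    rw [← (Equiv.piOptionEquivProd).symm.tsum_eq, ENNReal.tsum_prod']
    have h1 := h (α := fun b => α (some b)) (fun b => p (some b))
    simp only [Fintype.prod_option]
    simp only [Equiv.piOptionEquivProd, Equiv.coe_fn_symm_mk]
    simp [ENNReal.tsum_mul_left, h1, PMF.tsum_coe]

/-- Independent samples from a finite family of distributions. -/
noncomputable def pmfPi {ι : Type} [Fintype ι] {α : ι → Type} (p : ∀ i, PMF (α i)) :
    PMF (∀ i, α i) :=
  ⟨fun f => ∏ i, p i (f i), by
    rw [← tsum_pi_prod_eq_one p]; exact ENNReal.summable.hasSum⟩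

/-! ## Bilinear groups of composite order -/

/-- Cyclic groups `G`, `GT` of order `N = p₁ p₂ p₃` with a pairing and with encodings of their
elements as strings; `params` is whatever else the description of the groups contains. -/
structure BilinearGroup where
  p₁ : ℕ
  p₂ : ℕ
  p₃ : ℕ
  prime₁ : p₁.Prime
  prime₂ : p₂.Prime
  prime₃ : p₃.Prime
  ne₁₂ : p₁ ≠ p₂
  ne₁₃ : p₁ ≠ p₃
  ne₂₃ : p₂ ≠ p₃
  G : Type
  GT : Type
  [groupG : CommGroup G]
  [groupGT : CommGroup GT]
  [cyclicG : IsCyclic G]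
  [cyclicGT : IsCyclic GT]
  card_G : Nat.card G = p₁ * p₂ * p₃
  card_GT : Nat.card GT = p₁ * p₂ * p₃
  e : G →* G →* GT
  nondegenerate : ∃ g : G, orderOf (e g g) = p₁ * p₂ * p₃
  gen : G
  genT : GT
  zpowers_gen : Subgroup.zpowers gen = ⊤
  zpowers_genT : Subgroup.zpowers genT = ⊤
  enc : G → Data
  encT : GT → Data
  enc_injective : Function.Injective enc
  encT_injective : Function.Injective encT
  params : Data

namespace BilinearGroup

attribute [instance] groupG groupGT cyclicG cyclicGT

variable (B : BilinearGroup)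

/-- The group order. -/
def N : ℕ := B.p₁ * B.p₂ * B.p₃

instance : NeZero B.N :=
  ⟨mul_ne_zero (mul_ne_zero B.prime₁.ne_zero B.prime₂.ne_zero) B.prime₃.ne_zero⟩

instance : Finite B.G :=
  Nat.finite_of_card_ne_zero (by rw [B.card_G]; exact NeZero.ne B.N)

instance : Finite B.GT :=
  Nat.finite_of_card_ne_zero (by rw [B.card_GT]; exact NeZero.ne B.N)

/-- For a prime divisor `p` of the group order, the subgroup of `G` of order `p`. -/
def sub (p : ℕ) : Subgroup B.G := (powMonoidHom p : B.G →* B.G).ker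

/-- The generators of the subgroup of order `p`. -/
def Gens (p : ℕ) : Type := {g : B.G // Subgroup.zpowers g = B.sub p}

instance (p : ℕ) : Finite (B.Gens p) := inferInstanceAs (Finite {_g : B.G // _})

instance (p : ℕ) : Nonempty (B.Gens p) := by
  obtain ⟨g, hg⟩ := (Subgroup.isCyclic_iff_exists_zpowers_eq_top (B.sub p)).1 inferInstance
  exact ⟨⟨g, hg⟩⟩

/-- The description `(N, G, GT, e)`, including generators of `G` and `GT`. -/
def desc : Data :=
  Data.list [Data.bits B.N.bits, B.params, B.enc B.gen, B.encT B.genT]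

end BilinearGroup

/-- A generator of bilinear groups: on the security parameter `κ` it outputs a random instance of
description size polynomial in `κ`, and the operations of the groups that it outputs and their
pairing are efficiently computable. -/
structure GroupGenerator where
  Inst : Type
  grp : Inst → BilinearGroup
  dist : ℕ → PMF Inst
  desc_size : ∃ q : Polynomial ℕ, ∀ κ, ∀ I ∈ (dist κ).support, (grp I).desc.size ≤ q.eval κ
  mul_eff : EfficientOp (ι := Σ I, (grp I).G × (grp I).G) (fun i => (grp i.1).desc)
    (fun i => Data.list [(grp i.1).enc i.2.1, (grp i.1).enc i.2.2])
    (fun i => (grp i.1).enc (i.2.1 * i.2.2))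
  inv_eff : EfficientOp (ι := Σ I, (grp I).G) (fun i => (grp i.1).desc)
    (fun i => (grp i.1).enc i.2) (fun i => (grp i.1).enc i.2⁻¹)
  mulT_eff : EfficientOp (ι := Σ I, (grp I).GT × (grp I).GT) (fun i => (grp i.1).desc)
    (fun i => Data.list [(grp i.1).encT i.2.1, (grp i.1).encT i.2.2])
    (fun i => (grp i.1).encT (i.2.1 * i.2.2))
  invT_eff : EfficientOp (ι := Σ I, (grp I).GT) (fun i => (grp i.1).desc)
    (fun i => (grp i.1).encT i.2) (fun i => (grp i.1).encT i.2⁻¹)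
  pair_eff : EfficientOp (ι := Σ I, (grp I).G × (grp I).G) (fun i => (grp i.1).desc)
    (fun i => Data.list [(grp i.1).enc i.2.1, (grp i.1).enc i.2.2])
    (fun i => (grp i.1).encT ((grp i.1).e i.2.1 i.2.2))

/-- An efficient pairwise independent family of hash functions from `GT` to `{0,1}^κ`. A function
of the family is given by a uniformly random key, a string of `keyLen κ I` bits. -/
structure HashFamily (𝒢 : GroupGenerator) where
  keyLen : ℕ → 𝒢.Inst → ℕ
  hash : ∀ (κ : ℕ) (I : 𝒢.Inst), (Fin (keyLen κ I) → Bool) → (𝒢.grp I).GT → (Fin κ → Bool)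
  pairwise_indep : ∀ (κ : ℕ) (I : 𝒢.Inst) (x y : (𝒢.grp I).GT), x ≠ y →
    (unif (Fin (keyLen κ I) → Bool)).map (fun k => (hash κ I k x, hash κ I k y)) =
      unif ((Fin κ → Bool) × (Fin κ → Bool))
  keyLen_eff : EfficientOp (ι := ℕ × 𝒢.Inst)
    (fun i => Data.list [Data.unary i.1, (𝒢.grp i.2).desc])
    (fun _ => Data.nil) (fun i => Data.unary (keyLen i.1 i.2))
  hash_eff : EfficientOp
    (ι := Σ i : ℕ × 𝒢.Inst, (Fin (keyLen i.1 i.2) → Bool) × (𝒢.grp i.2).GT)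
    (fun i => Data.list [Data.unary i.1.1, (𝒢.grp i.1.2).desc])
    (fun i => Data.list [Data.bits (List.ofFn i.2.1), (𝒢.grp i.1.2).encT i.2.2])
    (fun i => Data.bits (List.ofFn (hash i.1.1 i.1.2 i.2.1 i.2.2)))

/-! ## Complexity assumptions -/

/-- A probabilistic polynomial-time algorithm that receives `1^κ` and a challenge, and outputs a
bit. It uses `coins.eval κ` uniformly random bits. -/
structure Distinguisher where
  coins : Polynomial ℕ
  run : Data → Data
  polyTime : PolyTime run

/-- The output distribution of the algorithm on the challenge `x`. -/
noncomputable def Distinguisher.output (D : Distinguisher) (κ : ℕ) (x : Data) : PMF Bool := do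
  let r ← unif (Fin (D.coins.eval κ) → Bool)
  pure (D.run (Data.list [Data.unary κ, Data.bits (List.ofFn r), x])).toBool

namespace GroupGenerator

variable (𝒢 : GroupGenerator)

/-- The subgroup decision experiment; `b = false` for `Z = X₁`, `b = true` for `Z = X₁ R₁`. -/
noncomputable def sdExp (D : Distinguisher) (κ : ℕ) (b : Bool) : PMF Bool := do
  let I ← 𝒢.dist κ
  let B := 𝒢.grp I
  let g₁ ← unif (B.Gens B.p₁)
  let g₃ ← unif (B.Gens B.p₃)
  let X₁ ← unif (B.sub B.p₁)
  let R₁ ← unif (B.sub B.p₂)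
  let Z : B.G := if b then X₁.1 * R₁.1 else X₁.1
  D.output κ (Data.list [B.desc, B.enc g₁.1, B.enc g₃.1, B.enc Z])

noncomputable def advSD (D : Distinguisher) (κ : ℕ) : ℝ :=
  |(𝒢.sdExp D κ false false).toReal - (𝒢.sdExp D κ true false).toReal|

/-- The general subgroup decision experiment; `b = false` for `Z = X₂ Y₂`, `b = true` for
`Z = X₂ R₃ Y₂`. -/
noncomputable def gsdExp (D : Distinguisher) (κ : ℕ) (b : Bool) : PMF Bool := do
  let I ← 𝒢.dist κ
  let B := 𝒢.grp I
  let g₁ ← unif (B.Gens B.p₁)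
  let g₃ ← unif (B.Gens B.p₃)
  let X₁ ← unif (B.sub B.p₁)
  let X₂ ← unif (B.sub B.p₁)
  let R₁ ← unif (B.sub B.p₂)
  let R₂ ← unif (B.sub B.p₂)
  let R₃ ← unif (B.sub B.p₂)
  let Y₁ ← unif (B.sub B.p₃)
  let Y₂ ← unif (B.sub B.p₃)
  let Z : B.G := if b then X₂.1 * R₃.1 * Y₂.1 else X₂.1 * Y₂.1
  D.output κ (Data.list [B.desc, B.enc g₁.1, B.enc g₃.1, B.enc (X₁.1 * R₁.1),
    B.enc (R₂.1 * Y₁.1), B.enc Z])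

noncomputable def advGSD (D : Distinguisher) (κ : ℕ) : ℝ :=
  |(𝒢.gsdExp D κ false false).toReal - (𝒢.gsdExp D κ true false).toReal|

/-- The SD assumption. -/
def SD : Prop := ∀ D : Distinguisher, Negligible (𝒢.advSD D)

/-- The GSD assumption. -/
def GSD : Prop := ∀ D : Distinguisher, Negligible (𝒢.advGSD D)

end GroupGenerator

/-! ## Distributed broadcast encryption -/

/-- The user indices `1, …, L`. -/
abbrev User (L : ℕ) : Type := {i : ℕ // i ∈ Finset.Icc 1 L}

/-- A distributed broadcast encryption scheme, with encodings as strings of what an adversary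
gets to see. -/
structure DBEScheme where
  PP : ℕ → ℕ → Type
  USK : ∀ {κ L : ℕ}, PP κ L → User L → Type
  UPK : ∀ {κ L : ℕ}, PP κ L → User L → Type
  Header : ∀ {κ L : ℕ}, PP κ L → Type
  Key : ℕ → Type
  [finiteKey : ∀ κ, Finite (Key κ)]
  [nonemptyKey : ∀ κ, Nonempty (Key κ)]
  setup : ∀ κ L : ℕ, PMF (PP κ L)
  genKey : ∀ {κ L : ℕ} (pp : PP κ L) (i : User L), PMF (USK pp i × UPK pp i)
  IsValid : ∀ {κ L : ℕ} (pp : PP κ L) (j : User L), UPK pp j → Prop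
  encaps : ∀ {κ L : ℕ} (pp : PP κ L) (S : Finset (User L)), (∀ j : S, UPK pp j.1) →
    PMF (Header pp × Key κ)
  decaps : ∀ {κ L : ℕ} (pp : PP κ L) (S : Finset (User L)), Header pp → ∀ i : User L,
    USK pp i → (∀ j : S, UPK pp j.1) → Option (Key κ)
  encPP : ∀ {κ L : ℕ}, PP κ L → Data
  encUPK : ∀ {κ L : ℕ} (pp : PP κ L) (j : User L), UPK pp j → Data
  encHeader : ∀ {κ L : ℕ} (pp : PP κ L), Header pp → Data
  encKey : ∀ {κ : ℕ}, Key κ → Data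

attribute [instance] DBEScheme.finiteKey DBEScheme.nonemptyKey

/-- The set of users encoded by a string, read as a list of bits, one for each of `1, …, L`. -/
def decodeSet (L : ℕ) (d : Data) : Finset (User L) :=
  Finset.univ.filter fun j => (d.nth (j.1 - 1)).toBool = true

/-- The encoding of `{(j, UPK_j)}` for `j` in `S`. -/
def DBEScheme.encUPKs (P : DBEScheme) {κ L : ℕ} (pp : P.PP κ L) (S : Finset (User L))
    (upk : ∀ j : S, P.UPK pp j.1) : Data :=
  Data.list ((S.sort (· ≤ ·)).attach.map fun j =>
    Data.cons (Data.unary j.1.1) (P.encUPK pp j.1 (upk ⟨j.1, (Finset.mem_sort _).1 j.2⟩)))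

/-- A probabilistic polynomial-time adversary against semi-static security. Its three stages pass
a state from each to the next; all its random bits are given to the first one. -/
structure SSAdversary where
  coins : Polynomial ℕ
  commit : Data → Data
  query : Data → Data
  guess : Data → Data
  commit_polyTime : PolyTime commit
  query_polyTime : PolyTime query
  guess_polyTime : PolyTime guess

/-- The semi-static security experiment; the outcome `true` means that the guess is right. The
first two stages output a pair (set, state), and users outside the initial set are dropped from
the challenge set. -/
noncomputable def DBEScheme.ssExp (P : DBEScheme) (A : SSAdversary) (κ L : ℕ) : PMF Bool := do
  let r ← unif (Fin (A.coins.eval (κ + L)) → Bool)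
  let o₁ := A.commit (Data.list [Data.unary κ, Data.unary L, Data.bits (List.ofFn r)])
  let S₀ := decodeSet L o₁.hd
  let pp ← P.setup κ L
  let keys ← pmfPi (fun j : S₀ => P.genKey pp j.1)
  let o₂ := A.query (Data.list [o₁.tl, P.encPP pp, P.encUPKs pp S₀ (fun j => (keys j).2)])
  let S := decodeSet L o₂.hd ∩ S₀
  let c ← P.encaps pp S (fun j => (keys ⟨j.1, (Finset.mem_inter.1 j.2).2⟩).2)
  let rk ← unif (P.Key κ)
  let μ ← unif Bool
  let o₃ := A.guess (Data.list [o₂.tl, P.encHeader pp c.1, P.encKey (if μ then rk else c.2)])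
  pure (o₃.toBool == μ)

noncomputable def DBEScheme.advSS (P : DBEScheme) (A : SSAdversary) (κ L : ℕ) : ℝ :=
  |(P.ssExp A κ L true).toReal - 1 / 2|

/-- Semi-static security, for every efficiently computable positive number `L κ` of users. -/
def DBEScheme.SemiStaticallySecure (P : DBEScheme) : Prop :=
  ∀ L : ℕ → ℕ, EfficientCount L → (∀ κ, 1 ≤ L κ) →
    ∀ A : SSAdversary, Negligible fun κ => P.advSS A κ (L κ)

/-! ## The basic scheme -/

namespace DBESS

variable {𝒢 : GroupGenerator} (ℋ : HashFamily 𝒢)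

/-- Public parameters; `key` is the key of the hash function. -/
structure PP (κ L : ℕ) where
  I : 𝒢.Inst
  g : (𝒢.grp I).G
  Y : (𝒢.grp I).G
  A : Finset.Icc 1 L → (𝒢.grp I).G
  U : (Finset.Icc 1 (2 * L)).erase (L + 1) → (𝒢.grp I).G
  Ω : (𝒢.grp I).GT
  key : Fin (ℋ.keyLen κ I) → Bool

variable {ℋ} {κ L : ℕ}

/-- The group of the public parameters. -/
abbrev PP.B (pp : PP ℋ κ L) : BilinearGroup := 𝒢.grp pp.I

structure USK (pp : PP ℋ κ L) where
  K : pp.B.G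

structure UPK (pp : PP ℋ κ L) (i : User L) where
  V : pp.B.G
  W : (Finset.Icc 1 L).erase (L + 1 - i.1) → pp.B.G

structure Header (pp : PP ℋ κ L) where
  C₁ : pp.B.G
  C₂ : pp.B.G

/-- The members of a family of elements of `G`, in increasing order of the index. -/
def elems (B : BilinearGroup) (s : Finset ℕ) (f : s → B.G) : List (B.G ⊕ B.GT) :=
  (s.sort (· ≤ ·)).attach.map fun k => Sum.inl (f ⟨k.1, (Finset.mem_sort _).1 k.2⟩)

def encElems (B : BilinearGroup) (l : List (B.G ⊕ B.GT)) : Data :=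
  Data.list (l.map (Sum.elim B.enc B.encT))

/-- The group elements that make up the public parameters. -/
def PP.elements (pp : PP ℋ κ L) : List (pp.B.G ⊕ pp.B.GT) :=
  [Sum.inl pp.g, Sum.inl pp.Y] ++ elems pp.B _ pp.A ++ elems pp.B _ pp.U ++ [Sum.inr pp.Ω]

def USK.elements {pp : PP ℋ κ L} (k : USK pp) : List (pp.B.G ⊕ pp.B.GT) := [Sum.inl k.K]

def UPK.elements {pp : PP ℋ κ L} {i : User L} (k : UPK pp i) : List (pp.B.G ⊕ pp.B.GT) :=
  Sum.inl k.V :: elems pp.B _ k.W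

def Header.elements {pp : PP ℋ κ L} (c : Header pp) : List (pp.B.G ⊕ pp.B.GT) :=
  [Sum.inl c.C₁, Sum.inl c.C₂]

variable (ℋ) in
noncomputable def setup (κ L : ℕ) : PMF (PP ℋ κ L) := do
  let I ← 𝒢.dist κ
  let B := 𝒢.grp I
  let g₁ ← unif (B.Gens B.p₁)
  let g₃ ← unif (B.Gens B.p₃)
  let α ← unif (ZMod B.N)
  let u ← unif (B.sub B.p₁)
  let Y ← unif (Finset.Icc 1 (2 * L) → B.sub B.p₃)
  let key ← unif (Fin (ℋ.keyLen κ I) → Bool)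
  let U : ℕ → B.G := fun k =>
    u.1 ^ (α ^ k).val * (if h : k ∈ Finset.Icc 1 (2 * L) then (Y ⟨k, h⟩).1 else 1)
  pure
    { I := I
      g := g₁.1
      Y := g₃.1
      A := fun k => g₁.1 ^ (α ^ k.1).val
      U := fun k => U k.1
      Ω := B.e g₁.1 (U (L + 1))
      key := key }

theorem mem_U {k : ℕ} (h : k ∈ Finset.Icc 1 L) :
    k ∈ (Finset.Icc 1 (2 * L)).erase (L + 1) := by
  simp only [Finset.mem_erase, Finset.mem_Icc] at *; omega

theorem mem_sub {i : ℕ} (h : i ∈ Finset.Icc 1 L) : L + 1 - i ∈ Finset.Icc 1 L := by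
  simp only [Finset.mem_Icc] at *; omega

theorem mem_sub_add {i j : ℕ} (hi : i ∈ Finset.Icc 1 L) (hj : j ∈ Finset.Icc 1 L) (h : j ≠ i) :
    L + 1 - i + j ∈ (Finset.Icc 1 (2 * L)).erase (L + 1) := by
  simp only [Finset.mem_erase, Finset.mem_Icc] at *; omega

theorem mem_W {i j : ℕ} (hi : i ∈ Finset.Icc 1 L) (hj : j ∈ Finset.Icc 1 L) (h : j ≠ i) :
    L + 1 - i ∈ (Finset.Icc 1 L).erase (L + 1 - j) := by
  simp only [Finset.mem_erase, Finset.mem_Icc] at *; omega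

theorem mem_self (i : User L) : L ∈ Finset.Icc 1 L := by
  have := i.2
  simp only [Finset.mem_Icc] at *; omega

/-- `U_k` for `1 ≤ k ≤ L`. -/
def PP.U' (pp : PP ℋ κ L) (k : ℕ) (h : k ∈ Finset.Icc 1 L) : pp.B.G := pp.U ⟨k, mem_U h⟩

/-- `A_k` for `0 ≤ k ≤ L`, where `A_0 = g`. -/
def PP.A' (pp : PP ℋ κ L) (k : ℕ) : pp.B.G :=
  if h : k ∈ Finset.Icc 1 L then pp.A ⟨k, h⟩ else pp.g

noncomputable def genKey (pp : PP ℋ κ L) (i : User L) : PMF (USK pp × UPK pp i) := do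
  let γ ← unif (ZMod pp.B.N)
  let Y ← unif (Finset.Icc 1 L → pp.B.sub pp.B.p₃)
  pure
    ({ K := pp.U' (L + 1 - i.1) (mem_sub i.2) ^ γ.val * (Y ⟨L + 1 - i.1, mem_sub i.2⟩).1 },
     { V := pp.g ^ γ.val
       W := fun k => pp.U' k.1 (Finset.mem_of_mem_erase k.2) ^ γ.val *
         (Y ⟨k.1, Finset.mem_of_mem_erase k.2⟩).1 })

def IsValid (pp : PP ℋ κ L) (j : User L) (k : UPK pp j) : Prop :=
  ∀ i : (Finset.Icc 1 L).erase (L + 1 - j.1),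
    pp.B.e k.V (pp.U' L (mem_self j)) = pp.B.e (pp.A' (L - i.1)) (k.W i)

noncomputable def encaps (pp : PP ℋ κ L) (S : Finset (User L)) (upk : ∀ j : S, UPK pp j.1) :
    PMF (Header pp × (Fin κ → Bool)) := do
  let t ← unif (ZMod pp.B.N)
  pure
    ({ C₁ := pp.g ^ t.val
       C₂ := (∏ j : S, pp.A j.1 * (upk j).V) ^ t.val },
     ℋ.hash κ pp.I pp.key (pp.Ω ^ t.val))

def decaps (pp : PP ℋ κ L) (S : Finset (User L)) (c : Header pp) (i : User L) (k : USK pp)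
    (upk : ∀ j : S, UPK pp j.1) : Option (Fin κ → Bool) :=
  if i ∈ S then
    let D₂ := pp.U' (L + 1 - i.1) (mem_sub i.2)
    let D₃ := ∏ j : S, if h : j.1.1 ≠ i.1 then
        pp.U ⟨L + 1 - i.1 + j.1.1, mem_sub_add i.2 j.1.2 h⟩ *
          (upk j).W ⟨L + 1 - i.1, mem_W i.2 j.1.2 h⟩
      else 1
    some (ℋ.hash κ pp.I pp.key (pp.B.e c.C₂ D₂ * (pp.B.e c.C₁ (k.K * D₃))⁻¹))
  else none

end DBESS

/-- The basic distributed broadcast encryption scheme. -/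
noncomputable def dbeSS {𝒢 : GroupGenerator} (ℋ : HashFamily 𝒢) : DBEScheme where
  PP := DBESS.PP ℋ
  USK := fun pp _ => DBESS.USK pp
  UPK := fun pp i => DBESS.UPK pp i
  Header := fun pp => DBESS.Header pp
  Key := fun κ => Fin κ → Bool
  setup := DBESS.setup ℋ
  genKey := DBESS.genKey
  IsValid := DBESS.IsValid
  encaps := DBESS.encaps
  decaps := DBESS.decaps
  encPP := fun pp => Data.list
    [pp.B.desc, DBESS.encElems pp.B pp.elements, Data.bits (List.ofFn pp.key)]
  encUPK := fun pp _ k => DBESS.encElems pp.B k.elements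
  encHeader := fun pp c => DBESS.encElems pp.B c.elements
  encKey := fun k => Data.bits (List.ofFn k)

/-!
The two attacks share one simulator of the semi-static security experiment. It receives elements
`C₁`, `D`, `Z` of `G`, chooses `α`, the `γ_j` and `m` pairs `(ρ_l, a_l)` of exponents, and
publishes `A_k = g ^ α ^ k` and `U_k = Z ^ α ^ k * ∏ l, D ^ (ρ_l * a_l ^ k)`, blinded in the
subgroup of order `p₃`; the `l`-th factor of the product is the `l`-th mask. For every user `j` of
the initial set it takes `γ_j - α ^ j` as the secret, so that `A_j * V_j = g ^ γ_j` and the header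
`(C₁, C₁ ^ ∑ j, γ_j)` fits every challenge set. The session key is the hash of `e(C₁, U_{L+1})`.
The component `V_{j,k}` of the public key of `j` is `U_k ^ γ_j / U_{k+j}`, blinded. As the index
`k = L + 1 - j` is left out, the element `U_{L+1}` enters into none of these.

Without masks, and with `C₁` and `Z` in the subgroup of order `p₁`, this is the real experiment
(`toReal_ssExp`). The SD assumption moves `C₁ = X₁` to `C₁ = X₁ R₁`. Then the number of masks
grows from `0` to `2 L`. Take `D = R₂ Y₁`. The GSD assumption moves `Z = X₂ Y₂` to `Z = X₂ R₃ Y₂`,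
where `Y₁` and `Y₂` disappear in the blinding (`gameValue_simP`). If `R₂ ≠ 1`, then `R₃ ^ α ^ k`
has the form `R₂ ^ (ρ * α ^ k)`, in which only `α` modulo `p₂` matters, and nothing else that is
published depends on `α` modulo `p₂`. Exchanging it with a fresh base `a` by means of the
idempotent of `ZMod N` that belongs to `p₂` turns the new part of `Z` into one more mask
(`mean_gameValue_simP`). Each step loses `1 / p₂`, the probability of `R₂ = 1`.

After `2 L` steps the exponents of the masks in `U_1, …, U_{2L}` are the values
`∑ l, ρ_l * a_l ^ k`. If the `a_l` are distinct and non-zero modulo `p₂`, then the Vandermonde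
matrix of the `a_l`
is invertible modulo `p₂`, and hence the exponent of `U_{L+1}` is uniform modulo `p₂` even when
all the others are given. The element `Ω = e(g, U_{L+1})` does not depend on this exponent, since
`g` has order `p₁`, but `e(C₁, U_{L+1})` does, and takes `p₂` equally likely values. By the
leftover hash lemma (`leftover_hash`) the session key is nearly uniform
(`abs_gameValue_sub_half`). The sum of the losses is bounded in `abs_sdValue_sub_half`. The attack
on GSD chooses the number `m < 2 L` of masks at random, which accounts for the factor `2 L`.

Both attacks (`Tools.attackSD`, `Tools.attackGSD`) have to be programs of the machine model, which
they are because polynomial-time functions are closed under composition, case distinction and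
iteration with results of polynomial size. Exponents are read off random bits; a number with
enough bits is nearly uniform modulo `N` (`NearUniform.natOfBits`), and the error is absorbed in
the term `C * L ^ 2 / p₂` (`abs_sdExp_sub_le`, `abs_gsdExp_sub_le`, `advSS_le`).

Semi-static security follows from the bound because `L` is polynomially bounded and
`𝔼 √x ≤ √(𝔼 x)`.
-/

/-! ### Machine model: locality and composition of programs -/

namespace Data

theorem size_hd_le (d : Data) : d.hd.size ≤ d.size := by
  cases d <;> simp [size, hd]; omega

theorem size_tl_le (d : Data) : d.tl.size ≤ d.size := by
  cases d <;> simp [size, tl]; omega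

end Data

theorem Polynomial.eval_mono_nat (q : Polynomial ℕ) {m n : ℕ} (h : m ≤ n) :
    q.eval m ≤ q.eval n := by
  rw [Polynomial.eval_eq_sum_range, Polynomial.eval_eq_sum_range]
  gcongr

/-- A strict upper bound for the registers that an expression reads. -/
def Expr.bound : Expr → ℕ
  | var x => x + 1
  | nil => 0
  | cons a b => max a.bound b.bound
  | hd a => a.bound
  | tl a => a.bound

/-- A strict upper bound for the registers that a program uses. -/
def Cmd.bound : Cmd → ℕ
  | assign x a => max (x + 1) a.bound
  | seq c d => max c.bound d.bound
  | ite x c d => max (x + 1) (max c.bound d.bound)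
  | loop x c => max (x + 1) c.bound

theorem Expr.value_congr {σ σ' : Store} {k : ℕ} (h : ∀ x < k, σ' x = σ x) :
    ∀ {a : Expr}, a.bound ≤ k → a.value σ' = a.value σ
  | var x, ha => h x ha
  | nil, _ => rfl
  | cons a b, ha => by
      simp only [Expr.bound, max_le_iff] at ha
      simp only [Expr.value, value_congr h ha.1, value_congr h ha.2]
  | hd a, ha => by simp only [Expr.value, value_congr (a := a) h ha]
  | tl a, ha => by simp only [Expr.value, value_congr (a := a) h ha]

namespace Cmd

/-- A program neither reads nor changes the registers beyond its bound. -/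
theorem Run.congr {c : Cmd} {σ τ : Store} {n k : ℕ} (h : Run c σ n τ) :
    ∀ {σ' : Store}, c.bound ≤ k → (∀ x < k, σ' x = σ x) →
      ∃ τ', Run c σ' n τ' ∧ (∀ x < k, τ' x = τ x) ∧ ∀ x, k ≤ x → τ' x = σ' x := by
  induction h with
  | assign x a σ =>
    intro σ' hk hσ
    simp only [bound, max_le_iff] at hk
    rw [← Expr.value_congr hσ hk.2]
    refine ⟨_, Run.assign x a σ', ?_, ?_⟩
    · intro y hy
      by_cases hyx : y = x
      · subst hyx; simp
      · simp [Function.update_of_ne hyx, hσ y hy]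
    · intro y hy
      exact Function.update_of_ne (by omega) _ _
  | seq h₁ h₂ ih₁ ih₂ =>
    intro σ' hk hσ
    simp only [bound, max_le_iff] at hk
    obtain ⟨τ', r₁, e₁, f₁⟩ := ih₁ hk.1 hσ
    obtain ⟨ρ', r₂, e₂, f₂⟩ := ih₂ hk.2 e₁
    exact ⟨ρ', r₁.seq r₂, e₂, fun x hx => (f₂ x hx).trans (f₁ x hx)⟩
  | ite_true hx _ ih =>
    intro σ' hk hσ
    simp only [bound, max_le_iff] at hk
    obtain ⟨τ', r, e, f⟩ := ih hk.2.1 hσ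
    exact ⟨τ', .ite_true (by rwa [hσ _ (by omega)]) r, e, f⟩
  | ite_false hx _ ih =>
    intro σ' hk hσ
    simp only [bound, max_le_iff] at hk
    obtain ⟨τ', r, e, f⟩ := ih hk.2.2 hσ
    exact ⟨τ', .ite_false (by rwa [hσ _ (by omega)]) r, e, f⟩
  | loop_done hx =>
    intro σ' hk hσ
    simp only [bound, max_le_iff] at hk
    exact ⟨σ', .loop_done (by rwa [hσ _ (by omega)]), hσ, fun _ _ => rfl⟩
  | loop_step hx _ _ ih₁ ih₂ =>
    intro σ' hk hσ
    obtain ⟨τ', r₁, e₁, f₁⟩ := ih₁ (by simp only [bound, max_le_iff] at hk; exact hk.2) hσ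
    obtain ⟨ρ', r₂, e₂, f₂⟩ := ih₂ hk e₁
    simp only [bound, max_le_iff] at hk
    exact ⟨ρ', .loop_step (by rwa [hσ _ (by omega)]) r₁ r₂, e₂,
      fun x hx => (f₂ x hx).trans (f₁ x hx)⟩

theorem Run.size_le {c : Cmd} {σ τ : Store} {n : ℕ} (h : Run c σ n τ) :
    ∀ x, (τ x).size ≤ (σ x).size + n := by
  induction h with
  | assign x a σ =>
    intro y
    by_cases hyx : y = x
    · subst hyx; simp; omega
    · simp [Function.update_of_ne hyx]
  | seq _ _ ih₁ ih₂ => intro x; have := ih₁ x; have := ih₂ x; omega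
  | ite_true _ _ ih => intro x; have := ih x; omega
  | ite_false _ _ ih => intro x; have := ih x; omega
  | loop_done _ => intro x; omega
  | loop_step _ _ _ ih₁ ih₂ => intro x; have := ih₁ x; have := ih₂ x; omega

theorem Run.congr_store {c : Cmd} {σ τ τ' : Store} {n : ℕ} (h : Run c σ n τ) (e : τ = τ') :
    Run c σ n τ' := e ▸ h

theorem Run.exists_le {c : Cmd} {σ τ τ' : Store} {n m : ℕ} (h : Run c σ n τ) (e : τ = τ')
    (hn : n ≤ m) : ∃ n, Run c σ n τ' ∧ n ≤ m := ⟨n, e ▸ h, hn⟩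

/-- `c` computes `f` in register `0` within time `t`, with registers below `k` as scratch space
that has to be empty at the start and is empty again at the end; all other registers are left
alone. -/
def Computes (c : Cmd) (k : ℕ) (f : Data → Data) (t : Polynomial ℕ) : Prop :=
  1 ≤ k ∧ ∀ σ : Store, (∀ x, 0 < x → x < k → σ x = Data.nil) →
    ∃ n, Run c σ n (Function.update σ 0 (f (σ 0))) ∧ n ≤ t.eval (σ 0).size

/-- Empties the registers `1, …, k`. -/
def clear : ℕ → Cmd
  | 0 => assign 0 (.var 0)
  | k + 1 => seq (clear k) (assign (k + 1) .nil)

theorem run_clear (σ : Store) : ∀ k, Run (clear k) σ (1 + (σ 0).size + 2 * k)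
    (fun x => if 0 < x ∧ x ≤ k then Data.nil else σ x)
  | 0 => by
    have h := Run.assign 0 (.var 0) σ
    simp only [Expr.value, Function.update_eq_self] at h
    have hz : (fun x => if 0 < x ∧ x ≤ 0 then Data.nil else σ x) = σ := by
      funext x; rw [if_neg (by omega)]
    rw [hz]
    exact h
  | k + 1 => by
    have h := (run_clear σ k).seq (Run.assign (k + 1) .nil _)
    simp only [Expr.value, Data.size] at h
    refine h.congr_store ?_
    funext x
    by_cases hx : x = k + 1
    · subst hx; simp
    · rw [Function.update_of_ne hx]
      by_cases h1 : 0 < x ∧ x ≤ k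
      · rw [if_pos h1, if_pos (by omega)]
      · rw [if_neg h1, if_neg (by omega)]

theorem Computes.mono {c : Cmd} {k k' : ℕ} {f : Data → Data} {t : Polynomial ℕ}
    (h : Computes c k f t) (hk : k ≤ k') : Computes c k' f t :=
  ⟨h.1.trans hk, fun σ hσ => h.2 σ fun x hx hxk => hσ x hx (by omega)⟩

theorem Computes.polyTime {c : Cmd} {k : ℕ} {f : Data → Data} {t : Polynomial ℕ}
    (h : Computes c k f t) : PolyTime f := by
  refine ⟨c, t, fun d => ?_⟩
  obtain ⟨n, r, hn⟩ := h.2 (Store.start d) fun x hx _ => by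
    simp [Store.start, Function.update_of_ne hx.ne']
  refine ⟨n, _, r, ?_, ?_⟩
  · simp [Store.start]
  · simpa [Store.start] using hn

end Cmd

open Cmd in
theorem PolyTime.computes {f : Data → Data} (h : PolyTime f) :
    ∃ c k t, Cmd.Computes c k f t := by
  obtain ⟨c, q, hq⟩ := h
  refine ⟨.seq c (clear c.bound), c.bound + 1, q + (1 + (.X + q) + 2 * (c.bound : Polynomial ℕ)),
    by omega, fun σ hσ => ?_⟩
  -- the program is run on the registers below its bound, and leaves garbage only there
  obtain ⟨n, τ, hr, hτ, hn⟩ := hq (σ 0)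
  obtain ⟨τ', r', e', f'⟩ := hr.congr (k := c.bound + 1) (σ' := σ) (by omega) (fun x hx => by
    by_cases h0 : x = 0
    · subst h0; simp [Store.start]
    · rw [hσ x (by omega) hx, Store.start, Function.update_of_ne h0])
  refine (r'.seq (run_clear τ' c.bound)).exists_le ?_ ?_
  · funext x
    by_cases h0 : x = 0
    · subst h0; simp [e', hτ]
    · rw [Function.update_of_ne h0]
      by_cases h1 : 0 < x ∧ x ≤ c.bound
      · rw [if_pos h1, hσ x (by omega) (by omega)]
      · rw [if_neg h1, f' x (by omega)]
  · have hs := r'.size_le 0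
    simp only [Polynomial.eval_add, Polynomial.eval_mul, Polynomial.eval_one, Polynomial.eval_X,
      Polynomial.eval_natCast, Polynomial.eval_ofNat]
    simp only [Nat.cast_id]
    omega

theorem PolyTime.size_le {f : Data → Data} (h : PolyTime f) :
    ∃ q : Polynomial ℕ, ∀ d, (f d).size ≤ q.eval d.size := by
  obtain ⟨c, q, hq⟩ := h
  refine ⟨.X + q, fun d => ?_⟩
  obtain ⟨n, τ, hr, hτ, hn⟩ := hq d
  have := hr.size_le 0
  rw [hτ] at this
  simp [Store.start] at this ⊢
  omega

namespace PolyTime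

open Cmd

theorem of_expr (a : Expr) (q : Polynomial ℕ)
    (hq : ∀ σ : Store, (a.value σ).size ≤ q.eval (σ 0).size) {f : Data → Data}
    (hf : ∀ σ, a.value σ = f (σ 0)) : PolyTime f := by
  refine Computes.polyTime (c := .assign 0 a) (k := 1) (t := 1 + q) ⟨le_rfl, fun σ _ => ?_⟩
  refine (Run.assign 0 a σ).exists_le (by rw [hf]) ?_
  · have := hq σ
    simp; omega

theorem id' : PolyTime fun d => d :=
  of_expr (.var 0) .X (fun σ => by simp [Expr.value]) fun _ => rfl

theorem hd' : PolyTime Data.hd :=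
  of_expr (.hd (.var 0)) .X (fun σ => by simpa [Expr.value] using Data.size_hd_le _)
    fun _ => rfl

theorem tl' : PolyTime Data.tl :=
  of_expr (.tl (.var 0)) .X (fun σ => by simpa [Expr.value] using Data.size_tl_le _)
    fun _ => rfl

/-- The expression with value `d`. -/
def _root_.Data.expr : Data → Expr
  | .nil => .nil
  | .cons a b => .cons a.expr b.expr

theorem _root_.Data.expr_value (σ : Store) : ∀ d : Data, d.expr.value σ = d
  | .nil => rfl
  | .cons a b => by simp [Data.expr, Expr.value, Data.expr_value σ a, Data.expr_value σ b]

theorem const (c : Data) : PolyTime fun _ => c :=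
  of_expr c.expr (c.size : Polynomial ℕ)
    (fun σ => by simp [c.expr_value]) fun σ => c.expr_value σ

theorem comp {f g : Data → Data} (hg : PolyTime g) (hf : PolyTime f) :
    PolyTime fun d => g (f d) := by
  obtain ⟨s, hs⟩ := hf.size_le
  obtain ⟨c, k, t, hk, hc⟩ := hf.computes
  obtain ⟨c', k', t', hk', hc'⟩ := hg.computes
  refine Computes.polyTime (c := .seq c c') (k := max k k') (t := t + t'.comp s)
    ⟨by omega, fun σ hσ => ?_⟩
  obtain ⟨n, r, hn⟩ := hc σ fun x hx hxk => hσ x hx (by omega)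
  obtain ⟨n', r', hn'⟩ := hc' (Function.update σ 0 (f (σ 0))) fun x hx hxk => by
    rw [Function.update_of_ne hx.ne']; exact hσ x hx (by omega)
  refine (r.seq r').exists_le (by simp) ?_
  · simp only [Function.update_self] at hn'
    have := t'.eval_mono_nat (hs (σ 0))
    simp only [Polynomial.eval_add, Polynomial.eval_comp]
    omega

theorem cons {f g : Data → Data} (hf : PolyTime f) (hg : PolyTime g) :
    PolyTime fun d => Data.cons (f d) (g d) := by
  obtain ⟨s, hs⟩ := hf.size_le
  obtain ⟨s', hs'⟩ := hg.size_le
  obtain ⟨c, k, t, hk, hc⟩ := hf.computes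
  obtain ⟨c', k', t', hk', hc'⟩ := hg.computes
  obtain ⟨K, hK⟩ : ∃ K, K = max k k' := ⟨_, rfl⟩
  refine Computes.polyTime
    (c := .seq (.assign K (.var 0)) (.seq c (.seq (.assign (K + 1) (.var 0))
      (.seq (.assign 0 (.var K)) (.seq c' (.seq (.assign 0 (.cons (.var (K + 1)) (.var 0)))
      (.seq (.assign K .nil) (.assign (K + 1) .nil))))))))
    (k := K + 2)
    (t := 100 + .X + t + s + .X + t' + s + s')
    ⟨by omega, fun σ hσ => ?_⟩
  have hσ' : ∀ x, 0 < x → x < K + 2 → σ x = Data.nil := hσ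
  obtain ⟨n, r, hn⟩ := hc (Function.update σ K (σ 0)) fun x hx hxk => by
    rw [Function.update_of_ne (by omega)]; exact hσ x hx (by omega)
  obtain ⟨n', r', hn'⟩ := hc'
    (Function.update (Function.update (Function.update σ K (σ 0)) (K + 1) (f (σ 0))) 0 (σ 0))
    fun x hx hxk => by
      rw [Function.update_of_ne (by omega), Function.update_of_ne (by omega),
        Function.update_of_ne (by omega)]
      exact hσ x hx (by omega)
  have hK0 : K ≠ 0 := by omega
  have e1 : (Function.update σ K (σ 0)) 0 = σ 0 := Function.update_of_ne hK0.symm _ _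
  rw [e1] at r hn
  have s1 := Run.assign K (.var 0) σ
  have s2 := Run.assign (K + 1) (.var 0)
    (Function.update (Function.update σ K (σ 0)) 0 (f (σ 0)))
  have s3 := Run.assign 0 (.var K) (Function.update (Function.update (Function.update σ K (σ 0)) 0
    (f (σ 0))) (K + 1) (f (σ 0)))
  simp only [Function.update_self] at r' hn'
  have s4 := Run.assign 0 (.cons (.var (K + 1)) (.var 0)) (Function.update (Function.update
    (Function.update (Function.update σ K (σ 0)) (K + 1) (f (σ 0))) 0 (σ 0)) 0 (g (σ 0)))
  have s5 := Run.assign K .nil (Function.update (Function.update (Function.update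
    (Function.update σ K (σ 0)) (K + 1) (f (σ 0))) 0 (σ 0)) 0 (.cons (f (σ 0)) (g (σ 0))))
  have s6 := Run.assign (K + 1) .nil (Function.update (Function.update (Function.update
    (Function.update (Function.update σ K (σ 0)) (K + 1) (f (σ 0))) 0 (σ 0)) 0
      (.cons (f (σ 0)) (g (σ 0)))) K .nil)
  have hKK : K ≠ K + 1 := by omega
  simp only [Expr.value, Function.update_self, Function.update_of_ne hK0,
    Function.update_of_ne hKK, Function.update_idem,
    Function.update_of_ne (show K + 1 ≠ 0 by omega)] at s1 s2 s3 s4 s5 s6 r'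
  have c1 : Function.update (Function.update (Function.update (Function.update σ K (σ 0)) 0
    (f (σ 0))) (K + 1) (f (σ 0))) 0 (σ 0) = Function.update (Function.update
    (Function.update σ K (σ 0)) (K + 1) (f (σ 0))) 0 (σ 0) := by
    funext x; simp only [Function.update_apply]; grind
  rw [c1] at s3
  refine (s1.seq (r.seq (s2.seq (s3.seq (r'.seq (s4.seq (s5.seq s6))))))).exists_le ?_ ?_
  · funext x
    have := hσ' K (by omega) (by omega)
    have := hσ' (K + 1) (by omega) (by omega)
    simp only [Function.update_apply]; grind
  · have := hs (σ 0)
    have := hs' (σ 0)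
    simp [Data.size] at *
    omega

/-- A case distinction on whether `f` is `nil`. -/
theorem ite {f g h : Data → Data} (hf : PolyTime f) (hg : PolyTime g) (hh : PolyTime h) :
    PolyTime fun d => if (f d).toBool = true then g d else h d := by
  obtain ⟨s, hs⟩ := hf.size_le
  obtain ⟨c, k, t, hk, hc⟩ := hf.computes
  obtain ⟨c', k', t', hk', hc'⟩ := hg.computes
  obtain ⟨c'', k'', t'', hk'', hc''⟩ := hh.computes
  obtain ⟨K, hK⟩ : ∃ K, K = max k (max k' k'') := ⟨_, rfl⟩
  refine Computes.polyTime
    (c := .seq (.assign K (.var 0)) (.seq c (.seq (.assign (K + 1) (.var 0))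
      (.seq (.assign 0 (.var K)) (.seq (.assign K .nil) (.ite (K + 1)
        (.seq (.assign (K + 1) .nil) c') c''))))))
    (k := K + 2)
    (t := 100 + .X + t + s + .X + t' + t'')
    ⟨by omega, fun σ hσ => ?_⟩
  have hσ' : ∀ x, 0 < x → x < K + 2 → σ x = Data.nil := hσ
  obtain ⟨n, r, hn⟩ := hc (Function.update σ K (σ 0)) fun x hx hxk => by
    rw [Function.update_of_ne (by omega)]; exact hσ x hx (by omega)
  obtain ⟨n', r', hn'⟩ := hc' σ fun x hx hxk => hσ x hx (by omega)
  obtain ⟨n'', r'', hn''⟩ := hc'' σ fun x hx hxk => hσ x hx (by omega)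
  have hK0 : K ≠ 0 := by omega
  have hKK : K ≠ K + 1 := by omega
  have e1 : (Function.update σ K (σ 0)) 0 = σ 0 := Function.update_of_ne hK0.symm _ _
  rw [e1] at r hn
  have z1 := hσ' K (by omega) (by omega)
  have z2 := hσ' (K + 1) (by omega) (by omega)
  have s1 := Run.assign K (.var 0) σ
  have s2 := Run.assign (K + 1) (.var 0)
    (Function.update (Function.update σ K (σ 0)) 0 (f (σ 0)))
  have s3 := Run.assign 0 (.var K) (Function.update (Function.update (Function.update σ K (σ 0)) 0
    (f (σ 0))) (K + 1) (f (σ 0)))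
  have s4 := Run.assign K .nil (Function.update (Function.update (Function.update
    (Function.update σ K (σ 0)) 0 (f (σ 0))) (K + 1) (f (σ 0))) 0 (σ 0))
  have c1 : Function.update (Function.update (Function.update (Function.update
    (Function.update σ K (σ 0)) 0 (f (σ 0))) (K + 1) (f (σ 0))) 0 (σ 0)) K Data.nil =
      Function.update σ (K + 1) (f (σ 0)) := by
    funext x; simp only [Function.update_apply]; grind
  have s5 := Run.assign (K + 1) .nil (Function.update σ (K + 1) (f (σ 0)))
  have c2 : Function.update (Function.update σ (K + 1) (f (σ 0))) (K + 1) Data.nil = σ := by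
    funext x; simp only [Function.update_apply]; grind
  simp only [Expr.value, Function.update_self, Function.update_of_ne hK0,
    Function.update_of_ne hKK, c1, c2] at s1 s2 s3 s4 s5
  have pre := fun {m ρ} (last : Run (.ite (K + 1) (.seq (.assign (K + 1) .nil) c') c'')
      (Function.update σ (K + 1) (f (σ 0))) m ρ) =>
    s1.seq (r.seq (s2.seq (s3.seq (s4.seq last))))
  have := hs (σ 0)
  by_cases hb : f (σ 0) = Data.nil
  · have c3 : Function.update σ (K + 1) (f (σ 0)) = σ := by
      rw [hb, ← z2, Function.update_eq_self]
    refine (pre (.ite_false (by simpa using hb) (by rw [c3]; exact r''))).exists_le ?_ ?_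
    · beta_reduce
      rw [if_neg (by simp [hb, Data.toBool])]
    · simp [Data.size] at *
      omega
  · refine (pre (.ite_true (by simpa using hb) (s5.seq r'))).exists_le ?_ ?_
    · beta_reduce
      rw [if_pos (by cases hd : f (σ 0) <;> simp_all [Data.toBool])]
    · simp [Data.size] at *
      omega

end PolyTime

namespace Data

/-- The members of a tree read as a list. -/
def toList : Data → List Data
  | nil => []
  | cons a b => a :: b.toList

theorem list_toList : ∀ d : Data, list d.toList = d
  | nil => rfl
  | cons a b => by simpa [toList, list] using list_toList b

@[simp] theorem toList_list : ∀ l : List Data, (list l).toList = l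
  | [] => rfl
  | a :: l => by simpa [toList, list] using toList_list l

theorem length_toList_le : ∀ d : Data, d.toList.length ≤ d.size
  | nil => by simp [toList]
  | cons a b => by
    have := length_toList_le b
    simp [toList, size]; omega

end Data

namespace Cmd

theorem Computes.run_loop {c : Cmd} {K : ℕ} {F : Data → Data} {t : Polynomial ℕ}
    (h : Computes c K F t) (s B : ℕ) : ∀ (l : Data) (σ : Store), σ K = l →
    (∀ x, 0 < x → x < K → σ x = Data.nil) → l.size ≤ s →
    (∀ i ≤ l.toList.length, (F^[i] (σ 0)).size ≤ B) →
    ∃ n, Run (.loop K (.seq c (.assign K (.tl (.var K))))) σ n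
      (Function.update (Function.update σ K .nil) 0 (F^[l.toList.length] (σ 0))) ∧
      n ≤ l.toList.length * (t.eval B + 2 + s) + 1
  | .nil, σ, hK, _, _, _ => by
    refine (Run.loop_done hK).exists_le ?_ (by simp [Data.toList])
    rw [← hK]
    simp [Data.toList, hK]
    rw [← hK]; simp
  | .cons a l, σ, hK, hσ, hs, hB => by
    have hK0 : K ≠ 0 := by have := h.1; omega
    simp only [Data.size] at hs
    obtain ⟨n, r, hn⟩ := h.2 σ hσ
    have r₁ := Run.assign K (.tl (.var K)) (Function.update σ 0 (F (σ 0)))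
    simp only [Expr.value, Function.update_of_ne hK0, hK, Data.tl] at r₁
    obtain ⟨m, r₂, hm⟩ := h.run_loop s B l
      (Function.update (Function.update σ 0 (F (σ 0))) K l) (by simp)
      (fun x hx hxK => by
        rw [Function.update_of_ne (by omega), Function.update_of_ne (by omega)]
        exact hσ x hx hxK) (by omega)
      (fun i hi => by
        have := hB (i + 1) (by simpa [Data.toList] using hi)
        simpa [Function.update_of_ne hK0.symm] using this)
    refine (Run.loop_step (by simp [hK]) (r.seq r₁) r₂).exists_le ?_ ?_
    · funext x
      simp only [Function.update_apply, Data.toList, List.length_cons, Function.iterate_succ,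
        Function.comp_apply]
      grind
    · have h0 := t.eval_mono_nat (hB 0 (Nat.zero_le _))
      simp only [Function.iterate_zero, id_eq] at h0
      simp only [Data.toList, List.length_cons, Nat.add_mul]
      omega

end Cmd

namespace PolyTime

/-- Bounded iteration: `F` is applied as often as the list `G d` is long. Polynomial time is
preserved when all intermediate results have polynomial size. -/
theorem iterate {F G I : Data → Data} (hF : PolyTime F) (hG : PolyTime G) (hI : PolyTime I)
    (hs : ∃ s : Polynomial ℕ, ∀ d, ∀ i ≤ (G d).toList.length, (F^[i] (I d)).size ≤ s.eval d.size) :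
    PolyTime fun d => F^[(G d).toList.length] (I d) := by
  obtain ⟨s, hs⟩ := hs
  obtain ⟨u, hu⟩ := hG.size_le
  obtain ⟨v, hv⟩ := hI.size_le
  obtain ⟨c, k, t, hc⟩ := hF.computes
  obtain ⟨c', k', t', hc'⟩ := (hG.cons hI).computes
  obtain ⟨K, hK⟩ : ∃ K, K = max k k' := ⟨_, rfl⟩
  replace hc := hc.mono (show k ≤ K by omega)
  replace hc' := hc'.mono (show k' ≤ K by omega)
  have hK0 : K ≠ 0 := by have := hc.1; omega
  -- register `K`, out of reach of `c`, holds the list that counts the rounds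
  refine Cmd.Computes.polyTime
    (c := .seq c' (.seq (.assign K (.hd (.var 0))) (.seq (.assign 0 (.tl (.var 0)))
      (.loop K (.seq c (.assign K (.tl (.var K))))))))
    (k := K + 1) (t := 100 + t' + u + v + u * (t.comp s + 2 + u)) ⟨by omega, fun σ hσ => ?_⟩
  obtain ⟨n, r, hn⟩ := hc'.2 σ fun x hx hxK => hσ x hx (by omega)
  have r₁ := Cmd.Run.assign K (.hd (.var 0)) (Function.update σ 0 ((G (σ 0)).cons (I (σ 0))))
  have r₂ := Cmd.Run.assign 0 (.tl (.var 0)) (Function.update (Function.update σ 0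
    ((G (σ 0)).cons (I (σ 0)))) K (G (σ 0)))
  simp only [Expr.value, Function.update_self, Function.update_of_ne hK0.symm, Data.hd,
    Data.tl] at r₁ r₂
  obtain ⟨m, r₃, hm⟩ := hc.run_loop (u.eval (σ 0).size) (s.eval (σ 0).size) (G (σ 0))
    (Function.update (Function.update (Function.update σ 0
      ((G (σ 0)).cons (I (σ 0)))) K (G (σ 0))) 0 (I (σ 0)))
    (by rw [Function.update_of_ne hK0]; simp) (fun x hx hxK => by
      rw [Function.update_of_ne (by omega), Function.update_of_ne (by omega),
        Function.update_of_ne (by omega)]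
      exact hσ x hx (by omega)) (hu _) (fun i hi => by simpa using hs (σ 0) i hi)
  refine (r.seq (r₁.seq (r₂.seq r₃))).exists_le ?_ ?_
  · have := hσ K (by omega) (by omega)
    funext x
    simp only [Function.update_apply]
    grind
  · have h1 := hu (σ 0)
    have h2 := hv (σ 0)
    have h3 := Nat.mul_le_mul_right (t.eval (s.eval (σ 0).size) + 2 + u.eval (σ 0).size)
      ((Data.length_toList_le (G (σ 0))).trans h1)
    simp only [Polynomial.eval_add, Polynomial.eval_comp, Polynomial.eval_mul,
      Polynomial.eval_ofNat]
    omega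

end PolyTime

/-! ### Polynomial-time list processing -/

attribute [fun_prop] PolyTime

namespace PolyTime

attribute [fun_prop] id' const comp cons ite

@[fun_prop] theorem hd {f : Data → Data} (hf : PolyTime f) : PolyTime fun d => (f d).hd :=
  hd'.comp hf

@[fun_prop] theorem tl {f : Data → Data} (hf : PolyTime f) : PolyTime fun d => (f d).tl :=
  tl'.comp hf

/-- Substitution into a function of two variables. -/
theorem comp₂ {F : Data → Data → Data} (hF : PolyTime fun p => F p.hd p.tl) {f g : Data → Data}
    (hf : PolyTime f) (hg : PolyTime g) : PolyTime fun d => F (f d) (g d) :=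
  hF.comp (hf.cons hg)

/-- Substitution into a function of three variables. -/
theorem comp₃ {F : Data → Data → Data → Data} (hF : PolyTime fun p => F p.hd p.tl.hd p.tl.tl)
    {f g h : Data → Data} (hf : PolyTime f) (hg : PolyTime g) (hh : PolyTime h) :
    PolyTime fun d => F (f d) (g d) (h d) :=
  hF.comp (hf.cons (hg.cons hh))

end PolyTime

namespace Data

/-- The length of a tree read as a list. -/
def len (d : Data) : ℕ := d.toList.length

theorem len_le_size (d : Data) : d.len ≤ d.size := length_toList_le d

@[simp] theorem len_list (l : List Data) : (list l).len = l.length := by simp [len]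

@[simp] theorem len_unary (n : ℕ) : (unary n).len = n := by simp [unary]

@[simp] theorem len_bits (l : List Bool) : (bits l).len = l.length := by simp [bits]

@[simp] theorem size_unary (n : ℕ) : (unary n).size = 2 * n + 1 := by
  induction n with
  | zero => rfl
  | succ n ih =>
    have : unary (n + 1) = cons nil (unary n) := rfl
    rw [this, size, ih, size]; omega

@[simp] theorem hd_cons (a b : Data) : (cons a b).hd = a := rfl

@[simp] theorem tl_cons (a b : Data) : (cons a b).tl = b := rfl

theorem tl_eq_list (d : Data) : d.tl = list d.toList.tail := by
  cases d with
  | nil => rfl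
  | cons a b => simp [tl, toList, list_toList]

theorem iterate_tl (d : Data) (n : ℕ) : tl^[n] d = list (d.toList.drop n) := by
  induction n generalizing d with
  | zero => simp [list_toList]
  | succ n ih =>
    rw [Function.iterate_succ_apply, ih, tl_eq_list, toList_list, List.drop_tail]

theorem size_list_append (l l' : List Data) :
    (list (l ++ l')).size + 1 = (list l).size + (list l').size := by
  induction l with
  | nil => simp [list, size]; omega
  | cons a l ih =>
    simp only [list, List.cons_append, List.foldr_cons, size] at ih ⊢
    omega

theorem size_le_of_mem {x : Data} : ∀ {l : List Data}, x ∈ l → x.size ≤ (list l).size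
  | a :: l, h => by
    simp only [list, List.foldr_cons, size]
    rcases List.mem_cons.1 h with rfl | h
    · omega
    · have := size_le_of_mem h
      simp only [list] at this; omega

theorem size_le_of_mem_toList {x d : Data} (h : x ∈ d.toList) : x.size ≤ d.size := by
  simpa [list_toList] using size_le_of_mem h

theorem size_iterate_tl_le (d : Data) (n : ℕ) : (tl^[n] d).size ≤ d.size := by
  induction n generalizing d with
  | zero => simp
  | succ n ih => exact (ih d.tl).trans (size_tl_le d)

@[simp] theorem toBool_ofBool (b : Bool) : (ofBool b).toBool = b := by cases b <;> rfl

theorem hd_list (l : List Data) : (list l).hd = l.headD nil := by cases l <;> rfl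

end Data

namespace PolyTime

open Data

/-- A fold whose intermediate results have polynomial size. -/
theorem foldl {G I : Data → Data} {F : Data → Data → Data → Data} (hG : PolyTime G)
    (hI : PolyTime I) (hF : PolyTime fun p => F p.hd p.tl.hd p.tl.tl)
    (hs : ∃ s : Polynomial ℕ, ∀ d i,
      (((G d).toList.take i).foldl (F d) (I d)).size ≤ s.eval d.size) :
    PolyTime fun d => (G d).toList.foldl (F d) (I d) := by
  obtain ⟨s, hs⟩ := hs
  obtain ⟨u, hu⟩ := hG.size_le
  -- the state consists of the parameters, the rest of the list, and the accumulator
  let step : Data → Data := fun p =>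
    Data.cons p.hd (Data.cons p.tl.hd.tl (F p.hd p.tl.tl p.tl.hd.hd))
  have hstep : PolyTime step := by
    have := comp₃ hF (f := fun p => p.hd) (g := fun p => p.tl.tl) (h := fun p => p.tl.hd.hd)
      (by fun_prop) (by fun_prop) (by fun_prop)
    exact hd'.cons (PolyTime.cons (by fun_prop) this)
  have key : ∀ d i, i ≤ (G d).toList.length → step^[i] (Data.cons d (Data.cons (G d) (I d))) =
      Data.cons d (Data.cons (Data.tl^[i] (G d)) (((G d).toList.take i).foldl (F d) (I d))) := by
    intro d i hi
    induction i with
    | zero => simp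
    | succ i ih =>
      rw [Function.iterate_succ_apply', ih (by omega), Function.iterate_succ_apply',
        List.take_succ_eq_append_getElem (by omega), List.foldl_append]
      simp only [step, hd_cons, tl_cons, List.foldl_cons, List.foldl_nil]
      rw [iterate_tl, Data.hd_list, List.drop_eq_getElem_cons (by omega)]
      rfl
  have := (iterate hstep hG (I := fun d => Data.cons d (Data.cons (G d) (I d)))
    (by fun_prop) ⟨.X + u + s + 2, fun d i hi => ?_⟩).tl.tl
  · convert this using 2 with d
    rw [key d _ le_rfl]
    simp [Data.tl]
  · rw [key d i hi]
    have h1 := hs d i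
    have h2 := (size_iterate_tl_le (G d) i).trans (hu d)
    simp [Data.size]
    omega

/-- A fold whose step has output of size polynomial in the parameters alone. -/
theorem foldl_of_bounded {G I : Data → Data} {F : Data → Data → Data → Data} (hG : PolyTime G)
    (hI : PolyTime I) (hF : PolyTime fun p => F p.hd p.tl.hd p.tl.tl)
    (hs : ∃ s : Polynomial ℕ, ∀ d a x, (F d a x).size ≤ s.eval d.size) :
    PolyTime fun d => (G d).toList.foldl (F d) (I d) := by
  obtain ⟨s, hs⟩ := hs
  obtain ⟨u, hu⟩ := hI.size_le
  refine foldl hG hI hF ⟨u + s, fun d i => ?_⟩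
  rw [Polynomial.eval_add]
  rcases List.eq_nil_or_concat ((G d).toList.take i) with h | ⟨l, b, h⟩
  · rw [h]; have := hu d; simp; omega
  · rw [h, List.concat_eq_append, List.foldl_append]
    have := hs d (l.foldl (F d) (I d)) b
    simp; omega

/-- A fold whose step adds a polynomial amount to the size of the accumulator. -/
theorem foldl_of_additive {G I : Data → Data} {F : Data → Data → Data → Data} (hG : PolyTime G)
    (hI : PolyTime I) (hF : PolyTime fun p => F p.hd p.tl.hd p.tl.tl)
    (hs : ∃ s : Polynomial ℕ, ∀ d a, ∀ x ∈ (G d).toList, (F d a x).size ≤ a.size + s.eval d.size) :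
    PolyTime fun d => (G d).toList.foldl (F d) (I d) := by
  obtain ⟨s, hs⟩ := hs
  obtain ⟨u, hu⟩ := hI.size_le
  obtain ⟨v, hv⟩ := hG.size_le
  refine foldl hG hI hF ⟨u + v * s, fun d i => ?_⟩
  have key : ∀ (l : List Data) (a : Data), (∀ x ∈ l, x ∈ (G d).toList) →
      (l.foldl (F d) a).size ≤ a.size + l.length * s.eval d.size := by
    intro l
    induction l with
    | nil => simp
    | cons x l ih =>
      intro a hl
      have h1 := ih (F d a x) fun y hy => hl y (List.mem_cons_of_mem _ hy)
      have h2 := hs d a x (hl x List.mem_cons_self)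
      simp only [List.foldl_cons, List.length_cons, Nat.add_mul]
      omega
  refine (key _ _ fun x hx => List.mem_of_mem_take hx).trans ?_
  rw [Polynomial.eval_add, Polynomial.eval_mul]
  have h1 : ((G d).toList.take i).length ≤ v.eval d.size :=
    (List.length_take_le' _ _).trans ((length_toList_le _).trans (hv d))
  have := Nat.mul_le_mul_right (s.eval d.size) h1
  have := hu d
  omega

@[fun_prop] theorem reverse {G : Data → Data} (hG : PolyTime G) :
    PolyTime fun d => list (G d).toList.reverse := by
  obtain ⟨v, hv⟩ := hG.size_le
  have := foldl_of_additive (F := fun _ a x => Data.cons x a) hG (const .nil) (by fun_prop)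
    ⟨v + 1, fun d a x hx => by
      have := size_le_of_mem_toList hx
      have := hv d
      simp [size]; omega⟩
  convert this using 2 with d
  simp [list]

theorem map {G : Data → Data} {F : Data → Data → Data} (hG : PolyTime G)
    (hF : PolyTime fun p => F p.hd p.tl) : PolyTime fun d => list ((G d).toList.map (F d)) := by
  obtain ⟨v, hv⟩ := hG.size_le
  obtain ⟨w, hw⟩ := hF.size_le
  have h3 := comp₂ hF (f := fun p => p.hd) (g := fun p => p.tl.tl) (by fun_prop) (by fun_prop)
  have := foldl_of_additive (F := fun d a x => Data.cons (F d x) a) hG (const .nil)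
    (h3.cons (by fun_prop))
    ⟨w.comp (.X + v + 1) + 1, fun d a x hx => by
      have h1 := size_le_of_mem_toList hx
      have h2 := hv d
      have h3 := (hw (Data.cons d x)).trans (w.eval_mono_nat (n := d.size + v.eval d.size + 1)
        (by simp [size]; omega))
      simp [size, Data.hd, Data.tl] at h3 ⊢; omega⟩
  convert this.reverse using 2 with d
  congr 1
  have key : ∀ (l : List Data) (a : List Data),
      l.foldl (fun a x => Data.cons (F d x) a) (list a) = list ((l.map (F d)).reverse ++ a) := by
    intro l
    induction l with
    | nil => simp
    | cons x l ih => intro a; simpa [list] using ih (F d x :: a)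
  have := key (G d).toList []
  change _ = (List.foldl _ (list []) _).toList.reverse
  rw [this]
  simp

theorem filter {G : Data → Data} {P : Data → Data → Data} (hG : PolyTime G)
    (hP : PolyTime fun p => P p.hd p.tl) :
    PolyTime fun d => list ((G d).toList.filter fun x => (P d x).toBool) := by
  obtain ⟨v, hv⟩ := hG.size_le
  have h3 := comp₂ hP (f := fun p => p.hd) (g := fun p => p.tl.tl) (by fun_prop) (by fun_prop)
  have := foldl_of_additive
    (F := fun d a x => if (P d x).toBool = true then Data.cons x a else a) hG (const .nil)
    (ite h3 (by fun_prop) (by fun_prop))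
    ⟨v + 1, fun d a x hx => by
      have h1 := size_le_of_mem_toList hx
      have h2 := hv d
      split
      · simp [size]; omega
      · omega⟩
  convert this.reverse using 2 with d
  congr 1
  have key : ∀ (l : List Data) (a : List Data),
      l.foldl (fun a x => if (P d x).toBool = true then Data.cons x a else a) (list a) =
        list ((l.filter fun x => (P d x).toBool).reverse ++ a) := by
    intro l
    induction l with
    | nil => simp
    | cons x l ih =>
      intro a
      by_cases hx : (P d x).toBool = true
      · simpa [list, hx] using ih (x :: a)
      · simpa [list, hx] using ih a
  have := key (G d).toList []
  change _ = (List.foldl _ (list []) _).toList.reverse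
  rw [this]
  simp

end PolyTime

namespace Data

/-- Concatenation of lists. -/
def append (a b : Data) : Data := list (a.toList ++ b.toList)

/-- The list `d` without its first `n.len` members. -/
def drop (n d : Data) : Data := list (d.toList.drop n.len)

/-- The first `n.len` members of the list `d`. -/
def take (n d : Data) : Data := list (d.toList.take n.len)

/-- The member with index `n.len` of the list `d`. -/
def get (d n : Data) : Data := d.nth n.len

/-- The product of two unary numbers. -/
def mul (a b : Data) : Data := unary (a.len * b.len)

theorem unary_add (m n : ℕ) : append (unary m) (unary n) = unary (m + n) := by
  simp [append, unary]

end Data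

namespace PolyTime

open Data

@[fun_prop] theorem append {f g : Data → Data} (hf : PolyTime f) (hg : PolyTime g) :
    PolyTime fun d => Data.append (f d) (g d) := by
  obtain ⟨v, hv⟩ := hf.size_le
  have := foldl_of_additive (F := fun _ a x => Data.cons x a) hf.reverse hg (by fun_prop)
    ⟨v + 1, fun d a x hx => by
      have := size_le_of_mem_toList (d := f d) (x := x) (by simpa using hx)
      have := hv d
      simp [size]; omega⟩
  convert this using 2 with d
  rw [toList_list, List.foldl_reverse]
  conv_rhs => rw [← list_toList (g d)]
  simp [Data.append, list]

@[fun_prop] theorem drop {f g : Data → Data} (hf : PolyTime f) (hg : PolyTime g) :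
    PolyTime fun d => Data.drop (f d) (g d) := by
  obtain ⟨v, hv⟩ := hg.size_le
  have := iterate tl' hf hg ⟨v, fun d i _ => (size_iterate_tl_le _ _).trans (hv d)⟩
  convert this using 2 with d
  rw [iterate_tl]; rfl

@[fun_prop] theorem take {f g : Data → Data} (hf : PolyTime f) (hg : PolyTime g) :
    PolyTime fun d => Data.take (f d) (g d) := by
  have : PolyTime fun d => list (Data.drop (Data.drop (f d) (g d))
      (list (g d).toList.reverse)).toList.reverse := by fun_prop
  convert this using 2 with d
  simp only [Data.drop, Data.take, toList_list, len_list, List.length_drop, List.drop_reverse,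
    List.reverse_reverse]
  congr 1
  by_cases h : (f d).len ≤ (g d).toList.length
  · rw [show (g d).toList.length - ((g d).toList.length - (f d).len) = (f d).len by omega]
  · rw [List.take_of_length_le (by omega), List.take_of_length_le (by omega)]

@[fun_prop] theorem get {f g : Data → Data} (hf : PolyTime f) (hg : PolyTime g) :
    PolyTime fun d => Data.get (f d) (g d) := by
  have : PolyTime fun d => (Data.drop (g d) (f d)).hd := by fun_prop
  convert this using 2 with d
  rw [Data.drop, ← iterate_tl]; rfl

/-- The length of a list, in unary. -/
@[fun_prop] theorem unary_len {f : Data → Data} (hf : PolyTime f) :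
    PolyTime fun d => unary (f d).len := by
  have := map hf (F := fun _ _ => .nil) (const .nil)
  convert this using 2 with d
  simp [unary, len]

@[fun_prop] theorem mul {f g : Data → Data} (hf : PolyTime f) (hg : PolyTime g) :
    PolyTime fun d => Data.mul (f d) (g d) := by
  obtain ⟨v, hv⟩ := hg.size_le
  have hG : PolyTime fun p : Data => g p.hd := hg.comp (by fun_prop)
  have := foldl_of_additive (F := fun d a _ => Data.append (g d) a) hf (const .nil)
    (by fun_prop) ⟨v, fun d a x hx => by
      have := size_list_append (g d).toList a.toList
      rw [list_toList, list_toList] at this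
      have := hv d
      simp only [Data.append]; omega⟩
  convert this.unary_len using 2 with d
  rw [Data.mul]
  congr 1
  have key : ∀ (l : List Data) (a : Data), (l.foldl (fun a _ => Data.append (g d) a) a).len =
      l.length * (g d).len + a.len := by
    intro l
    induction l with
    | nil => simp
    | cons x l ih =>
      intro a
      rw [List.foldl_cons, ih]
      simp [Data.append, len]; ring
  rw [key]
  simp [len, toList]

/-- Polynomials of unary numbers. -/
@[fun_prop] theorem unary_eval (q : Polynomial ℕ) {f : Data → Data} (hf : PolyTime f) :
    PolyTime fun d => unary (q.eval (f d).len) := by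
  induction q using Polynomial.induction_on' with
  | add p q hp hq =>
    convert hp.append hq using 2 with d
    rw [unary_add, Polynomial.eval_add]
  | monomial n a =>
    induction n with
    | zero => simpa using const _
    | succ n ih =>
      convert ih.mul hf using 2 with d
      simp [Data.mul, pow_succ, mul_assoc]

end PolyTime

/-! ### Arithmetic in encoded groups -/

namespace Data

/-- The natural number with the given binary digits, most significant digit first. -/
def natOfBits (l : List Bool) : ℕ := l.foldl (fun a b => 2 * a + b.toNat) 0

/-- The list of the unary numbers `0, …, n.len - 1`. -/
def iota (n : Data) : Data := list ((List.range n.len).map unary)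

/-- A truth value that is true if the first of two unary numbers is smaller than the second. -/
def lt (m n : Data) : Data := drop m n

/-- A truth value that is true if two unary numbers differ. -/
def ne (m n : Data) : Data := append (lt m n) (lt n m)

theorem toBool_list (l : List Data) : (list l).toBool = !l.isEmpty := by cases l <;> rfl

@[simp] theorem toBool_lt (m n : Data) : (lt m n).toBool = decide (m.len < n.len) := by
  rw [lt, drop, toBool_list, Bool.eq_iff_iff]
  simp only [Bool.not_eq_true', List.isEmpty_eq_false_iff, ne_eq,
    List.drop_eq_nil_iff, not_le, decide_eq_true_eq]
  rfl

@[simp] theorem toBool_ne (m n : Data) : (ne m n).toBool = decide (m.len ≠ n.len) := by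
  have h1 := toBool_lt m n
  have h2 := toBool_lt n m
  rw [← list_toList (lt m n), toBool_list] at h1
  rw [← list_toList (lt n m), toBool_list] at h2
  have h3 : ∀ l l' : List Data, (!(l ++ l').isEmpty) = ((!l.isEmpty) || !l'.isEmpty) := by
    intro l l'; cases l <;> simp
  rw [ne, append, toBool_list, h3, h1, h2, ← Bool.decide_or]
  exact decide_eq_decide.2 (by omega)

theorem size_list_map_unary {B : ℕ} : ∀ l : List ℕ, (∀ k ∈ l, k ≤ B) →
    (list (l.map unary)).size ≤ 1 + l.length * (2 * B + 2)
  | [], _ => by simp [list, size]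
  | a :: l, h => by
    have h1 := size_list_map_unary l fun k hk => h k (List.mem_cons_of_mem _ hk)
    have h2 := h a List.mem_cons_self
    simp only [list, List.map_cons, List.foldr_cons, size, size_unary, List.length_cons,
      Nat.add_mul] at h1 ⊢
    omega

end Data

namespace PolyTime

open Data

@[fun_prop] theorem nth {f : Data → Data} (hf : PolyTime f) (k : ℕ) :
    PolyTime fun d => (f d).nth k := by
  convert hf.get (const (unary k)) using 2 with d
  rw [Data.get, len_unary]

@[fun_prop] theorem lt {f g : Data → Data} (hf : PolyTime f) (hg : PolyTime g) :
    PolyTime fun d => Data.lt (f d) (g d) := hf.drop hg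

@[fun_prop] theorem ne {f g : Data → Data} (hf : PolyTime f) (hg : PolyTime g) :
    PolyTime fun d => Data.ne (f d) (g d) := (hf.lt hg).append (hg.lt hf)

@[fun_prop] theorem list_cons {f : Data → Data} {g : Data → List Data} (hf : PolyTime f)
    (hg : PolyTime fun d => list (g d)) : PolyTime fun d => list (f d :: g d) := hf.cons hg

@[fun_prop] theorem iota {f : Data → Data} (hf : PolyTime f) :
    PolyTime fun d => Data.iota (f d) := by
  obtain ⟨v, hv⟩ := hf.size_le
  have key : ∀ l : List Data, l.foldl (fun a _ => Data.cons (unary a.len) a) .nil =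
      list ((List.range l.length).reverse.map unary) := by
    intro l
    induction l using List.reverseRecOn with
    | nil => rfl
    | append_singleton l x ih =>
      rw [List.foldl_append, ih, List.foldl_cons, List.foldl_nil, len_list]
      simp [List.range_succ]
      rfl
  have := foldl (F := fun _ a _ => Data.cons (unary a.len) a) hf (const .nil) (by fun_prop)
    ⟨1 + v * (2 * v + 2), fun d i => by
      have h1 : ((f d).toList.take i).length ≤ v.eval d.size :=
        (List.length_take_le' _ _).trans ((length_toList_le _).trans (hv d))
      rw [key]
      refine (size_list_map_unary (B := v.eval d.size) _ ?_).trans ?_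
      · intro k hk
        simp only [List.mem_reverse, List.mem_range] at hk
        omega
      · simp only [List.length_reverse, List.length_range, Polynomial.eval_add,
          Polynomial.eval_mul, Polynomial.eval_one, Polynomial.eval_ofNat]
        gcongr⟩
  convert this.reverse using 2 with d
  rw [key, toList_list, ← List.map_reverse, List.reverse_reverse]
  rfl

end PolyTime

/-- Programs for the group operations, the pairing, the hash family and the number of users. -/
structure Tools {𝒢 : GroupGenerator} (ℋ : HashFamily 𝒢) (L : ℕ → ℕ) where
  mulOp : Data → Data
  invOp : Data → Data
  pairOp : Data → Data
  keyLenOp : Data → Data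
  hashOp : Data → Data
  countOp : Data → Data
  mulOp_poly : PolyTime mulOp
  invOp_poly : PolyTime invOp
  pairOp_poly : PolyTime pairOp
  keyLenOp_poly : PolyTime keyLenOp
  hashOp_poly : PolyTime hashOp
  countOp_poly : PolyTime countOp
  mulOp_size : ∃ s : Polynomial ℕ, ∀ d x : Data, (mulOp (.cons d x)).size ≤ s.eval d.size
  mulOp_eq : ∀ (I : 𝒢.Inst) (x y : (𝒢.grp I).G),
    mulOp (.cons (𝒢.grp I).desc (Data.list [(𝒢.grp I).enc x, (𝒢.grp I).enc y])) =
      (𝒢.grp I).enc (x * y)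
  invOp_eq : ∀ (I : 𝒢.Inst) (x : (𝒢.grp I).G),
    invOp (.cons (𝒢.grp I).desc ((𝒢.grp I).enc x)) = (𝒢.grp I).enc x⁻¹
  pairOp_eq : ∀ (I : 𝒢.Inst) (x y : (𝒢.grp I).G),
    pairOp (.cons (𝒢.grp I).desc (Data.list [(𝒢.grp I).enc x, (𝒢.grp I).enc y])) =
      (𝒢.grp I).encT ((𝒢.grp I).e x y)
  keyLenOp_eq : ∀ (κ : ℕ) (I : 𝒢.Inst),
    keyLenOp (.cons (Data.list [Data.unary κ, (𝒢.grp I).desc]) .nil) =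
      Data.unary (ℋ.keyLen κ I)
  hashOp_eq : ∀ (κ : ℕ) (I : 𝒢.Inst) (k : Fin (ℋ.keyLen κ I) → Bool) (x : (𝒢.grp I).GT),
    hashOp (.cons (Data.list [Data.unary κ, (𝒢.grp I).desc])
      (Data.list [Data.bits (List.ofFn k), (𝒢.grp I).encT x])) =
      Data.bits (List.ofFn (ℋ.hash κ I k x))
  countOp_eq : ∀ κ, countOp (Data.unary κ) = Data.unary (L κ)

theorem Tools.nonempty {𝒢 : GroupGenerator} (ℋ : HashFamily 𝒢) {L : ℕ → ℕ}
    (hL : EfficientCount L) : Nonempty (Tools ℋ L) := by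
  obtain ⟨f₁, h₁, s₁, e₁⟩ := 𝒢.mul_eff
  obtain ⟨f₂, h₂, -, e₂⟩ := 𝒢.inv_eff
  obtain ⟨f₃, h₃, -, e₃⟩ := 𝒢.pair_eff
  obtain ⟨f₄, h₄, -, e₄⟩ := ℋ.keyLen_eff
  obtain ⟨f₅, h₅, -, e₅⟩ := ℋ.hash_eff
  obtain ⟨f₆, h₆, e₆⟩ := hL
  exact ⟨⟨f₁, f₂, f₃, f₄, f₅, f₆, h₁, h₂, h₃, h₄, h₅, h₆, s₁, fun I x y => e₁ ⟨I, x, y⟩,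
    fun I x => e₂ ⟨I, x⟩, fun I x y => e₃ ⟨I, x, y⟩, fun κ I => e₄ (κ, I),
    fun κ I k x => e₅ ⟨(κ, I), k, x⟩, e₆⟩⟩

namespace Tools

open Data

variable {𝒢 : GroupGenerator} {ℋ : HashFamily 𝒢} {L : ℕ → ℕ} (T : Tools ℋ L)

/-- The product in `G`, for the groups with description `D`. -/
def mul (D x y : Data) : Data := T.mulOp (.cons D (list [x, y]))

/-- The inverse in `G`. -/
def inv (D x : Data) : Data := T.invOp (.cons D x)

/-- The pairing. -/
def pair (D x y : Data) : Data := T.pairOp (.cons D (list [x, y]))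

/-- The neutral element, obtained from the generator in the description of the group. -/
def one (D : Data) : Data := T.mul D (D.nth 2) (T.inv D (D.nth 2))

/-- The power of `x` with an exponent given in binary, by square and multiply. -/
def pow (D x b : Data) : Data :=
  b.toList.foldl (fun a c =>
    if c.toBool = true then T.mul D (T.mul D a a) x else T.mul D a a) (T.one D)

/-- The power of `x` with exponent `b ^ k`, for `b` in binary and `k` in unary. -/
def powIter (D x b k : Data) : Data :=
  k.toList.foldl (fun a _ => T.pow D a b) (T.mul D x (T.one D))

/-- A product indexed by a list. -/
def prod (D : Data) (f : Data → Data) (l : Data) : Data :=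
  l.toList.foldl (fun a k => T.mul D a (f k)) (T.one D)

theorem size_mul_le : ∃ s : Polynomial ℕ, ∀ D x y, (T.mul D x y).size ≤ s.eval D.size := by
  obtain ⟨s, hs⟩ := T.mulOp_size
  exact ⟨s, fun D x y => hs _ _⟩

theorem size_pow_le : ∃ s : Polynomial ℕ, ∀ D x b, (T.pow D x b).size ≤ s.eval D.size := by
  obtain ⟨s, hs⟩ := T.size_mul_le
  refine ⟨s, fun D x b => ?_⟩
  rw [pow]
  rcases List.eq_nil_or_concat b.toList with h | ⟨l, c, h⟩
  · rw [h]; exact hs _ _ _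
  · rw [h, List.concat_eq_append, List.foldl_append, List.foldl_cons, List.foldl_nil]
    split <;> exact hs _ _ _

section PolyTime

variable {D x y b k : Data → Data}

@[fun_prop] theorem polyTime_mul (hD : PolyTime D) (hx : PolyTime x) (hy : PolyTime y) :
    PolyTime fun d => T.mul (D d) (x d) (y d) :=
  T.mulOp_poly.comp (hD.cons (hx.cons (hy.cons (.const .nil))))

@[fun_prop] theorem polyTime_inv (hD : PolyTime D) (hx : PolyTime x) :
    PolyTime fun d => T.inv (D d) (x d) :=
  T.invOp_poly.comp (hD.cons hx)

@[fun_prop] theorem polyTime_pair (hD : PolyTime D) (hx : PolyTime x) (hy : PolyTime y) :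
    PolyTime fun d => T.pair (D d) (x d) (y d) :=
  T.pairOp_poly.comp (hD.cons (hx.cons (hy.cons (.const .nil))))

@[fun_prop] theorem polyTime_one (hD : PolyTime D) : PolyTime fun d => T.one (D d) := by
  unfold one; fun_prop

@[fun_prop] theorem polyTime_pow (hD : PolyTime D) (hx : PolyTime x) (hb : PolyTime b) :
    PolyTime fun d => T.pow (D d) (x d) (b d) := by
  obtain ⟨s, hs⟩ := T.size_mul_le
  obtain ⟨v, hv⟩ := hD.size_le
  have hD' : PolyTime fun p : Data => D p.hd := hD.comp (by fun_prop)
  have hx' : PolyTime fun p : Data => x p.hd := hx.comp (by fun_prop)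
  refine PolyTime.foldl_of_bounded (F := fun d a c => if c.toBool = true then
    T.mul (D d) (T.mul (D d) a a) (x d) else T.mul (D d) a a) hb (by fun_prop) (by fun_prop)
    ⟨s.comp v, fun d a c => ?_⟩
  rw [Polynomial.eval_comp]
  split <;> exact (hs _ _ _).trans (s.eval_mono_nat (hv d))

@[fun_prop] theorem polyTime_powIter (hD : PolyTime D) (hx : PolyTime x) (hb : PolyTime b)
    (hk : PolyTime k) : PolyTime fun d => T.powIter (D d) (x d) (b d) (k d) := by
  obtain ⟨s, hs⟩ := T.size_pow_le
  obtain ⟨v, hv⟩ := hD.size_le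
  have hD' : PolyTime fun p : Data => D p.hd := hD.comp (by fun_prop)
  have hb' : PolyTime fun p : Data => b p.hd := hb.comp (by fun_prop)
  refine PolyTime.foldl_of_bounded (F := fun d a _ => T.pow (D d) a (b d)) hk (by fun_prop)
    (by fun_prop) ⟨s.comp v, fun d a c => ?_⟩
  rw [Polynomial.eval_comp]
  exact (hs _ _ _).trans (s.eval_mono_nat (hv d))

theorem polyTime_prod (hD : PolyTime D) (hk : PolyTime k) {f : Data → Data → Data}
    (hf : PolyTime fun p => f p.hd p.tl) : PolyTime fun d => T.prod (D d) (f d) (k d) := by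
  obtain ⟨s, hs⟩ := T.size_mul_le
  obtain ⟨v, hv⟩ := hD.size_le
  have hD' : PolyTime fun p : Data => D p.hd := hD.comp (by fun_prop)
  have hf' : PolyTime fun p : Data => f p.hd p.tl.tl := .comp₂ hf (by fun_prop) (by fun_prop)
  refine PolyTime.foldl_of_bounded (F := fun d a c => T.mul (D d) a (f d c)) hk (by fun_prop)
    (T.polyTime_mul hD' (by fun_prop) hf') ⟨s.comp v, fun d a c => ?_⟩
  rw [Polynomial.eval_comp]
  exact (hs _ _ _).trans (s.eval_mono_nat (hv d))

end PolyTime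

section Correct

variable (I : 𝒢.Inst)

theorem mul_enc (x y : (𝒢.grp I).G) :
    T.mul (𝒢.grp I).desc ((𝒢.grp I).enc x) ((𝒢.grp I).enc y) = (𝒢.grp I).enc (x * y) :=
  T.mulOp_eq I x y

theorem inv_enc (x : (𝒢.grp I).G) :
    T.inv (𝒢.grp I).desc ((𝒢.grp I).enc x) = (𝒢.grp I).enc x⁻¹ :=
  T.invOp_eq I x

theorem pair_enc (x y : (𝒢.grp I).G) :
    T.pair (𝒢.grp I).desc ((𝒢.grp I).enc x) ((𝒢.grp I).enc y) = (𝒢.grp I).encT ((𝒢.grp I).e x y) :=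
  T.pairOp_eq I x y

theorem one_enc : T.one (𝒢.grp I).desc = (𝒢.grp I).enc 1 := by
  have h : (𝒢.grp I).desc.nth 2 = (𝒢.grp I).enc (𝒢.grp I).gen := rfl
  rw [one, h, inv_enc, mul_enc, mul_inv_cancel]

theorem pow_enc (x : (𝒢.grp I).G) (l : List Bool) :
    T.pow (𝒢.grp I).desc ((𝒢.grp I).enc x) (bits l) = (𝒢.grp I).enc (x ^ natOfBits l) := by
  rw [pow, one_enc, bits, toList_list, List.foldl_map, natOfBits]
  induction l using List.reverseRecOn with
  | nil => simp
  | append_singleton l c ih =>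
    rw [List.foldl_append, List.foldl_append, ih]
    cases c
    · simp [mul_enc, two_mul, pow_add]
    · simp [mul_enc, two_mul, pow_add]

theorem powIter_enc (x : (𝒢.grp I).G) (l : List Bool) (k : ℕ) :
    T.powIter (𝒢.grp I).desc ((𝒢.grp I).enc x) (bits l) (unary k) =
      (𝒢.grp I).enc (x ^ natOfBits l ^ k) := by
  rw [powIter, one_enc, mul_enc, mul_one, unary, toList_list]
  induction k with
  | zero => simp
  | succ k ih =>
    rw [List.replicate_succ', List.foldl_append, ih]
    simp [pow_enc, ← pow_mul, pow_succ]

theorem prod_enc {ι : Type} (l : List ι) (i : ι → Data) (f : Data → Data) (f' : ι → (𝒢.grp I).G)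
    (h : ∀ k ∈ l, f (i k) = (𝒢.grp I).enc (f' k)) :
    T.prod (𝒢.grp I).desc f (list (l.map i)) = (𝒢.grp I).enc (l.map f').prod := by
  rw [prod, one_enc, toList_list]
  induction l using List.reverseRecOn with
  | nil => simp
  | append_singleton l c ih =>
    rw [List.map_append, List.foldl_append, ih fun k hk => h k (by simp [hk])]
    simp [h c (by simp), mul_enc]

end Correct

end Tools

/-! ### The simulator as a program -/

open Data

namespace Tools

variable {𝒢 : GroupGenerator} {ℋ : HashFamily 𝒢} {L : ℕ → ℕ} (T : Tools ℋ L)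

/-- The random bits of the simulator are read as a square table of blocks; this is the block in row
`a` and column `b`. The members of the environment `d` are, in this order: the security parameter,
the number of users, the length of a block, the length of a row, the random bits, the description
of the groups, the generators of the subgroups of order `p₁` and `p₃`, the first component of the
header, the basis of the masks, the basis of the parameters `U_k`, and the number of masks. -/
def block (d a b : Data) : Data :=
  take (d.nth 2) (drop (append (Data.mul a (d.nth 3)) (Data.mul b (d.nth 2))) (d.nth 4))

@[fun_prop] theorem polyTime_block {d a b : Data → Data} (hd : PolyTime d) (ha : PolyTime a)
    (hb : PolyTime b) : PolyTime fun x => block (d x) (a x) (b x) := by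
  unfold block; fun_prop

/-- The parameter `A_k`. -/
def simA (d k : Data) : Data :=
  T.powIter (d.nth 5) (d.nth 6) (block d (unary 1) (unary 0)) k

/-- The contribution of the `l`-th mask to the parameter `U_k`. -/
def simMask (d k l : Data) : Data :=
  T.powIter (d.nth 5) (T.pow (d.nth 5) (d.nth 9) (block d (unary 4) l)) (block d (unary 5) l) k

/-- The parameter `U_k`. -/
def simU (d k : Data) : Data :=
  T.mul (d.nth 5) (T.mul (d.nth 5)
    (T.powIter (d.nth 5) (d.nth 10) (block d (unary 1) (unary 0)) k)
    (T.prod (d.nth 5) (T.simMask d k) (iota (d.nth 11))))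
    (T.pow (d.nth 5) (d.nth 7) (block d (unary 2) k))

/-- The component `V_j` of a public key, whose secret is an exponent from the table minus
`α ^ j`. -/
def simV (d j : Data) : Data :=
  T.mul (d.nth 5) (T.pow (d.nth 5) (d.nth 6) (block d (unary 3) j))
    (T.inv (d.nth 5) (T.simA d j))

/-- The component `V_{j,k}` of a public key. -/
def simW (d j k : Data) : Data :=
  T.mul (d.nth 5) (T.mul (d.nth 5)
    (T.pow (d.nth 5) (T.simU d k) (block d (unary 3) j))
    (T.inv (d.nth 5) (T.simU d (append k j))))
    (T.pow (d.nth 5) (d.nth 7) (block d (append (unary 6) j) k))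

/-- The numbers `1, …, n`. -/
def upto (n : Data) : Data := drop (unary 1) (iota (append n (unary 1)))

/-- The list `l` of unary numbers without the number `i`. -/
def without (l i : Data) : Data := list (l.toList.filter fun k => (ne k i).toBool)

/-- The hash key. -/
def simKey (d : Data) : Data :=
  take (T.keyLenOp (.cons (list [d.nth 0, d.nth 5]) .nil)) (block d (unary 0) (unary 1))

/-- `U_{L+1}`, which is not published. -/
def simTop (d : Data) : Data := T.simU d (append (d.nth 1) (unary 1))

/-- The list of the parameters `A_k`. -/
def simAs (d : Data) : Data := list ((upto (d.nth 1)).toList.map (T.simA d))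

/-- The list of the published parameters `U_k`. -/
def simUs (d : Data) : Data :=
  list ((without (upto (append (d.nth 1) (d.nth 1))) (append (d.nth 1) (unary 1))).toList.map
    (T.simU d))

/-- The public parameters. -/
def simPP (d : Data) : Data :=
  list [d.nth 5, append (list [d.nth 6, d.nth 7]) (append (T.simAs d) (append (T.simUs d)
    (list [T.pair (d.nth 5) (d.nth 6) (T.simTop d)]))), T.simKey d]

/-- The list of the components `V_{j,k}` of a public key. -/
def simWs (d j : Data) : Data :=
  list ((without (upto (d.nth 1)) (drop j (append (d.nth 1) (unary 1)))).toList.map (T.simW d j))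

/-- A public key, with the index of its user. -/
def simUPK (d j : Data) : Data :=
  .cons j (.cons (T.simV d j) (T.simWs d j))

/-- The first answer of the adversary, which takes its random bits from the
first block of the table. -/
def simCommit (A : SSAdversary) (d : Data) : Data :=
  A.commit (list [d.nth 0, d.nth 1, take (unary (A.coins.eval (append (d.nth 0) (d.nth 1)).len))
    (block d (unary 0) (unary 0))])

/-- The members of the list `l` of user indices that a set encoded by `o` contains. -/
def selected (o l : Data) : Data :=
  list (l.toList.filter fun j => (get o (drop (unary 1) j)).toBool)

/-- The members of the initial set. -/
def simS₀ (A : SSAdversary) (d : Data) : Data :=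
  selected (simCommit A d).hd (upto (d.nth 1))

/-- The public keys of the members of the initial set. -/
def simUPKs (A : SSAdversary) (d : Data) : Data := list ((simS₀ A d).toList.map (T.simUPK d))

/-- The second answer of the adversary. -/
def simQuery (A : SSAdversary) (d : Data) : Data :=
  A.query (list [(simCommit A d).tl, T.simPP d, T.simUPKs A d])

/-- The members of the challenge set. -/
def simS (A : SSAdversary) (d : Data) : Data :=
  selected (T.simQuery A d).hd (simS₀ A d)

/-- The contribution of user `j` to the second component of the header. -/
def simFactor (d j : Data) : Data := T.pow (d.nth 5) (d.nth 8) (block d (unary 3) j)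

/-- The second component of the header. -/
def simC₂ (A : SSAdversary) (d : Data) : Data :=
  T.prod (d.nth 5) (T.simFactor d) (T.simS A d)

/-- The session key that belongs to the header. -/
def simHash (d : Data) : Data :=
  T.hashOp (.cons (list [d.nth 0, d.nth 5])
    (list [T.simKey d, T.pair (d.nth 5) (d.nth 8) (T.simTop d)]))

/-- The session key that the adversary receives. -/
def simCK (d : Data) : Data :=
  if (block d (unary 0) (unary 3)).hd.toBool = true then
    take (d.nth 0) (block d (unary 0) (unary 2))
  else T.simHash d

/-- The last answer of the adversary. -/
def simGuess (A : SSAdversary) (d : Data) : Data :=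
  A.guess (list [(T.simQuery A d).tl, list [d.nth 8, T.simC₂ A d], T.simCK d])

/-- Whether the adversary is right. -/
def sim (A : SSAdversary) (d : Data) : Data :=
  if (T.simGuess A d).toBool = true then (block d (unary 0) (unary 3)).hd
  else if (block d (unary 0) (unary 3)).hd.toBool = true then .nil else .cons .nil .nil

section PolyTime

variable {d j k l : Data → Data}

@[fun_prop] theorem polyTime_simA (hd : PolyTime d) (hk : PolyTime k) :
    PolyTime fun x => T.simA (d x) (k x) := by
  unfold simA; fun_prop

@[fun_prop] theorem polyTime_simMask (hd : PolyTime d) (hk : PolyTime k) (hl : PolyTime l) :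
    PolyTime fun x => T.simMask (d x) (k x) (l x) := by
  unfold simMask; fun_prop

@[fun_prop] theorem polyTime_simU (hd : PolyTime d) (hk : PolyTime k) :
    PolyTime fun x => T.simU (d x) (k x) := by
  have hd' : PolyTime fun p : Data => d p.hd := hd.comp (by fun_prop)
  have hk' : PolyTime fun p : Data => k p.hd := hk.comp (by fun_prop)
  have := T.polyTime_prod (D := fun x => (d x).nth 5) (k := fun x => iota ((d x).nth 11))
    (f := fun x => T.simMask (d x) (k x)) (by fun_prop) (by fun_prop) (by fun_prop)
  unfold simU
  exact T.polyTime_mul (by fun_prop) (T.polyTime_mul (by fun_prop) (by fun_prop) this)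
    (by fun_prop)

@[fun_prop] theorem polyTime_simV (hd : PolyTime d) (hj : PolyTime j) :
    PolyTime fun x => T.simV (d x) (j x) := by
  unfold simV; fun_prop

@[fun_prop] theorem polyTime_simW (hd : PolyTime d) (hj : PolyTime j) (hk : PolyTime k) :
    PolyTime fun x => T.simW (d x) (j x) (k x) := by
  unfold simW; fun_prop

@[fun_prop] theorem polyTime_upto (hd : PolyTime d) : PolyTime fun x => upto (d x) := by
  unfold upto; fun_prop

@[fun_prop] theorem polyTime_without (hl : PolyTime l) (hk : PolyTime k) :
    PolyTime fun x => without (l x) (k x) := by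
  have hk' : PolyTime fun p : Data => k p.hd := hk.comp (by fun_prop)
  have := PolyTime.filter (P := fun x y => ne y (k x)) hl (by fun_prop)
  unfold without
  exact this

@[fun_prop] theorem polyTime_selected (hl : PolyTime l) (hk : PolyTime k) :
    PolyTime fun x => selected (l x) (k x) := by
  have hl' : PolyTime fun p : Data => l p.hd := hl.comp (by fun_prop)
  have := PolyTime.filter (P := fun x y => get (l x) (drop (unary 1) y)) hk (by fun_prop)
  unfold selected
  exact this

@[fun_prop] theorem polyTime_simKey (hd : PolyTime d) : PolyTime fun x => T.simKey (d x) := by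
  have := T.keyLenOp_poly.comp (f := fun x => .cons (list [(d x).nth 0, (d x).nth 5]) .nil)
    (by fun_prop)
  unfold simKey
  exact this.take (by fun_prop)

@[fun_prop] theorem polyTime_simTop (hd : PolyTime d) : PolyTime fun x => T.simTop (d x) := by
  unfold simTop; fun_prop

@[fun_prop] theorem polyTime_simAs (hd : PolyTime d) : PolyTime fun x => T.simAs (d x) := by
  have hd' : PolyTime fun p : Data => d p.hd := hd.comp (by fun_prop)
  have := PolyTime.map (G := fun x => upto ((d x).nth 1)) (F := fun x => T.simA (d x))
    (by fun_prop) (by fun_prop)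
  unfold simAs
  exact this

@[fun_prop] theorem polyTime_simUs (hd : PolyTime d) : PolyTime fun x => T.simUs (d x) := by
  have hd' : PolyTime fun p : Data => d p.hd := hd.comp (by fun_prop)
  have := PolyTime.map (G := fun x => without (upto (append ((d x).nth 1) ((d x).nth 1)))
    (append ((d x).nth 1) (unary 1))) (F := fun x => T.simU (d x)) (by fun_prop) (by fun_prop)
  unfold simUs
  exact this

@[fun_prop] theorem polyTime_simPP (hd : PolyTime d) : PolyTime fun x => T.simPP (d x) := by
  unfold simPP; fun_prop

@[fun_prop] theorem polyTime_simWs (hd : PolyTime d) (hj : PolyTime j) :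
    PolyTime fun x => T.simWs (d x) (j x) := by
  have hd' : PolyTime fun p : Data => d p.hd := hd.comp (by fun_prop)
  have hj' : PolyTime fun p : Data => j p.hd := hj.comp (by fun_prop)
  have := PolyTime.map (G := fun x => without (upto ((d x).nth 1))
    (drop (j x) (append ((d x).nth 1) (unary 1)))) (F := fun x => T.simW (d x) (j x))
    (by fun_prop) (by fun_prop)
  unfold simWs
  exact this

@[fun_prop] theorem polyTime_simUPK (hd : PolyTime d) (hj : PolyTime j) :
    PolyTime fun x => T.simUPK (d x) (j x) := by
  unfold simUPK; fun_prop

@[fun_prop] theorem polyTime_simCommit (A : SSAdversary) (hd : PolyTime d) :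
    PolyTime fun x => simCommit A (d x) := by
  unfold simCommit
  exact A.commit_polyTime.comp (by fun_prop)

@[fun_prop] theorem polyTime_simS₀ (A : SSAdversary) (hd : PolyTime d) :
    PolyTime fun x => simS₀ A (d x) := by
  unfold simS₀; fun_prop

@[fun_prop] theorem polyTime_simUPKs (A : SSAdversary) (hd : PolyTime d) :
    PolyTime fun x => T.simUPKs A (d x) := by
  have hd' : PolyTime fun p : Data => d p.hd := hd.comp (by fun_prop)
  have := PolyTime.map (G := fun x => simS₀ A (d x)) (F := fun x => T.simUPK (d x))
    (by fun_prop) (by fun_prop)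
  unfold simUPKs
  exact this

@[fun_prop] theorem polyTime_simQuery (A : SSAdversary) (hd : PolyTime d) :
    PolyTime fun x => T.simQuery A (d x) := by
  unfold simQuery
  exact A.query_polyTime.comp (by fun_prop)

@[fun_prop] theorem polyTime_simS (A : SSAdversary) (hd : PolyTime d) :
    PolyTime fun x => T.simS A (d x) := by
  unfold simS; fun_prop

@[fun_prop] theorem polyTime_simC₂ (A : SSAdversary) (hd : PolyTime d) :
    PolyTime fun x => T.simC₂ A (d x) := by
  have hd' : PolyTime fun p : Data => d p.hd := hd.comp (by fun_prop)
  have := T.polyTime_prod (D := fun x => (d x).nth 5) (f := fun x => T.simFactor (d x))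
    (k := fun x => T.simS A (d x)) (by fun_prop) (by fun_prop)
    (by unfold simFactor; fun_prop)
  unfold simC₂
  exact this

@[fun_prop] theorem polyTime_simHash (hd : PolyTime d) : PolyTime fun x => T.simHash (d x) := by
  unfold simHash
  exact T.hashOp_poly.comp (by fun_prop)

@[fun_prop] theorem polyTime_simCK (hd : PolyTime d) : PolyTime fun x => T.simCK (d x) := by
  unfold simCK; fun_prop

@[fun_prop] theorem polyTime_simGuess (A : SSAdversary) (hd : PolyTime d) :
    PolyTime fun x => T.simGuess A (d x) := by
  unfold simGuess
  exact A.guess_polyTime.comp (by fun_prop)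

@[fun_prop] theorem polyTime_sim (A : SSAdversary) (hd : PolyTime d) :
    PolyTime fun x => T.sim A (d x) := by
  unfold sim; fun_prop

end PolyTime

/-- The part of the environment that does not depend on the challenge; the polynomials `qK` and
`qM` count the blocks of a row and the bits of a block. -/
noncomputable def simBase (qK qM : Polynomial ℕ) (x : Data) : List Data :=
  [x.nth 0, T.countOp (x.nth 0), unary (qM.eval (x.nth 0).len),
    unary ((qK * qM).eval (x.nth 0).len), x.nth 1, (x.nth 2).nth 0, (x.nth 2).nth 1,
    (x.nth 2).nth 2]

/-- A unary number below `2 * n.len` modulo `n.len`. Whatever the input, the output is at most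
`n.len`. -/
def modStep (n a : Data) : Data :=
  unary (if (lt a n).toBool = true then a else take n (drop n a)).len

/-- The number with binary digits `b` modulo the positive number `n`, in unary. -/
def unaryMod (n b : Data) : Data :=
  b.toList.foldl (fun a c => modStep n (append (if c.toBool = true then unary 1 else .nil)
    (modStep n (append a a)))) .nil

@[fun_prop] theorem polyTime_modStep {n a : Data → Data} (hn : PolyTime n) (ha : PolyTime a) :
    PolyTime fun x => modStep (n x) (a x) := by
  unfold modStep; fun_prop

theorem size_modStep_le (n a : Data) : (modStep n a).size ≤ 2 * n.len + 1 := by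
  rw [modStep, size_unary]
  by_cases h : a.len < n.len
  · rw [if_pos (by simpa using h)]; omega
  · rw [if_neg (by simpa using h)]
    have : (take n (drop n a)).len ≤ n.len := by simp [take]
    omega

@[fun_prop] theorem polyTime_unaryMod {n b : Data → Data} (hn : PolyTime n) (hb : PolyTime b) :
    PolyTime fun x => unaryMod (n x) (b x) := by
  have hn' : PolyTime fun p : Data => n p.hd := hn.comp (by fun_prop)
  obtain ⟨v, hv⟩ := hn.size_le
  have := PolyTime.foldl_of_bounded (F := fun x a c => modStep (n x)
    (append (if c.toBool = true then unary 1 else .nil) (modStep (n x) (append a a)))) hb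
    (.const .nil) (by fun_prop) ⟨2 * v + 1, fun x a c => by
      have h1 := (len_le_size (n x)).trans (hv x)
      have h2 := size_modStep_le (n x)
        (append (if c.toBool = true then unary 1 else .nil) (modStep (n x) (append a a)))
      simp only [Polynomial.eval_add, Polynomial.eval_mul, Polynomial.eval_ofNat,
        Polynomial.eval_one]
      omega⟩
  unfold unaryMod
  exact this

@[fun_prop] theorem polyTime_countOp {f : Data → Data} (hf : PolyTime f) :
    PolyTime fun x => T.countOp (f x) := T.countOp_poly.comp hf

/-- The environment in which the attack on the subgroup decision assumption simulates. -/
noncomputable def envSD (qK qM : Polynomial ℕ) (x : Data) : Data :=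
  list (T.simBase qK qM x ++ [(x.nth 2).nth 3, (x.nth 2).nth 1,
    T.pow ((x.nth 2).nth 0) ((x.nth 2).nth 1)
      (block (list (T.simBase qK qM x)) (unary 1) (unary 1)), .nil])

/-- The environment in which the attack on the general subgroup decision assumption simulates. -/
noncomputable def envGSD (qK qM : Polynomial ℕ) (x : Data) : Data :=
  list (T.simBase qK qM x ++ [(x.nth 2).nth 3, (x.nth 2).nth 4, (x.nth 2).nth 5,
    unaryMod (append (T.countOp (x.nth 0)) (T.countOp (x.nth 0)))
      (block (list (T.simBase qK qM x)) (unary 0) (unary 4))])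

theorem polyTime_envSD (qK qM : Polynomial ℕ) : PolyTime (T.envSD qK qM) := by
  unfold envSD simBase
  simp only [List.cons_append, List.nil_append]
  fun_prop

theorem polyTime_envGSD (qK qM : Polynomial ℕ) : PolyTime (T.envGSD qK qM) := by
  unfold envGSD simBase
  simp only [List.cons_append, List.nil_append]
  fun_prop

/-- The attack on the subgroup decision assumption. -/
noncomputable def attackSD (A : SSAdversary) (qK qM : Polynomial ℕ) : Distinguisher where
  coins := qK * qK * qM
  run x := T.sim A (T.envSD qK qM x)
  polyTime := T.polyTime_sim A (T.polyTime_envSD qK qM)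

/-- The attack on the general subgroup decision assumption. -/
noncomputable def attackGSD (A : SSAdversary) (qK qM : Polynomial ℕ) : Distinguisher where
  coins := qK * qK * qM
  run x := T.sim A (T.envGSD qK qM x)
  polyTime := T.polyTime_sim A (T.polyTime_envGSD qK qM)

end Tools

/-! ### What the adversary sees -/

open Data

/-- The group elements that an adversary receives; families are indexed by all natural numbers, and
`C₂` is the second component of the header for a list of users. -/
structure View (B : BilinearGroup) where
  g : B.G
  Y : B.G
  A : ℕ → B.G
  U : ℕ → B.G
  Ω : B.GT
  V : ℕ → B.G
  W : ℕ → ℕ → B.G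
  C₁ : B.G
  C₂ : List ℕ → B.G

namespace View

variable {B : BilinearGroup} (X : View B)

/-- The encoded public parameters, with hash key `key`. -/
def encPP (L : ℕ) (key : List Bool) : Data :=
  list [B.desc, list ([B.enc X.g, B.enc X.Y] ++ (List.range' 1 L).map (fun k => B.enc (X.A k)) ++
    ((List.range' 1 (2 * L)).filter fun k => k ≠ L + 1).map (fun k => B.enc (X.U k)) ++
    [B.encT X.Ω]), bits key]

/-- The encoded public key of user `j`. -/
def encUPK (L : ℕ) (j : ℕ) : Data :=
  .cons (unary j) (list (B.enc (X.V j) ::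
    ((List.range' 1 L).filter fun k => k ≠ L + 1 - j).map (fun k => B.enc (X.W j k))))

end View

namespace SSAdversary

variable (A : SSAdversary) {B : BilinearGroup} (κ L : ℕ) (r key : List Bool) (X : View B)

/-- The first answer, with random bits `r`. -/
def answer₁ : Data := A.commit (list [unary κ, unary L, bits r])

/-- The members of a list of users that an encoded set contains. -/
def _root_.selectedUsers (o : Data) (l : List ℕ) : List ℕ :=
  l.filter fun j => (o.nth (j - 1)).toBool

/-- The initial set. -/
def users₁ : List ℕ := selectedUsers (A.answer₁ κ L r).hd (List.range' 1 L)

/-- The second answer. -/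
def answer₂ : Data :=
  A.query (list [(A.answer₁ κ L r).tl, X.encPP L key,
    list ((A.users₁ κ L r).map (X.encUPK L))])

/-- The challenge set. -/
def users₂ : List ℕ := selectedUsers (A.answer₂ κ L r key X).hd (A.users₁ κ L r)

/-- The guess, when the session key is `ck`. -/
def play (ck : List Bool) : Bool :=
  (A.guess (list [(A.answer₂ κ L r key X).tl,
    list [B.enc X.C₁, B.enc (X.C₂ (A.users₂ κ L r key X))], bits ck])).toBool

end SSAdversary

/-- The view that the simulator creates, with natural numbers `n a b` as exponents. -/
def simView {B : BilinearGroup} (L : ℕ) (n : ℕ → ℕ → ℕ) (g g₃ C₁ D Z : B.G) (m : ℕ) : View B :=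
  let A : ℕ → B.G := fun k => g ^ n 1 0 ^ k
  let U : ℕ → B.G := fun k => Z ^ n 1 0 ^ k *
    ((List.range m).map fun l => (D ^ n 4 l) ^ n 5 l ^ k).prod * g₃ ^ n 2 k
  { g := g
    Y := g₃
    A := A
    U := U
    Ω := B.e g (U (L + 1))
    V := fun j => g ^ n 3 j * (A j)⁻¹
    W := fun j k => U k ^ n 3 j * (U (k + j))⁻¹ * g₃ ^ n (6 + j) k
    C₁ := C₁
    C₂ := fun S => (S.map fun j => C₁ ^ n 3 j).prod }

namespace Tools

/-- A block of a table with blocks of length `M` and rows of length `R`. -/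
def blockBits (M R : ℕ) (c : List Bool) (a b : ℕ) : List Bool := (c.drop (a * R + b * M)).take M

variable {𝒢 : GroupGenerator} {ℋ : HashFamily 𝒢} {L : ℕ → ℕ} (T : Tools ℋ L)

theorem map_bits_list (n m : ℕ) (c : List Bool) :
    take (unary n) (drop (unary m) (bits c)) = bits ((c.drop m).take n) := by
  simp [take, drop, bits, List.map_drop, List.map_take]

theorem take_bits (n : ℕ) (c : List Bool) : take (unary n) (bits c) = bits (c.take n) := by
  simp [take, bits, List.map_take]

theorem drop_unary (m n : ℕ) : drop (unary m) (unary n) = unary (n - m) := by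
  simp [drop, unary]

theorem upto_unary (n : ℕ) : upto (unary n) = list ((List.range' 1 n).map unary) := by
  rw [upto, unary_add, iota, drop, toList_list, len_unary, len_unary, ← List.map_drop,
    List.range_eq_range', List.drop_range']
  simp

theorem without_unary (l : List ℕ) (i : ℕ) :
    without (list (l.map unary)) (unary i) = list ((l.filter fun k => k ≠ i).map unary) := by
  rw [without, toList_list, List.filter_map]
  congr 2
  refine List.filter_congr fun k _ => ?_
  simp

theorem selected_unary (o : Data) (l : List ℕ) :
    selected o (list (l.map unary)) = list ((selectedUsers o l).map unary) := by
  rw [selected, toList_list, List.filter_map, selectedUsers]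
  congr 2
  refine List.filter_congr fun k _ => ?_
  simp [drop_unary, Data.get]

section Correct

variable (A : SSAdversary) (κ M R : ℕ) (c : List Bool) (I : 𝒢.Inst) (g g₃ C₁ D Z : (𝒢.grp I).G)
  (m : ℕ)

variable (L) in
/-- The environment of the simulator. -/
def simEnv : Data :=
  list [unary κ, unary (L κ), unary M, unary R, bits c, (𝒢.grp I).desc, (𝒢.grp I).enc g,
    (𝒢.grp I).enc g₃, (𝒢.grp I).enc C₁, (𝒢.grp I).enc D, (𝒢.grp I).enc Z, unary m]

/-- The exponents that the simulator reads off its random bits. -/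
def exponents (M R : ℕ) (c : List Bool) (a b : ℕ) : ℕ := natOfBits (blockBits M R c a b)

theorem block_list (κ₀ L₀ : Data) (l : List Data) (a b : ℕ) :
    block (list (κ₀ :: L₀ :: unary M :: unary R :: bits c :: l)) (unary a) (unary b) =
      bits (blockBits M R c a b) := by
  change take (unary M) (drop (append (Data.mul (unary a) (unary R))
    (Data.mul (unary b) (unary M))) (bits c)) = _
  rw [Data.mul, Data.mul, unary_add, map_bits_list, blockBits]
  simp

theorem block_simEnv (a b : ℕ) : block (simEnv L κ M R c I g g₃ C₁ D Z m) (unary a) (unary b) =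
    bits (blockBits M R c a b) := block_list M R c _ _ _ a b

variable (L) in
/-- The view created in the environment `simEnv`. -/
def envView : View (𝒢.grp I) := simView (L κ) (exponents M R c) g g₃ C₁ D Z m

section Nth

theorem simEnv_nth_zero : (simEnv L κ M R c I g g₃ C₁ D Z m).nth 0 = unary κ := rfl
theorem simEnv_nth_one : (simEnv L κ M R c I g g₃ C₁ D Z m).nth 1 = unary (L κ) := rfl
theorem simEnv_nth_five : (simEnv L κ M R c I g g₃ C₁ D Z m).nth 5 = (𝒢.grp I).desc := rfl
theorem simEnv_nth_six : (simEnv L κ M R c I g g₃ C₁ D Z m).nth 6 = (𝒢.grp I).enc g := rfl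
theorem simEnv_nth_seven : (simEnv L κ M R c I g g₃ C₁ D Z m).nth 7 = (𝒢.grp I).enc g₃ := rfl
theorem simEnv_nth_eight : (simEnv L κ M R c I g g₃ C₁ D Z m).nth 8 = (𝒢.grp I).enc C₁ := rfl
theorem simEnv_nth_nine : (simEnv L κ M R c I g g₃ C₁ D Z m).nth 9 = (𝒢.grp I).enc D := rfl
theorem simEnv_nth_ten : (simEnv L κ M R c I g g₃ C₁ D Z m).nth 10 = (𝒢.grp I).enc Z := rfl
theorem simEnv_nth_eleven : (simEnv L κ M R c I g g₃ C₁ D Z m).nth 11 = unary m := rfl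

end Nth

theorem simA_env (k : ℕ) : T.simA (simEnv L κ M R c I g g₃ C₁ D Z m) (unary k) =
    (𝒢.grp I).enc ((envView L κ M R c I g g₃ C₁ D Z m).A k) := by
  rw [simA, block_simEnv, simEnv_nth_five, simEnv_nth_six, powIter_enc]
  rfl

theorem simMask_env (k l : ℕ) :
    T.simMask (simEnv L κ M R c I g g₃ C₁ D Z m) (unary k) (unary l) =
      (𝒢.grp I).enc ((D ^ exponents M R c 4 l) ^ exponents M R c 5 l ^ k) := by
  rw [simMask, block_simEnv, block_simEnv, simEnv_nth_five, simEnv_nth_nine, pow_enc, powIter_enc]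
  rfl

theorem simU_env (k : ℕ) : T.simU (simEnv L κ M R c I g g₃ C₁ D Z m) (unary k) =
    (𝒢.grp I).enc ((envView L κ M R c I g g₃ C₁ D Z m).U k) := by
  rw [simU, block_simEnv, block_simEnv, simEnv_nth_five, simEnv_nth_seven, simEnv_nth_ten,
    simEnv_nth_eleven, powIter_enc, pow_enc, iota, len_unary,
    T.prod_enc I _ _ _ _ fun l _ => T.simMask_env κ M R c I g g₃ C₁ D Z m k l, mul_enc, mul_enc]
  rfl

theorem simV_env (j : ℕ) : T.simV (simEnv L κ M R c I g g₃ C₁ D Z m) (unary j) =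
    (𝒢.grp I).enc ((envView L κ M R c I g g₃ C₁ D Z m).V j) := by
  rw [simV, block_simEnv, simEnv_nth_five, simEnv_nth_six, simA_env, pow_enc, inv_enc, mul_enc]
  rfl

theorem simW_env (j k : ℕ) : T.simW (simEnv L κ M R c I g g₃ C₁ D Z m) (unary j) (unary k) =
    (𝒢.grp I).enc ((envView L κ M R c I g g₃ C₁ D Z m).W j k) := by
  rw [simW, unary_add, unary_add, block_simEnv, block_simEnv, simEnv_nth_five, simEnv_nth_seven,
    simU_env, simU_env, pow_enc, pow_enc, inv_enc, mul_enc, mul_enc]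
  rfl

theorem simTop_env : T.simTop (simEnv L κ M R c I g g₃ C₁ D Z m) =
    (𝒢.grp I).enc ((envView L κ M R c I g g₃ C₁ D Z m).U (L κ + 1)) := by
  rw [simTop, simEnv_nth_one, unary_add, simU_env]

theorem map_unary_enc (l : List ℕ) (f : Data → Data) (f' : ℕ → (𝒢.grp I).G)
    (h : ∀ k, f (unary k) = (𝒢.grp I).enc (f' k)) :
    list ((list (l.map unary)).toList.map f) = list (l.map fun k => (𝒢.grp I).enc (f' k)) := by
  rw [toList_list, List.map_map]
  congr 1
  exact List.map_congr_left fun k _ => h k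

theorem append_list (l l' : List Data) : append (list l) (list l') = list (l ++ l') := by
  simp [append]

variable (key : Fin (ℋ.keyLen κ I) → Bool)

theorem simKey_env
    (hkey : List.ofFn key = (blockBits M R c 0 1).take (ℋ.keyLen κ I)) :
    T.simKey (simEnv L κ M R c I g g₃ C₁ D Z m) = bits (List.ofFn key) := by
  have h := T.keyLenOp_eq κ I
  rw [simKey, simEnv_nth_zero, simEnv_nth_five, h, block_simEnv, take_bits, hkey]

theorem simPP_env
    (hkey : List.ofFn key = (blockBits M R c 0 1).take (ℋ.keyLen κ I)) :
    T.simPP (simEnv L κ M R c I g g₃ C₁ D Z m) =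
    (envView L κ M R c I g g₃ C₁ D Z m).encPP (L κ) (List.ofFn key) := by
  rw [simPP, T.simKey_env κ M R c I g g₃ C₁ D Z m key hkey, simAs, simUs, simTop_env,
    simEnv_nth_one, simEnv_nth_five, simEnv_nth_six, simEnv_nth_seven, unary_add, unary_add,
    upto_unary, upto_unary, without_unary, pair_enc,
    map_unary_enc I _ _ _ fun k => T.simA_env κ M R c I g g₃ C₁ D Z m k,
    map_unary_enc I _ _ _ fun k => T.simU_env κ M R c I g g₃ C₁ D Z m k,
    append_list, append_list, append_list, ← two_mul, View.encPP]
  simp only [List.append_assoc]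
  rfl

theorem simUPK_env (j : ℕ) : T.simUPK (simEnv L κ M R c I g g₃ C₁ D Z m) (unary j) =
    (envView L κ M R c I g g₃ C₁ D Z m).encUPK (L κ) j := by
  rw [simUPK, simWs, simV_env, simEnv_nth_one, unary_add, upto_unary, drop_unary, without_unary,
    map_unary_enc I _ _ _ fun k => T.simW_env κ M R c I g g₃ C₁ D Z m j k]
  rfl

theorem simCommit_env : simCommit A (simEnv L κ M R c I g g₃ C₁ D Z m) =
    A.answer₁ κ (L κ) ((blockBits M R c 0 0).take (A.coins.eval (κ + L κ))) := by
  rw [simCommit, block_simEnv, simEnv_nth_zero, simEnv_nth_one, unary_add, len_unary, take_bits]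
  rfl

theorem simS₀_env : simS₀ A (simEnv L κ M R c I g g₃ C₁ D Z m) =
    list ((A.users₁ κ (L κ) ((blockBits M R c 0 0).take (A.coins.eval (κ + L κ)))).map unary) := by
  rw [simS₀, simCommit_env, simEnv_nth_one, upto_unary, selected_unary]
  rfl

theorem simQuery_env
    (hkey : List.ofFn key = (blockBits M R c 0 1).take (ℋ.keyLen κ I)) :
    T.simQuery A (simEnv L κ M R c I g g₃ C₁ D Z m) =
      A.answer₂ κ (L κ) ((blockBits M R c 0 0).take (A.coins.eval (κ + L κ))) (List.ofFn key)
        (envView L κ M R c I g g₃ C₁ D Z m) := by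
  rw [simQuery, T.simPP_env κ M R c I g g₃ C₁ D Z m key hkey, simUPKs, simS₀_env, simCommit_env,
    toList_list, List.map_map, SSAdversary.answer₂]
  congr 6
  exact List.map_congr_left fun k _ => T.simUPK_env κ M R c I g g₃ C₁ D Z m k

theorem simC₂_env
    (hkey : List.ofFn key = (blockBits M R c 0 1).take (ℋ.keyLen κ I)) :
    T.simC₂ A (simEnv L κ M R c I g g₃ C₁ D Z m) = (𝒢.grp I).enc
      ((envView L κ M R c I g g₃ C₁ D Z m).C₂ (A.users₂ κ (L κ)
        ((blockBits M R c 0 0).take (A.coins.eval (κ + L κ))) (List.ofFn key)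
        (envView L κ M R c I g g₃ C₁ D Z m))) := by
  rw [simC₂, simS, T.simQuery_env A κ M R c I g g₃ C₁ D Z m key hkey, simS₀_env, selected_unary,
    simEnv_nth_five, T.prod_enc I _ _ _ (fun j => C₁ ^ exponents M R c 3 j) fun j _ => by
      rw [simFactor, block_simEnv, simEnv_nth_five, simEnv_nth_eight, pow_enc]; rfl]
  rfl

theorem simHash_env
    (hkey : List.ofFn key = (blockBits M R c 0 1).take (ℋ.keyLen κ I)) :
    T.simHash (simEnv L κ M R c I g g₃ C₁ D Z m) = bits (List.ofFn (ℋ.hash κ I key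
      ((𝒢.grp I).e C₁ ((envView L κ M R c I g g₃ C₁ D Z m).U (L κ + 1))))) := by
  rw [simHash, T.simKey_env κ M R c I g g₃ C₁ D Z m key hkey, simTop_env, simEnv_nth_zero,
    simEnv_nth_five, simEnv_nth_eight, pair_enc, T.hashOp_eq]

theorem toBool_hd_bits (l : List Bool) : (bits l).hd.toBool = l.headD false := by
  cases l with
  | nil => rfl
  | cons a l => exact toBool_ofBool a

/-- The simulator runs the adversary on the view that its random bits determine. -/
theorem sim_env (hkey : List.ofFn key = (blockBits M R c 0 1).take (ℋ.keyLen κ I)) :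
    (T.sim A (simEnv L κ M R c I g g₃ C₁ D Z m)).toBool =
      (A.play κ (L κ) ((blockBits M R c 0 0).take (A.coins.eval (κ + L κ))) (List.ofFn key)
        (envView L κ M R c I g g₃ C₁ D Z m)
        (if (blockBits M R c 0 3).headD false then (blockBits M R c 0 2).take κ
          else List.ofFn (ℋ.hash κ I key
            ((𝒢.grp I).e C₁ ((envView L κ M R c I g g₃ C₁ D Z m).U (L κ + 1))))) ==
        (blockBits M R c 0 3).headD false) := by
  have h : (T.simGuess A (simEnv L κ M R c I g g₃ C₁ D Z m)).toBool =
      A.play κ (L κ) ((blockBits M R c 0 0).take (A.coins.eval (κ + L κ))) (List.ofFn key)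
        (envView L κ M R c I g g₃ C₁ D Z m)
        (if (blockBits M R c 0 3).headD false then (blockBits M R c 0 2).take κ
          else List.ofFn (ℋ.hash κ I key
            ((𝒢.grp I).e C₁ ((envView L κ M R c I g g₃ C₁ D Z m).U (L κ + 1))))) := by
    rw [simGuess, T.simQuery_env A κ M R c I g g₃ C₁ D Z m key hkey,
      T.simC₂_env A κ M R c I g g₃ C₁ D Z m key hkey, simCK, block_simEnv, block_simEnv,
      T.simHash_env κ M R c I g g₃ C₁ D Z m key hkey, toBool_hd_bits, simEnv_nth_zero, take_bits,
      simEnv_nth_eight, SSAdversary.play, apply_ite bits]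
    rfl
  rw [sim, block_simEnv, toBool_hd_bits, ← h, apply_ite Data.toBool, apply_ite Data.toBool,
    toBool_hd_bits]
  generalize (T.simGuess A (simEnv L κ M R c I g g₃ C₁ D Z m)).toBool = x
  generalize (blockBits M R c 0 3).headD false = y
  cases x <;> cases y <;> rfl

end Correct

theorem modStep_unary {n a : ℕ} (h : a < 2 * n) : modStep (unary n) (unary a) = unary (a % n) := by
  by_cases han : a < n
  · rw [modStep, if_pos (by simpa using han), len_unary, Nat.mod_eq_of_lt han]
  · have h1 : (take (unary n) (unary (a - n))).len = a - n := by
      rw [take, len_list, List.length_take, len_unary, unary, toList_list, List.length_replicate]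
      omega
    rw [modStep, if_neg (by simpa using han), drop_unary, h1, Nat.mod_eq_sub_mod (by omega),
      Nat.mod_eq_of_lt (by omega)]

theorem unaryMod_bits {n : ℕ} (hn : 0 < n) (b : List Bool) :
    unaryMod (unary n) (bits b) = unary (natOfBits b % n) := by
  rw [unaryMod, bits, toList_list, List.foldl_map, natOfBits]
  induction b using List.reverseRecOn with
  | nil => rw [List.foldl_nil, List.foldl_nil, Nat.zero_mod]; rfl
  | append_singleton l c ih =>
    rw [List.foldl_append, List.foldl_append, ih]
    obtain ⟨x, hx⟩ : ∃ x, x = l.foldl (fun a b => 2 * a + b.toNat) 0 := ⟨_, rfl⟩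
    rw [← hx, List.foldl_cons, List.foldl_cons, List.foldl_nil, List.foldl_nil, unary_add,
      modStep_unary (by have := Nat.mod_lt x hn; omega), toBool_ofBool]
    have h0 : c.toNat ≤ 1 := by cases c <;> simp
    have h1 : (if c = true then unary 1 else nil) = unary c.toNat := by cases c <;> rfl
    have h2 := Nat.mod_lt (x % n + x % n) hn
    rw [h1, unary_add, modStep_unary (by omega), ← Nat.add_mod, Nat.add_mod_mod]
    congr 2
    omega

variable (qK qM : Polynomial ℕ) (κ : ℕ) (c : List Bool) (I : 𝒢.Inst)

theorem simBase_eq (l : List Data) : T.simBase qK qM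
    (list [unary κ, bits c, list ((𝒢.grp I).desc :: l)]) =
      [unary κ, unary (L κ), unary (qM.eval κ), unary ((qK * qM).eval κ), bits c,
        (𝒢.grp I).desc, l.headD nil, l.tail.headD nil] := by
  have h : (list [unary κ, bits c, list ((𝒢.grp I).desc :: l)]).nth 0 = unary κ := rfl
  rw [simBase, h, T.countOp_eq, len_unary]
  congr 1
  cases l with
  | nil => rfl
  | cons a l => cases l <;> rfl

theorem envSD_eq (g g₃ Z : (𝒢.grp I).G) : T.envSD qK qM (list [unary κ, bits c,
    list [(𝒢.grp I).desc, (𝒢.grp I).enc g, (𝒢.grp I).enc g₃, (𝒢.grp I).enc Z]]) =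
      simEnv L κ (qM.eval κ) ((qK * qM).eval κ) c I g g₃ Z g
        (g ^ exponents (qM.eval κ) ((qK * qM).eval κ) c 1 1) 0 := by
  rw [envSD, simBase_eq, block_list]
  change list (_ ++ [_, _, T.pow (𝒢.grp I).desc ((𝒢.grp I).enc g) _, _]) = _
  rw [pow_enc]
  rfl

theorem envGSD_eq (hL : 1 ≤ L κ) (g g₃ C₁ D Z : (𝒢.grp I).G) :
    T.envGSD qK qM (list [unary κ, bits c,
      list [(𝒢.grp I).desc, (𝒢.grp I).enc g, (𝒢.grp I).enc g₃, (𝒢.grp I).enc C₁,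
        (𝒢.grp I).enc D, (𝒢.grp I).enc Z]]) =
      simEnv L κ (qM.eval κ) ((qK * qM).eval κ) c I g g₃ C₁ D Z
        (exponents (qM.eval κ) ((qK * qM).eval κ) c 0 4 % (2 * L κ)) := by
  have h : (list [unary κ, bits c,
      list [(𝒢.grp I).desc, (𝒢.grp I).enc g, (𝒢.grp I).enc g₃, (𝒢.grp I).enc C₁,
        (𝒢.grp I).enc D, (𝒢.grp I).enc Z]]).nth 0 = unary κ := rfl
  rw [envGSD, simBase_eq, block_list, h, T.countOp_eq, unary_add, ← two_mul,
    unaryMod_bits (by omega)]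
  rfl

end Tools

/-! ### Averages over finite types -/

/-- The average of a function on a finite type. -/
noncomputable def mean {α : Type} [Finite α] (f : α → ℝ) : ℝ :=
  letI := Fintype.ofFinite α
  (∑ a, f a) / Fintype.card α

section Mean

variable {α β γ : Type} [Finite α] [Finite β] [Finite γ]

theorem mean_eq_sum [Fintype α] (f : α → ℝ) : mean f = (∑ a, f a) / Fintype.card α := by
  unfold mean
  congr!

theorem mean_add (f g : α → ℝ) : mean (fun a => f a + g a) = mean f + mean g := by
  have := Fintype.ofFinite α
  simp only [mean_eq_sum, Finset.sum_add_distrib, add_div]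

theorem mean_sub (f g : α → ℝ) : mean (fun a => f a - g a) = mean f - mean g := by
  have := Fintype.ofFinite α
  simp only [mean_eq_sum, Finset.sum_sub_distrib, sub_div]

theorem mean_mul_left (c : ℝ) (f : α → ℝ) : mean (fun a => c * f a) = c * mean f := by
  have := Fintype.ofFinite α
  simp only [mean_eq_sum, ← Finset.mul_sum, mul_div_assoc]

@[simp] theorem mean_const [Nonempty α] (c : ℝ) : mean (fun _ : α => c) = c := by
  have := Fintype.ofFinite α
  have h : (Fintype.card α : ℝ) ≠ 0 := by exact_mod_cast Fintype.card_ne_zero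
  simp [mean_eq_sum, h]

theorem mean_mono {f g : α → ℝ} (h : ∀ a, f a ≤ g a) : mean f ≤ mean g := by
  have := Fintype.ofFinite α
  simp only [mean_eq_sum]
  gcongr
  exact h _

theorem mean_nonneg {f : α → ℝ} (h : ∀ a, 0 ≤ f a) : 0 ≤ mean f := by
  have := Fintype.ofFinite α
  rw [mean_eq_sum]
  exact div_nonneg (Finset.sum_nonneg fun a _ => h a) (Nat.cast_nonneg _)

theorem mean_le_one [Nonempty α] {f : α → ℝ} (h : ∀ a, f a ≤ 1) : mean f ≤ 1 := by
  simpa using mean_mono (g := fun _ => 1) h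

theorem abs_mean_le (f : α → ℝ) : |mean f| ≤ mean fun a => |f a| := by
  have := Fintype.ofFinite α
  rw [mean_eq_sum, mean_eq_sum, abs_div, Nat.abs_cast]
  gcongr
  exact Finset.abs_sum_le_sum_abs _ _

theorem abs_mean_sub_mean_le (f g : α → ℝ) : |mean f - mean g| ≤ mean fun a => |f a - g a| := by
  rw [← mean_sub]; exact abs_mean_le _

theorem mean_comm (f : α → β → ℝ) :
    mean (fun a => mean fun b => f a b) = mean fun b => mean fun a => f a b := by
  have := Fintype.ofFinite α
  have := Fintype.ofFinite β
  simp only [mean_eq_sum, Finset.sum_div]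
  rw [Finset.sum_comm]
  simp only [div_right_comm]

theorem mean_prod (f : α × β → ℝ) : mean f = mean fun a => mean fun b => f (a, b) := by
  have := Fintype.ofFinite α
  have := Fintype.ofFinite β
  simp only [mean_eq_sum, Fintype.sum_prod_type, Fintype.card_prod, Nat.cast_mul, Finset.sum_div]
  simp only [div_div, mul_comm]

theorem mean_equiv (e : α ≃ β) (f : β → ℝ) : mean (fun a => f (e a)) = mean f := by
  have := Fintype.ofFinite α
  have := Fintype.ofFinite β
  rw [mean_eq_sum, mean_eq_sum, Fintype.card_congr e, e.sum_comp]

theorem mean_bijective {e : α → β} (he : Function.Bijective e) (f : β → ℝ) :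
    mean (fun a => f (e a)) = mean f := mean_equiv (Equiv.ofBijective e he) f

theorem mean_injective {e : α → α} (he : Function.Injective e) (f : α → ℝ) :
    mean (fun a => f (e a)) = mean f :=
  mean_bijective ⟨he, Finite.surjective_of_injective he⟩ f

theorem mean_congr {f g : α → ℝ} (h : ∀ a, f a = g a) : mean f = mean g := by
  rw [funext h]

/-- If two functions with values in `[0, 1]` agree outside an event, then their averages differ at
most by the probability of the event. -/
theorem abs_mean_sub_mean_le_of_eq {f g : α → ℝ} (p : α → Prop) [DecidablePred p]
    (hf : ∀ a, 0 ≤ f a ∧ f a ≤ 1) (hg : ∀ a, 0 ≤ g a ∧ g a ≤ 1) (h : ∀ a, ¬p a → f a = g a) :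
    |mean f - mean g| ≤ mean fun a => if p a then 1 else 0 := by
  refine (abs_mean_sub_mean_le f g).trans (mean_mono fun a => ?_)
  split
  · rw [abs_le]; constructor <;> linarith [hf a, hg a]
  · rw [h a ‹_›]; simp

/-- The image of a uniformly random element under `φ` is uniformly random. -/
def Equidist (φ : α → β) : Prop := ∀ f : β → ℝ, mean (fun a => f (φ a)) = mean f

/-- The image of a uniformly random element under `φ` has statistical distance at most `ε` from
uniform. -/
def NearUniform (φ : α → β) (ε : ℝ) : Prop :=
  ∀ f : β → ℝ, (∀ b, 0 ≤ f b ∧ f b ≤ 1) → |mean (fun a => f (φ a)) - mean f| ≤ ε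

theorem Equidist.nearUniform {φ : α → β} (h : Equidist φ) : NearUniform φ 0 := fun f _ => by
  rw [h f]; simp

theorem Equidist.of_bijective {φ : α → β} (h : Function.Bijective φ) : Equidist φ :=
  mean_bijective h

theorem Equidist.id : Equidist fun a : α => a := fun _ => rfl

theorem Equidist.comp {φ : α → β} {ψ : β → γ} (hψ : Equidist ψ) (hφ : Equidist φ) :
    Equidist fun a => ψ (φ a) := fun f => by
  rw [← hψ, ← hφ]

theorem Equidist.fst [Nonempty β] : Equidist fun x : α × β => x.1 := fun f => by
  simp [mean_prod]

theorem NearUniform.mono {φ : α → β} {ε ε' : ℝ} (h : NearUniform φ ε) (hε : ε ≤ ε') :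
    NearUniform φ ε' := fun f hf => (h f hf).trans hε

theorem NearUniform.comp {φ : α → β} {ψ : β → γ} {ε ε' : ℝ} (hψ : NearUniform ψ ε)
    (hφ : NearUniform φ ε') : NearUniform (fun a => ψ (φ a)) (ε + ε') := fun f hf => by
  have h1 := hψ f hf
  have h2 := hφ (fun b => f (ψ b)) fun b => hf _
  rw [abs_le] at *
  constructor <;> linarith

theorem NearUniform.prodMap {δ : Type} [Finite δ] [Nonempty β] [Nonempty γ] {φ : α → β} {ψ : γ → δ}
    {ε ε' : ℝ} (hφ : NearUniform φ ε) (hψ : NearUniform ψ ε') :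
    NearUniform (fun x : α × γ => (φ x.1, ψ x.2)) (ε + ε') := fun f hf => by
  rw [mean_prod, mean_prod]
  have h1 := hφ (fun b => mean fun c => f (b, ψ c)) fun b =>
    ⟨mean_nonneg fun c => (hf _).1, mean_le_one fun c => (hf _).2⟩
  have h2 : |(mean fun b => mean fun c => f (b, ψ c)) - mean fun b => mean fun d => f (b, d)| ≤
      ε' := by
    refine (abs_mean_sub_mean_le _ _).trans ?_
    rw [← mean_const (α := β) ε']
    exact mean_mono fun b => hψ (fun d => f (b, d)) fun d => hf _
  rw [abs_le] at *
  constructor <;> linarith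

end Mean

/-- A surjective homomorphism maps the uniform distribution to the uniform distribution. -/
theorem Equidist.of_surjective_mul {G H : Type} [AddGroup G] [Group H] [Finite G] [Finite H]
    {φ : G → H} (h : ∀ x y, φ (x + y) = φ x * φ y) (hs : Function.Surjective φ) :
    Equidist φ := fun f => by
  -- `φ x` and `φ x * b` have the same distribution for every `b` in the image of `φ`
  have h1 : ∀ b, mean (fun x => f (φ x * b)) = mean fun x => f (φ x) := by
    intro b
    obtain ⟨y, rfl⟩ := hs b
    simp only [← h]
    exact mean_injective (fun a b hab => by simpa using hab) fun x => f (φ x)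
  have h2 : ∀ x, mean (fun b => f (φ x * b)) = mean f := fun x =>
    mean_injective (fun a b hab => by simpa using hab) f
  calc mean (fun x => f (φ x)) = mean fun b => mean fun x => f (φ x * b) := by
        simp only [h1, mean_const]
    _ = mean fun x => mean fun b => f (φ x * b) := mean_comm _
    _ = mean f := by simp only [h2, mean_const]

/-- A surjective homomorphism of additive groups maps the uniform distribution to the uniform
distribution. -/
theorem Equidist.of_surjective_add {G H : Type} [AddGroup G] [AddGroup H] [Finite G] [Finite H]
    {φ : G → H} (h : ∀ x y, φ (x + y) = φ x + φ y) (hs : Function.Surjective φ) :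
    Equidist φ :=
  Equidist.of_surjective_mul (H := Multiplicative H) h hs

/-- A subfamily of independent uniformly random elements. -/
theorem Equidist.comp_injective {ι κ X : Type} [Finite ι] [Finite κ] [Finite X] [Nonempty X]
    {σ : κ → ι} (hσ : Function.Injective σ) : Equidist fun x : ι → X => fun k => x (σ k) := by
  classical
  let e := Equiv.piEquivPiSubtypeProd (fun i => i ∈ Set.range σ) fun _ => X
  let e' : ({i // i ∈ Set.range σ} → X) ≃ (κ → X) :=
    (Equiv.ofInjective σ hσ).symm.arrowCongr (Equiv.refl X)
  have h := (Equidist.of_bijective e'.bijective).comp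
    ((Equidist.fst (α := {i // i ∈ Set.range σ} → X) (β := {i // i ∉ Set.range σ} → X)).comp
      (Equidist.of_bijective e.bijective))
  exact h

/-- Independent images of independent uniformly random elements. -/
theorem NearUniform.pi {X Y : Type} [Finite X] [Nonempty X] [Finite Y] [Nonempty Y] {φ : X → Y}
    {ε : ℝ} (h : NearUniform φ ε) {ι : Type} [Fintype ι] :
    NearUniform (fun x : ι → X => fun i => φ (x i)) (Fintype.card ι * ε) := by
  classical
  have hn : ∀ n : ℕ, NearUniform (fun x : Fin n → X => fun i => φ (x i)) (n * ε) := by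
    intro n
    induction n with
    | zero =>
      intro f _
      have : (fun x : Fin 0 → X => f fun i => φ (x i)) = fun _ => f Fin.elim0 := by
        funext x; congr 1; exact Subsingleton.elim _ _
      have h' : f = fun _ => f Fin.elim0 := by
        funext x; congr 1; exact Subsingleton.elim _ _
      rw [this, h']
      simp
    | succ n ih =>
      have h1 := h.prodMap ih
      have h2 := ((Equidist.of_bijective
        (Fin.consEquiv fun _ : Fin (n + 1) => Y).bijective).nearUniform.comp
        h1).comp (Equidist.of_bijective
          (Fin.consEquiv fun _ : Fin (n + 1) => X).symm.bijective).nearUniform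
      have h3 : (0 + (ε + n * ε) + 0) = ((n + 1 : ℕ) : ℝ) * ε := by push_cast; ring
      rw [h3] at h2
      convert h2 using 2 with x
      funext i
      refine Fin.cases ?_ (fun i => ?_) i <;> simp [Fin.consEquiv, Fin.tail]
  have e := Fintype.equivFin ι
  have h1 := (((Equidist.of_bijective
    (e.arrowCongr (Equiv.refl Y)).symm.bijective).nearUniform).comp (hn (Fintype.card ι))).comp
    (Equidist.of_bijective (e.arrowCongr (Equiv.refl X)).bijective).nearUniform
  have h3 : (0 + (Fintype.card ι) * ε + 0) = (Fintype.card ι) * ε := by ring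
  rw [h3] at h1
  convert h1 using 2 with x
  funext i
  simp

/-- Reduction modulo `N` of a uniformly random number below `Q`. -/
theorem NearUniform.natCast (Q N : ℕ) [NeZero Q] [NeZero N] :
    NearUniform (fun x : Fin Q => (x.val : ZMod N)) (N / Q) := fun f hf => by
  have hQ : (0 : ℝ) < Q := by exact_mod_cast Nat.pos_of_neZero Q
  have hN : (0 : ℝ) < N := by exact_mod_cast Nat.pos_of_neZero N
  -- one full period
  have hper : ∀ a : ℕ, ∑ i ∈ Finset.range N, f ((a + i : ℕ) : ZMod N) = ∑ y, f y := by
    intro a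
    have e : ∑ i ∈ Finset.range N, f ((a + i : ℕ) : ZMod N) = ∑ y : ZMod N, f (a + y) := by
      refine Finset.sum_bij' (fun i _ => (i : ZMod N)) (fun y _ => y.val) (by simp)
        (fun y _ => by simpa using ZMod.val_lt y) (fun i hi => by
          simpa using ZMod.val_cast_of_lt (by simpa using hi)) (by simp) (by simp)
    rw [e]
    exact Equiv.sum_comp (Equiv.addLeft (a : ZMod N)) f
  have hmul : ∀ q : ℕ, ∑ i ∈ Finset.range (N * q), f ((i : ℕ) : ZMod N) = q * ∑ y, f y := by
    intro q
    induction q with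
    | zero => simp
    | succ q ih =>
      rw [Nat.mul_succ, Finset.sum_range_add, ih, hper]; push_cast; ring
  obtain ⟨S, hS⟩ : ∃ S, S = ∑ y, f y := ⟨_, rfl⟩
  have hS0 : 0 ≤ S := by rw [hS]; exact Finset.sum_nonneg fun y _ => (hf y).1
  have hSN : S ≤ N := by
    rw [hS]
    refine (Finset.sum_le_sum fun y _ => (hf y).2).trans ?_
    simp [ZMod.card]
  -- the incomplete period at the end
  obtain ⟨ρ, hρ⟩ : ∃ ρ, ρ = ∑ i ∈ Finset.range (Q % N), f ((N * (Q / N) + i : ℕ) : ZMod N) :=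
    ⟨_, rfl⟩
  have hρ0 : 0 ≤ ρ := by rw [hρ]; exact Finset.sum_nonneg fun y _ => (hf _).1
  have hρr : ρ ≤ (Q % N : ℕ) := by
    rw [hρ]
    refine (Finset.sum_le_sum fun y _ => (hf _).2).trans ?_
    simp
  have hr : ((Q % N : ℕ) : ℝ) ≤ N := by exact_mod_cast (Nat.mod_lt Q (Nat.pos_of_neZero N)).le
  have hr0 : (0 : ℝ) ≤ (Q % N : ℕ) := Nat.cast_nonneg _
  have hQe : (Q : ℝ) = N * (Q / N : ℕ) + (Q % N : ℕ) := by
    exact_mod_cast (Nat.div_add_mod Q N).symm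
  have h1 : mean (fun x : Fin Q => f (x.val : ZMod N)) = ((Q / N : ℕ) * S + ρ) / Q := by
    rw [mean_eq_sum, Fintype.card_fin, Fin.sum_univ_eq_sum_range fun i => f ((i : ℕ) : ZMod N)]
    congr 1
    conv_lhs => rw [← Nat.div_add_mod Q N]
    rw [Finset.sum_range_add, hmul, ← hS, ← hρ]
  have h2 : mean f = S / N := by rw [mean_eq_sum, ZMod.card, hS]
  have h3 : ((Q / N : ℕ) * S + ρ) / Q - S / N = (ρ * N - (Q % N : ℕ) * S) / (Q * N) := by
    rw [div_sub_div _ _ hQ.ne' hN.ne']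
    congr 1
    rw [hQe]; ring
  rw [h1, h2, h3, abs_div, abs_of_pos (mul_pos hQ hN), div_le_div_iff₀ (mul_pos hQ hN) hQ]
  have h4 : |ρ * N - (Q % N : ℕ) * S| ≤ N * N := by
    rw [abs_le]; constructor <;> nlinarith
  nlinarith

open Data in
/-- A block of bits, read as a number modulo `N`. -/
theorem NearUniform.natOfBits (M N : ℕ) [NeZero N] :
    NearUniform (fun b : Fin M → Bool => (natOfBits (List.ofFn b) : ZMod N)) (N / 2 ^ M) := by
  have hlt : ∀ l : List Bool, Data.natOfBits l < 2 ^ l.length := by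
    intro l
    induction l using List.reverseRecOn with
    | nil => simp [Data.natOfBits]
    | append_singleton l c ih =>
      simp only [Data.natOfBits, List.foldl_append, List.length_append, List.length_singleton,
        List.foldl_cons, List.foldl_nil, pow_succ] at ih ⊢
      have : c.toNat ≤ 1 := by cases c <;> simp
      omega
  have hinj : ∀ l l' : List Bool, l.length = l'.length → Data.natOfBits l = Data.natOfBits l' →
      l = l' := by
    intro l
    induction l using List.reverseRecOn with
    | nil => intro l' h _; simpa [eq_comm] using h
    | append_singleton l c ih =>
      intro l' h h'
      rcases List.eq_nil_or_concat l' with rfl | ⟨l'', c', rfl⟩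
      · simp at h
      · rw [List.concat_eq_append] at h h' ⊢
        simp only [Data.natOfBits, List.foldl_append, List.foldl_cons, List.foldl_nil] at h'
        have hc : c = c' := by cases c <;> cases c' <;> simp at h' ⊢ <;> omega
        subst hc
        rw [ih l'' (by simpa using h) (by simp only [Data.natOfBits]; omega)]
  let e : (Fin M → Bool) → Fin (2 ^ M) := fun b => ⟨Data.natOfBits (List.ofFn b), by
    simpa using hlt (List.ofFn b)⟩
  have he : Function.Injective e := fun b b' h => by
    have := hinj (List.ofFn b) (List.ofFn b') (by simp) (by simpa [e] using h)
    exact List.ofFn_injective this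
  have hb : Function.Bijective e :=
    (Fintype.bijective_iff_injective_and_card e).2 ⟨he, by simp⟩
  have := (NearUniform.natCast (2 ^ M) N).comp (Equidist.of_bijective hb).nearUniform
  simpa using this

/-! ### Probabilities of experiments -/

theorem expect_unif {α : Type} [Finite α] [Nonempty α] (f : α → ℝ) :
    expect (unif α) f = mean f := by
  have := Fintype.ofFinite α
  have h : ∀ a : α, (unif α a).toReal = (Fintype.card α : ℝ)⁻¹ := by
    intro a
    have : unif α = PMF.uniformOfFintype α := by unfold unif; congr!
    rw [this, PMF.uniformOfFintype_apply]; simp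
  rw [expect, tsum_fintype, mean_eq_sum, Finset.sum_div]
  exact Finset.sum_congr rfl fun a _ => by rw [h, div_eq_inv_mul]

theorem toReal_bind {α β : Type} (p : PMF α) (k : α → PMF β) (b : β) :
    ((p.bind k) b).toReal = expect p fun a => (k a b).toReal := by
  rw [PMF.bind_apply, ENNReal.tsum_toReal_eq fun a =>
    ENNReal.mul_ne_top (PMF.apply_ne_top _ _) (PMF.apply_ne_top _ _)]
  simp [expect, ENNReal.toReal_mul]

theorem toReal_unif_bind {α β : Type} [Finite α] [Nonempty α] (k : α → PMF β) (b : β) :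
    (((unif α).bind k) b).toReal = mean fun a => (k a b).toReal := by
  rw [toReal_bind, expect_unif]

theorem toReal_pure (x b : Bool) :
    ((pure x : PMF Bool) b).toReal = if x = b then 1 else 0 := by
  change ((PMF.pure x) b).toReal = _
  rw [PMF.pure_apply]
  by_cases h : x = b
  · simp [h]
  · rw [if_neg h, if_neg (Ne.symm h)]; rfl

theorem toReal_false (p : PMF Bool) : (p false).toReal = 1 - (p true).toReal := by
  have h := p.tsum_coe
  rw [tsum_fintype, Fintype.sum_bool] at h
  have h2 := congrArg ENNReal.toReal h
  rw [ENNReal.toReal_add (p.apply_ne_top _) (p.apply_ne_top _)] at h2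
  simp at h2
  linarith

section Expect

variable {α : Type} (p : PMF α)

theorem summable_toReal : Summable fun a => (p a).toReal :=
  ENNReal.summable_toReal (by simp [p.tsum_coe])

theorem tsum_toReal : ∑' a, (p a).toReal = 1 := by
  rw [← ENNReal.tsum_toReal_eq fun a => p.apply_ne_top a, p.tsum_coe]; simp

theorem summable_expect {f : α → ℝ} (h : ∃ C, ∀ a ∈ p.support, |f a| ≤ C) :
    Summable fun a => (p a).toReal * f a := by
  obtain ⟨C, hC⟩ := h
  refine Summable.of_norm_bounded ((summable_toReal p).mul_right C) fun a => ?_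
  rw [Real.norm_eq_abs, abs_mul, abs_of_nonneg ENNReal.toReal_nonneg]
  by_cases ha : a ∈ p.support
  · exact mul_le_mul_of_nonneg_left (hC a ha) ENNReal.toReal_nonneg
  · rw [PMF.mem_support_iff, not_not] at ha
    simp [ha]

variable {p}

theorem expect_mono {f g : α → ℝ} (hf : ∃ C, ∀ a ∈ p.support, |f a| ≤ C)
    (hg : ∃ C, ∀ a ∈ p.support, |g a| ≤ C)
    (h : ∀ a ∈ p.support, f a ≤ g a) : expect p f ≤ expect p g := by
  refine (summable_expect p hf).tsum_le_tsum (fun a => ?_) (summable_expect p hg)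
  by_cases ha : a ∈ p.support
  · exact mul_le_mul_of_nonneg_left (h a ha) ENNReal.toReal_nonneg
  · rw [PMF.mem_support_iff, not_not] at ha
    simp [ha]

theorem expect_congr {f g : α → ℝ} (h : ∀ a ∈ p.support, f a = g a) :
    expect p f = expect p g := by
  refine tsum_congr fun a => ?_
  by_cases ha : a ∈ p.support
  · rw [h a ha]
  · rw [PMF.mem_support_iff, not_not] at ha
    simp [ha]

theorem expect_add {f g : α → ℝ} (hf : ∃ C, ∀ a ∈ p.support, |f a| ≤ C)
    (hg : ∃ C, ∀ a ∈ p.support, |g a| ≤ C) :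
    expect p (fun a => f a + g a) = expect p f + expect p g := by
  simp only [expect, mul_add]
  exact (summable_expect p hf).tsum_add (summable_expect p hg)

theorem expect_mul_left (c : ℝ) (f : α → ℝ) : expect p (fun a => c * f a) = c * expect p f := by
  simp only [expect, ← tsum_mul_left]
  exact tsum_congr fun a => by ring

theorem expect_sub {f g : α → ℝ} (hf : ∃ C, ∀ a ∈ p.support, |f a| ≤ C)
    (hg : ∃ C, ∀ a ∈ p.support, |g a| ≤ C) :
    expect p (fun a => f a - g a) = expect p f - expect p g := by
  simp only [expect, mul_sub]
  exact (summable_expect p hf).tsum_sub (summable_expect p hg)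

@[simp] theorem expect_const (c : ℝ) : expect p (fun _ => c) = c := by
  rw [expect, tsum_mul_right, tsum_toReal, one_mul]

theorem abs_expect_le {f g : α → ℝ} (hg : ∃ C, ∀ a ∈ p.support, |g a| ≤ C)
    (h : ∀ a ∈ p.support, |f a| ≤ g a) : |expect p f| ≤ expect p g := by
  obtain ⟨C, hC⟩ := hg
  have hf : ∃ C, ∀ a ∈ p.support, |f a| ≤ C :=
    ⟨C, fun a ha => (h a ha).trans ((le_abs_self _).trans (hC a ha))⟩
  have h1 := expect_mono hf ⟨C, hC⟩ fun a ha => (le_abs_self _).trans (h a ha)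
  have h2 := expect_mono (f := fun a => -f a) (by simpa using hf) ⟨C, hC⟩
    fun a ha => (neg_le_abs _).trans (h a ha)
  have h3 : expect p (fun a => -f a) = -expect p f := by
    simpa using expect_mul_left (p := p) (-1) f
  rw [h3] at h2
  exact abs_le.2 ⟨by linarith, h1⟩

end Expect

/-- Independent samples of images of uniformly random elements. -/
theorem pmfPi_unif_map {ι : Type} [Fintype ι] {X : Type} [Finite X] [Nonempty X] {Y : ι → Type}
    (f : ∀ i, X → Y i) :
    pmfPi (fun i => (unif X).map (f i)) = (unif (ι → X)).map fun x i => f i (x i) := by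
  classical
  have := Fintype.ofFinite X
  have hu : ∀ (Z : Type) [Fintype Z] [Nonempty Z] (z : Z),
      unif Z z = (Fintype.card Z : ENNReal)⁻¹ := by
    intro Z _ _ z
    have : unif Z = PMF.uniformOfFintype Z := by unfold unif; congr!
    rw [this, PMF.uniformOfFintype_apply]
  ext y
  change ∏ i, ((unif X).map (f i)) (y i) = _
  simp only [PMF.map_apply, tsum_fintype, hu]
  rw [Finset.prod_univ_sum, Fintype.piFinset_univ]
  refine Finset.sum_congr rfl fun x _ => ?_
  by_cases h : y = fun i => f i (x i)
  · rw [if_pos h, Finset.prod_congr rfl fun i _ => if_pos (congrFun h i)]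
    rw [Finset.prod_const, Finset.card_univ, Fintype.card_fun, Nat.cast_pow, ENNReal.inv_pow]
  · rw [if_neg h]
    obtain ⟨i, hi⟩ := Function.ne_iff.1 h
    exact Finset.prod_eq_zero (Finset.mem_univ i) (if_neg hi)

/-! ### Leftover hash lemma -/

theorem mean_ite_eq {R : Type} [Finite R] [DecidableEq R] (r : R) :
    mean (fun s => if r = s then (1 : ℝ) else 0) = (Nat.card R : ℝ)⁻¹ := by
  have := Fintype.ofFinite R
  rw [mean_eq_sum, Finset.sum_ite_eq, if_pos (Finset.mem_univ r), Nat.card_eq_fintype_card,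
    one_div]

theorem mean_mul_sq_le {α : Type} [Finite α] [Nonempty α] (f g : α → ℝ) :
    mean (fun a => f a * g a) ^ 2 ≤ mean (fun a => f a ^ 2) * mean fun a => g a ^ 2 := by
  have := Fintype.ofFinite α
  have h : (0 : ℝ) < Fintype.card α := by exact_mod_cast Fintype.card_pos
  rw [mean_eq_sum, mean_eq_sum, mean_eq_sum, div_pow, div_mul_div_comm, ← sq]
  gcongr
  exact Finset.sum_mul_sq_le_sq_mul_sq _ _ _

/-- Leftover hash lemma: under a pairwise independent hash function with known key, the image of a
uniformly random element of a large set looks uniformly random. The proof bounds the collision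
probability and applies the Cauchy–Schwarz inequality. -/
theorem leftover_hash {Q S R X : Type} [Finite Q] [Nonempty Q] [Finite R] [Nonempty R] [Finite X]
    [Nonempty X] (hash : Q → S → R) (v : X → S) (hv : Function.Injective v)
    (hpi : ∀ x y, x ≠ y → (unif Q).map (fun k => (hash k x, hash k y)) = unif (R × R))
    (φ : Q → R → ℝ) (hφ : ∀ k r, 0 ≤ φ k r ∧ φ k r ≤ 1) :
    |mean (fun k => mean fun x => φ k (hash k (v x))) - mean fun k => mean fun r => φ k r| ≤
      1 / 2 * √(Nat.card R / Nat.card X) := by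
  classical
  obtain ⟨ρ, hρ⟩ : ∃ ρ : ℝ, ρ = Nat.card R := ⟨_, rfl⟩
  have hρ0 : 0 < ρ := by rw [hρ]; exact_mod_cast Nat.card_pos
  obtain ⟨χ, hχ⟩ : ∃ χ : ℝ, χ = Nat.card X := ⟨_, rfl⟩
  have hχ0 : 0 < χ := by rw [hχ]; exact_mod_cast Nat.card_pos
  -- the collision probability of two distinct points
  have hcoll : ∀ x y, x ≠ y → mean (fun k => if hash k x = hash k y then (1 : ℝ) else 0) = ρ⁻¹ := by
    intro x y hxy
    have h1 := congrArg (fun p => ((p.bind fun z : R × R =>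
      (PMF.pure (decide (z.1 = z.2)))) true).toReal) (hpi x y hxy)
    simp only [PMF.bind_map, toReal_unif_bind] at h1
    have h2 : ∀ z : R × R, ((PMF.pure (decide (z.1 = z.2))) true).toReal =
        if z.1 = z.2 then 1 else 0 := by
      intro z
      refine (toReal_pure _ _).trans ?_
      simp
    simp only [Function.comp_def] at h1
    rw [mean_congr fun k => (h2 (hash k x, hash k y)).symm, h1, mean_congr h2, mean_prod]
    simp only [mean_ite_eq, mean_const, hρ]
  -- the probability that `v x` is mapped to `r` under the key `k`
  obtain ⟨q, hq⟩ : ∃ q : Q → R → ℝ,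
    q = fun k r => mean fun x => if hash k (v x) = r then 1 else 0 := ⟨_, rfl⟩
  have hqm : ∀ k, mean (q k) = ρ⁻¹ := by
    intro k
    rw [hq, mean_comm]
    simp only [mean_ite_eq, mean_const, hρ]
  have hqφ : ∀ k, mean (fun x => φ k (hash k (v x))) = ρ * mean fun r => φ k r * q k r := by
    intro k
    have h1 : ∀ s, φ k s = ρ * mean fun r => φ k r * if s = r then 1 else 0 := by
      intro s
      have : ∀ r, φ k r * (if s = r then 1 else 0) = φ k s * if s = r then 1 else 0 := by
        intro r
        by_cases h : s = r
        · rw [h]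
        · simp [h]
      simp only [this, mean_mul_left, mean_ite_eq, ← hρ]
      field_simp
    rw [mean_congr fun x => h1 (hash k (v x)), mean_mul_left, mean_comm]
    congr 1
    refine mean_congr fun r => ?_
    rw [mean_mul_left, hq]
  -- the collision probability of the images of two random points
  have hsq : mean (fun k => mean fun r => q k r ^ 2) ≤ ρ⁻¹ * (ρ⁻¹ + χ⁻¹) := by
    have h1 : ∀ k r, q k r ^ 2 = mean fun x => mean fun y =>
        (if hash k (v x) = r then 1 else 0) * if hash k (v y) = r then (1 : ℝ) else 0 := by
      intro k r
      simp only [mean_mul_left]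
      simp only [sq, hq, mul_comm _ (mean _), mean_mul_left]
    have h2 : ∀ k, mean (fun r => q k r ^ 2) = mean fun x => mean fun y =>
        ρ⁻¹ * if hash k (v x) = hash k (v y) then (1 : ℝ) else 0 := by
      intro k
      simp only [h1]
      rw [mean_comm]
      refine mean_congr fun x => ?_
      rw [mean_comm]
      refine mean_congr fun y => ?_
      by_cases h : hash k (v x) = hash k (v y)
      · rw [h, if_pos rfl, mul_one, hρ, ← mean_ite_eq (hash k (v y))]
        refine mean_congr fun r => ?_
        split <;> simp
      · have : ∀ r, (if hash k (v x) = r then 1 else 0) *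
            (if hash k (v y) = r then (1 : ℝ) else 0) = 0 := by
          intro r
          by_cases h' : hash k (v x) = r
          · simp [← h', Ne.symm h]
          · simp [h']
        simp [this, h]
    simp only [h2]
    rw [mean_comm]
    have h3 : ∀ x, mean (fun k => mean fun y => ρ⁻¹ *
        if hash k (v x) = hash k (v y) then (1 : ℝ) else 0) ≤ ρ⁻¹ * (ρ⁻¹ + χ⁻¹) := by
      intro x
      rw [mean_comm, hχ, ← mean_ite_eq x]
      have h4 : ∀ y, mean (fun k => ρ⁻¹ * if hash k (v x) = hash k (v y) then (1 : ℝ) else 0) ≤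
          ρ⁻¹ * (ρ⁻¹ + if x = y then 1 else 0) := by
        intro y
        rw [mean_mul_left]
        gcongr
        by_cases h : x = y
        · subst h; simp [hρ0.le]
        · rw [hcoll _ _ (hv.ne h)]; simp [h]
      refine (mean_mono h4).trans_eq ?_
      rw [mean_mul_left, mean_add, mean_const]
    refine (mean_mono h3).trans_eq (mean_const _)
  -- subtracting `1 / 2` changes nothing, as `q k` has mean `ρ⁻¹`, and it halves the final bound
  have hdiff : mean (fun k => mean fun x => φ k (hash k (v x))) -
      mean (fun k => mean fun r => φ k r) =
      ρ * mean fun z : Q × R => (φ z.1 z.2 - 1 / 2) * (q z.1 z.2 - ρ⁻¹) := by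
    rw [← mean_sub, mean_prod, ← mean_mul_left]
    refine mean_congr fun k => ?_
    have : ∀ r, (φ k r - 1 / 2) * (q k r - ρ⁻¹) =
        (φ k r * q k r - 1 / 2 * q k r) - (ρ⁻¹ * φ k r - 1 / 2 * ρ⁻¹) := fun r => by ring
    simp only [this, mean_sub, mean_mul_left, mean_const]
    rw [hqφ, hqm]
    field_simp
    ring
  have hvar : mean (fun z : Q × R => (q z.1 z.2 - ρ⁻¹) ^ 2) ≤ ρ⁻¹ * χ⁻¹ := by
    have : ∀ z : Q × R, (q z.1 z.2 - ρ⁻¹) ^ 2 =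
        q z.1 z.2 ^ 2 - (2 * ρ⁻¹ * q z.1 z.2 - ρ⁻¹ * ρ⁻¹) := fun z => by ring
    simp only [this]
    rw [mean_sub, mean_sub, mean_mul_left, mean_const, mean_prod, mean_prod]
    simp only [hqm, mean_const]
    linarith
  have hφ2 : mean (fun z : Q × R => (φ z.1 z.2 - 1 / 2) ^ 2) ≤ 1 / 4 := by
    refine (mean_mono (g := fun _ => 1 / 4) fun z => ?_).trans_eq (mean_const _)
    have := hφ z.1 z.2
    nlinarith
  rw [hdiff]
  apply abs_le_of_sq_le_sq _ (by positivity)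
  rw [← hρ, ← hχ, mul_pow, mul_pow, Real.sq_sqrt (by positivity)]
  have h5 := mean_mul_sq_le (fun z : Q × R => φ z.1 z.2 - 1 / 2) fun z => q z.1 z.2 - ρ⁻¹
  have h6 : (0 : ℝ) ≤ mean fun z : Q × R => (q z.1 z.2 - ρ⁻¹) ^ 2 :=
    mean_nonneg fun z => sq_nonneg _
  calc _ ≤ ρ ^ 2 * (1 / 4 * (ρ⁻¹ * χ⁻¹)) := by
        gcongr
        exact h5.trans (mul_le_mul hφ2 hvar h6 (by norm_num))
    _ = _ := by field_simp; norm_num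

/-! ### Exponents modulo the group order -/

namespace BilinearGroup

variable (B : BilinearGroup)

/-- Powers with exponents in `ℤ/N`. -/
def pw (x : B.G) (a : ZMod B.N) : B.G := x ^ a.val

/-- Powers in the target group with exponents in `ℤ/N`. -/
def pwT (x : B.GT) (a : ZMod B.N) : B.GT := x ^ a.val

variable {B}

theorem pow_N (x : B.G) : x ^ B.N = 1 := by
  have := pow_card_eq_one' (x := x)
  rwa [B.card_G] at this

theorem powT_N (x : B.GT) : x ^ B.N = 1 := by
  have := pow_card_eq_one' (x := x)
  rwa [B.card_GT] at this

theorem pow_mod_N (x : B.G) (n : ℕ) : x ^ (n % B.N) = x ^ n := by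
  conv_rhs => rw [← Nat.div_add_mod n B.N, pow_add, pow_mul, pow_N, one_pow, one_mul]

theorem pw_natCast (x : B.G) (n : ℕ) : B.pw x n = x ^ n := by
  rw [pw, ZMod.val_natCast, pow_mod_N]

theorem pw_add (x : B.G) (a b : ZMod B.N) : B.pw x (a + b) = B.pw x a * B.pw x b := by
  rw [pw, ZMod.val_add, pow_mod_N, pow_add]; rfl

theorem pw_mul (x : B.G) (a b : ZMod B.N) : B.pw x (a * b) = B.pw (B.pw x a) b := by
  rw [pw, ZMod.val_mul, pow_mod_N, pow_mul]; rfl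

@[simp] theorem pw_zero (x : B.G) : B.pw x 0 = 1 := by simp [pw]

theorem pw_neg (x : B.G) (a : ZMod B.N) : B.pw x (-a) = (B.pw x a)⁻¹ := by
  rw [eq_inv_iff_mul_eq_one, ← pw_add]; simp

theorem pw_sub (x : B.G) (a b : ZMod B.N) : B.pw x (a - b) = B.pw x a * (B.pw x b)⁻¹ := by
  rw [sub_eq_add_neg, pw_add, pw_neg]

theorem mul_pw (x y : B.G) (a : ZMod B.N) : B.pw (x * y) a = B.pw x a * B.pw y a := mul_pow _ _ _

theorem pw_comm (x : B.G) (a b : ZMod B.N) : B.pw (B.pw x a) b = B.pw (B.pw x b) a := by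
  rw [← pw_mul, ← pw_mul, mul_comm]

theorem e_pw_left (x y : B.G) (a : ZMod B.N) : B.e (B.pw x a) y = B.pwT (B.e x y) a := by
  rw [pw, map_pow]; rfl

/-! ### The subgroups of prime order and the pairing -/

theorem mem_sub_iff {p : ℕ} {x : B.G} : x ∈ B.sub p ↔ x ^ p = 1 := Iff.rfl

theorem pw_mem {p : ℕ} {x : B.G} (hx : x ∈ B.sub p) (a : ZMod B.N) : B.pw x a ∈ B.sub p :=
  Subgroup.pow_mem _ hx _

theorem card_sub {p : ℕ} (hp : p ∣ B.N) : Nat.card (B.sub p) = p := by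
  have := IsCyclic.card_powMonoidHom_ker B.G p
  rwa [B.card_G, Nat.gcd_eq_right (by exact hp)] at this

theorem dvd₁ : B.p₁ ∣ B.N := ⟨B.p₂ * B.p₃, by rw [N, mul_assoc]⟩

theorem dvd₂ : B.p₂ ∣ B.N := ⟨B.p₁ * B.p₃, by rw [N]; ring⟩

theorem Gens.mem {p : ℕ} (g : B.Gens p) : g.1 ∈ B.sub p := by
  have h : Subgroup.zpowers g.1 = B.sub p := g.2
  exact h.le (Subgroup.mem_zpowers g.1)

/-- An exponent of an element of the subgroup of order `p` matters only modulo `p`. -/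
theorem pw_eq_of_cast_eq {p : ℕ} (hp : p ∣ B.N) {x : B.G} (hx : x ∈ B.sub p) {a b : ZMod B.N}
    (h : ZMod.castHom hp (ZMod p) a = ZMod.castHom hp (ZMod p) b) : B.pw x a = B.pw x b := by
  have : ∀ c : ZMod B.N, ZMod.castHom hp (ZMod p) c = (c.val : ZMod p) := by
    intro c
    rw [ZMod.castHom_apply, ZMod.natCast_val]
  rw [this, this, ZMod.natCast_eq_natCast_iff] at h
  exact pow_eq_pow_iff_modEq.2 (h.of_dvd (orderOf_dvd_of_pow_eq_one hx))

/-- Uniformly random powers of a generator are uniformly random. -/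
theorem equidist_pw {p : ℕ} {g : B.G} (hg : Subgroup.zpowers g = B.sub p) (hm : g ∈ B.sub p) :
    Equidist fun a : ZMod B.N => (⟨B.pw g a, pw_mem hm a⟩ : B.sub p) := by
  refine Equidist.of_surjective_mul (fun a b => Subtype.ext (pw_add g a b)) fun y => ?_
  have hy : y.1 ∈ Subgroup.zpowers g := by rw [hg]; exact y.2
  rw [← mem_powers_iff_mem_zpowers] at hy
  obtain ⟨n, hn⟩ := hy
  exact ⟨n, Subtype.ext ((pw_natCast g n).trans hn)⟩

theorem zpowers_eq_sub {p : ℕ} (hp : p.Prime) (hd : p ∣ B.N) {x : B.G} (hx : x ∈ B.sub p)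
    (h1 : x ≠ 1) : Subgroup.zpowers x = B.sub p := by
  have hle : Subgroup.zpowers x ≤ B.sub p := by
    rw [Subgroup.zpowers_le]; exact hx
  have := Fact.mk hp
  refine Subgroup.eq_of_le_of_card_ge hle ?_
  rw [card_sub hd, Nat.card_zpowers, orderOf_eq_prime hx h1]

theorem e_eq_one {p q : ℕ} (h : p.Coprime q) {x y : B.G} (hx : x ∈ B.sub p) (hy : y ∈ B.sub q) :
    B.e x y = 1 := by
  have h1 : B.e x y ^ p = 1 := by
    rw [← MonoidHom.pow_apply, ← map_pow, mem_sub_iff.1 hx]; simp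
  have h2 : B.e x y ^ q = 1 := by rw [← map_pow, mem_sub_iff.1 hy]; simp
  have h3 := Nat.dvd_gcd (orderOf_dvd_of_pow_eq_one h1) (orderOf_dvd_of_pow_eq_one h2)
  rw [h.gcd_eq_one, Nat.dvd_one, orderOf_eq_one_iff] at h3
  exact h3

/-- The pairing is non-degenerate on the subgroup of order `p₂`. -/
theorem e_ne_one {x y : B.G} (hx : x ∈ B.sub B.p₂) (hy : y ∈ B.sub B.p₂) (hx1 : x ≠ 1)
    (hy1 : y ≠ 1) : B.e x y ≠ 1 := by
  obtain ⟨g, hg⟩ := B.nondegenerate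
  have hpow : ∀ z : B.G, ∃ n : ℕ, B.gen ^ n = z := fun z => by
    have : z ∈ Subgroup.zpowers B.gen := by rw [B.zpowers_gen]; trivial
    rwa [← mem_powers_iff_mem_zpowers] at this
  have hgen : orderOf (B.e B.gen B.gen) = B.N := by
    obtain ⟨n, hn⟩ := hpow g
    refine Nat.dvd_antisymm (orderOf_dvd_of_pow_eq_one (powT_N _)) ?_
    rw [N, ← hg, ← hn, map_pow, map_pow, MonoidHom.pow_apply]
    exact (orderOf_pow_dvd n).trans (orderOf_pow_dvd n)
  have hgenG : orderOf B.gen = B.N := by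
    rw [← Nat.card_zpowers, B.zpowers_gen, Subgroup.card_top, B.card_G]; rfl
  obtain ⟨a, rfl⟩ := hpow x
  obtain ⟨b, rfl⟩ := hpow y
  have key : ∀ c : ℕ, B.gen ^ c ∈ B.sub B.p₂ → B.p₁ * B.p₃ ∣ c := by
    intro c hc
    rw [mem_sub_iff, ← pow_mul] at hc
    have h1 := orderOf_dvd_of_pow_eq_one hc
    rw [hgenG, N, show B.p₁ * B.p₂ * B.p₃ = (B.p₁ * B.p₃) * B.p₂ by ring] at h1
    exact Nat.dvd_of_mul_dvd_mul_right B.prime₂.pos h1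
  have key2 : ∀ c : ℕ, B.gen ^ c ≠ 1 → B.gen ^ c ∈ B.sub B.p₂ → ¬ B.p₂ ∣ c := by
    intro c hc hm hd
    apply hc
    rw [← orderOf_dvd_iff_pow_eq_one, hgenG, N,
      show B.p₁ * B.p₂ * B.p₃ = (B.p₁ * B.p₃) * B.p₂ by ring]
    refine Nat.Coprime.mul_dvd_of_dvd_of_dvd ?_ (key c hm) hd
    exact Nat.Coprime.mul_left ((Nat.coprime_primes B.prime₁ B.prime₂).2 B.ne₁₂)
      ((Nat.coprime_primes B.prime₃ B.prime₂).2 B.ne₂₃.symm)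
  intro h
  rw [map_pow, map_pow, MonoidHom.pow_apply, ← pow_mul] at h
  have h1 := orderOf_dvd_of_pow_eq_one h
  rw [hgen] at h1
  rcases B.prime₂.dvd_mul.1 ((dvd₂ (B := B)).trans h1) with h2 | h2
  · exact key2 _ hx1 hx h2
  · exact key2 _ hy1 hy h2

theorem exists_idempotent (B : BilinearGroup) : ∃ ε : ZMod B.N,
    ZMod.castHom dvd₁ (ZMod B.p₁) ε = 0 ∧ ZMod.castHom dvd₂ (ZMod B.p₂) ε = 1 ∧ ε * ε = ε := by
  have hc : (B.p₁ * B.p₃).Coprime B.p₂ :=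
    Nat.Coprime.mul_left ((Nat.coprime_primes B.prime₁ B.prime₂).2 B.ne₁₂)
      ((Nat.coprime_primes B.prime₃ B.prime₂).2 B.ne₂₃.symm)
  obtain ⟨n, h0, h1⟩ := Nat.chineseRemainder hc 0 1
  refine ⟨n, ?_, ?_, ?_⟩
  · rw [map_natCast, ZMod.natCast_eq_zero_iff]
    exact (Dvd.intro _ rfl).trans ((Nat.modEq_zero_iff_dvd).1 h0)
  · rw [map_natCast, ← Nat.cast_one, ZMod.natCast_eq_natCast_iff]
    exact h1
  · rw [← Nat.cast_mul, ZMod.natCast_eq_natCast_iff]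
    have h2 : n * n ≡ n [MOD (B.p₁ * B.p₃) * B.p₂] := by
      rw [← Nat.modEq_and_modEq_iff_modEq_mul hc]
      exact ⟨(h0.mul_left n).trans (by simpa using h0.symm), by simpa using h1.mul_left n⟩
    rwa [show (B.p₁ * B.p₃) * B.p₂ = B.N by rw [N]; ring] at h2

end BilinearGroup

/-! ### The games for a fixed group -/

open Data BilinearGroup

/-- Agreement of two views in all that the adversary gets to see. -/
structure View.Agree {B : BilinearGroup} (L : ℕ) (X X' : View B) : Prop where
  g : X.g = X'.g
  Y : X.Y = X'.Y
  A : ∀ k ∈ Finset.Icc 1 L, X.A k = X'.A k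
  U : ∀ k ∈ Finset.Icc 1 (2 * L), k ≠ L + 1 → X.U k = X'.U k
  Ω : X.Ω = X'.Ω
  V : ∀ j ∈ Finset.Icc 1 L, X.V j = X'.V j
  W : ∀ j ∈ Finset.Icc 1 L, ∀ k ∈ Finset.Icc 1 L, k ≠ L + 1 - j → X.W j k = X'.W j k
  C₁ : X.C₁ = X'.C₁
  C₂ : ∀ S : List ℕ, (∀ j ∈ S, j ∈ Finset.Icc 1 L) → X.C₂ S = X'.C₂ S

section Agree

variable {B : BilinearGroup} {L : ℕ} {X X' : View B}

theorem mem_range'_iff {n k : ℕ} : k ∈ List.range' 1 n ↔ k ∈ Finset.Icc 1 n := by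
  rw [List.mem_range'_1, Finset.mem_Icc]; omega

theorem View.Agree.encPP (h : X.Agree L X') (key : List Bool) :
    X.encPP L key = X'.encPP L key := by
  have hA : (List.range' 1 L).map (fun k => B.enc (X.A k)) =
      (List.range' 1 L).map (fun k => B.enc (X'.A k)) :=
    List.map_congr_left fun k hk => by rw [h.A k (mem_range'_iff.1 hk)]
  have hU : ((List.range' 1 (2 * L)).filter (· ≠ L + 1)).map (fun k => B.enc (X.U k)) =
      ((List.range' 1 (2 * L)).filter (· ≠ L + 1)).map (fun k => B.enc (X'.U k)) := by
    refine List.map_congr_left fun k hk => ?_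
    rw [List.mem_filter] at hk
    rw [h.U k (mem_range'_iff.1 hk.1) (by simpa using hk.2)]
  rw [View.encPP, View.encPP, h.g, h.Y, h.Ω, hA, hU]

theorem View.Agree.encUPK (h : X.Agree L X') {j : ℕ} (hj : j ∈ Finset.Icc 1 L) :
    X.encUPK L j = X'.encUPK L j := by
  rw [View.encUPK, View.encUPK, h.V j hj]
  congr 3
  refine List.map_congr_left fun k hk => ?_
  rw [List.mem_filter] at hk
  rw [h.W j hj k (mem_range'_iff.1 hk.1) (by simpa using hk.2)]

theorem SSAdversary.mem_users₁ (A : SSAdversary) (κ : ℕ) (r : List Bool) {j : ℕ}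
    (h : j ∈ A.users₁ κ L r) : j ∈ Finset.Icc 1 L := mem_range'_iff.1 (List.mem_filter.1 h).1

theorem View.Agree.answer₂ (h : X.Agree L X') (A : SSAdversary) (κ : ℕ) (r key : List Bool) :
    A.answer₂ κ L r key X = A.answer₂ κ L r key X' := by
  rw [SSAdversary.answer₂, SSAdversary.answer₂, h.encPP]
  congr 6
  exact List.map_congr_left fun j hj => h.encUPK (A.mem_users₁ κ r hj)

theorem SSAdversary.mem_users₂ (A : SSAdversary) (κ : ℕ) (r key : List Bool) {j : ℕ}
    (h : j ∈ A.users₂ κ L r key X) : j ∈ Finset.Icc 1 L :=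
  A.mem_users₁ κ r (List.mem_filter.1 h).1

theorem View.Agree.play (h : X.Agree L X') (A : SSAdversary) (κ : ℕ) (r key ck : List Bool) :
    A.play κ L r key X ck = A.play κ L r key X' ck := by
  have h2 : A.users₂ κ L r key X = A.users₂ κ L r key X' := by
    rw [SSAdversary.users₂, h.answer₂]; rfl
  rw [SSAdversary.play, SSAdversary.play, h.C₁,
    h.C₂ _ fun j hj => A.mem_users₂ κ r key hj, h2, h.answer₂]

end Agree

/-- Names for the random exponents that the simulator uses: the exponent `α`, the discrete
logarithm `x` of the basis of the parameters `U_k`, the blinding `y k` of `U_k` in the subgroup of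
order `p₃`, the secret `γ j` of user `j`, the coefficient `ρ l` and the base `a l` of the `l`-th
mask, and the blinding `w j k` of `V_{j,k}`. -/
inductive CoinIdx (L : ℕ) : Type
  | α
  | x
  | y (k : Fin (2 * L + 2))
  | γ (k : Fin (2 * L + 2))
  | ρ (k : Fin (2 * L + 2))
  | a (k : Fin (2 * L + 2))
  | w (j k : Fin (2 * L + 2))

/-- The cell of the table of random bits from which an exponent is read. -/
def CoinIdx.cell {L : ℕ} : CoinIdx L → ℕ × ℕ
  | α => (1, 0)
  | x => (1, 1)
  | y k => (2, k)
  | γ k => (3, k)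
  | ρ k => (4, k)
  | a k => (5, k)
  | w j k => (6 + j, k)

theorem CoinIdx.cell_injective {L : ℕ} : Function.Injective (CoinIdx.cell (L := L)) := by
  intro i j h
  cases i <;> cases j <;> simp only [CoinIdx.cell, Prod.mk.injEq] at h <;>
    first
    | rfl
    | (exfalso; omega)
    | (congr 1 <;> exact Fin.ext (by omega))

theorem CoinIdx.cell_lt {L : ℕ} (i : CoinIdx L) :
    i.cell.1 ≠ 0 ∧ i.cell.1 < 2 * L + 8 ∧ i.cell.2 < 2 * L + 8 := by
  cases i <;> simp [CoinIdx.cell] <;> omega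

instance (L : ℕ) : Finite (CoinIdx L) :=
  Finite.of_injective
    (fun i : CoinIdx L => ((⟨i.cell.1, i.cell_lt.2.1⟩, ⟨i.cell.2, i.cell_lt.2.2⟩) :
      Fin (2 * L + 8) × Fin (2 * L + 8)))
    fun i j h => CoinIdx.cell_injective (by simpa [Prod.ext_iff] using h)

/-- The random exponents of the simulator. -/
abbrev Coins (B : BilinearGroup) (L : ℕ) : Type := CoinIdx L → ZMod B.N

namespace Coins

variable {B : BilinearGroup} {L : ℕ} (c : Coins B L)

/-- A family indexed by `0, …, 2 L + 1`, continued by zero. -/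
def ext (f : Fin (2 * L + 2) → ZMod B.N) (k : ℕ) : ZMod B.N :=
  if h : k < 2 * L + 2 then f ⟨k, h⟩ else 0

/-! The exponents by name; families are continued by zero to all natural numbers. -/

def α : ZMod B.N := c .α
def x : ZMod B.N := c .x
def y (k : ℕ) : ZMod B.N := ext (fun i => c (.y i)) k
def γ (k : ℕ) : ZMod B.N := ext (fun i => c (.γ i)) k
def ρ (k : ℕ) : ZMod B.N := ext (fun i => c (.ρ i)) k
def a (k : ℕ) : ZMod B.N := ext (fun i => c (.a i)) k
def w (j k : ℕ) : ZMod B.N := ext (fun i => ext (fun i' => c (.w i i')) k) j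

/-- The exponent of the masks of `U_k`, with `m` masks. -/
def mask (m k : ℕ) : ZMod B.N := ∑ l ∈ Finset.range m, c.ρ l * c.a l ^ k

/-- The view in which `g` and `g₃` are the generators, `C₁` is the first component of the header
and the parameters `U_k` are the elements `P k`, blinded. The secret of user `j` is
`γ_j - α ^ j`. -/
def view (g g₃ C₁ : B.G) (P : ℕ → B.G) : View B :=
  let U : ℕ → B.G := fun k => P k * B.pw g₃ (c.y k)
  { g := g
    Y := g₃
    A := fun k => B.pw g (c.α ^ k)
    U := U
    Ω := B.e g (U (L + 1))
    V := fun j => B.pw g (c.γ j) * (B.pw g (c.α ^ j))⁻¹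
    W := fun j k => B.pw (U k) (c.γ j) * (U (k + j))⁻¹ * B.pw g₃ (c.w j k)
    C₁ := C₁
    C₂ := fun S => B.pw C₁ (S.map c.γ).sum }

theorem view_agree {c c' : Coins B L} {g g₃ C₁ : B.G} {P P' : ℕ → B.G}
    (hα : ∀ k ∈ Finset.Icc 1 L, B.pw g (c.α ^ k) = B.pw g (c'.α ^ k))
    (hγ : c.γ = c'.γ) (hw : c.w = c'.w)
    (hU : ∀ k ∈ Finset.Icc 1 (2 * L), k ≠ L + 1 →
      P k * B.pw g₃ (c.y k) = P' k * B.pw g₃ (c'.y k))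
    (hΩ : B.e g (P (L + 1) * B.pw g₃ (c.y (L + 1))) =
      B.e g (P' (L + 1) * B.pw g₃ (c'.y (L + 1)))) :
    (c.view g g₃ C₁ P).Agree L (c'.view g g₃ C₁ P') where
  g := rfl
  Y := rfl
  A := hα
  U := hU
  Ω := hΩ
  V j hj := by simp only [view, hγ, hα j hj]
  W j hj k hk hjk := by
    rw [Finset.mem_Icc] at hj hk
    simp only [view, hγ, hw]
    rw [hU k (Finset.mem_Icc.2 ⟨by omega, by omega⟩) (by omega),
      hU (k + j) (Finset.mem_Icc.2 ⟨by omega, by omega⟩) (by omega)]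
  C₁ := rfl
  C₂ S _ := by simp only [view, hγ]

end Coins

/-- The indicator function of truth. -/
def ind (b : Bool) : ℝ := if b = true then 1 else 0

theorem ind_nonneg (b : Bool) : 0 ≤ ind b := by cases b <;> simp [ind]

theorem ind_le_one (b : Bool) : ind b ≤ 1 := by cases b <;> simp [ind]

section Games

variable {𝒢 : GroupGenerator} (ℋ : HashFamily 𝒢) (A : SSAdversary) (κ L : ℕ) (I : 𝒢.Inst)

/-- The random choices of the security experiment that do not concern the groups: the random bits
of the adversary, the hash key, a random session key, and the challenge bit. -/
abbrev Seeds : Type :=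
  (Fin (A.coins.eval (κ + L)) → Bool) × (Fin (ℋ.keyLen κ I) → Bool) × (Fin κ → Bool) × Bool

variable {L I} in
/-- Whether the adversary guesses right, when it has the view `X` and the session key is the hash
value of `t`. -/
def won (ω : Seeds ℋ A κ L I) (X : View (𝒢.grp I)) (t : (𝒢.grp I).GT) : Bool :=
  A.play κ L (List.ofFn ω.1) (List.ofFn ω.2.1) X
    (if ω.2.2.2 then List.ofFn ω.2.2.1 else List.ofFn (ℋ.hash κ I ω.2.1 t)) == ω.2.2.2

variable {I} in
/-- The probability that the adversary guesses right, when the parameters `U_k` are the elements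
`P c k`, blinded, and the first component of the header is `C₁`. -/
noncomputable def gameValue (g g₃ C₁ : (𝒢.grp I).G) (P : Coins (𝒢.grp I) L → ℕ → (𝒢.grp I).G) : ℝ :=
  mean fun ω : Seeds ℋ A κ L I => mean fun c : Coins (𝒢.grp I) L =>
    ind (won ℋ A κ ω (c.view g g₃ C₁ (P c))
      ((𝒢.grp I).e C₁ (P c (L + 1) * (𝒢.grp I).pw g₃ (c.y (L + 1)))))

variable {ℋ A κ L I}

theorem won_congr {X X' : View (𝒢.grp I)} (h : X.Agree L X') (ω : Seeds ℋ A κ L I)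
    (t : (𝒢.grp I).GT) : won ℋ A κ ω X t = won ℋ A κ ω X' t := by
  rw [won, won, h.play]

variable {g g₃ C₁ : (𝒢.grp I).G}

theorem gameValue_nonneg (P : Coins (𝒢.grp I) L → ℕ → (𝒢.grp I).G) :
    0 ≤ gameValue ℋ A κ L g g₃ C₁ P :=
  mean_nonneg fun _ => mean_nonneg fun _ => ind_nonneg _

theorem gameValue_le_one (P : Coins (𝒢.grp I) L → ℕ → (𝒢.grp I).G) :
    gameValue ℋ A κ L g g₃ C₁ P ≤ 1 :=
  mean_le_one fun _ => mean_le_one fun _ => ind_le_one _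

/-- A game is not changed by an injective transformation `T` of the random exponents that
preserves what the adversary sees. -/
theorem gameValue_eq_of_injective {P P' : Coins (𝒢.grp I) L → ℕ → (𝒢.grp I).G}
    (T : Coins (𝒢.grp I) L → Coins (𝒢.grp I) L) (hT : Function.Injective T)
    (hα : ∀ c, ∀ k ∈ Finset.Icc 1 L,
      (𝒢.grp I).pw g ((T c).α ^ k) = (𝒢.grp I).pw g (c.α ^ k))
    (hγ : ∀ c, (T c).γ = c.γ) (hw : ∀ c, (T c).w = c.w)
    (hU : ∀ c, ∀ k ∈ Finset.Icc 1 (2 * L + 1),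
      P (T c) k * (𝒢.grp I).pw g₃ ((T c).y k) = P' c k * (𝒢.grp I).pw g₃ (c.y k)) :
    gameValue ℋ A κ L g g₃ C₁ P = gameValue ℋ A κ L g g₃ C₁ P' := by
  refine mean_congr fun ω => ?_
  rw [← mean_injective hT]
  refine mean_congr fun c => ?_
  have h1 := hU c (L + 1) (Finset.mem_Icc.2 ⟨by omega, by omega⟩)
  rw [h1, won_congr (Coins.view_agree (hα c) (hγ c) (hw c) (fun k hk _ => hU c k ?_) (by rw [h1]))]
  rw [Finset.mem_Icc] at hk ⊢
  omega

/-- The random exponents with the blindings of the parameters `U_k` shifted by `δ`. -/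
def Coins.shiftY {B : BilinearGroup} (δ : ℕ → ZMod B.N) (c : Coins B L) : Coins B L
  | .y k => c (.y k) + δ k
  | i => c i

/-- Contributions to `U_k` in the subgroup of order `p₃` do not matter. -/
theorem gameValue_absorb (P : Coins (𝒢.grp I) L → ℕ → (𝒢.grp I).G)
    (δ : Coins (𝒢.grp I) L → ℕ → ZMod (𝒢.grp I).N)
    (hP : ∀ c d, P (Coins.shiftY d c) = P c) (hδ : ∀ c d, δ (Coins.shiftY d c) = δ c) :
    gameValue ℋ A κ L g g₃ C₁ (fun c k => P c k * (𝒢.grp I).pw g₃ (δ c k)) =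
      gameValue ℋ A κ L g g₃ C₁ P := by
  symm
  refine gameValue_eq_of_injective (fun c => Coins.shiftY (δ c) c) ?_ (fun _ _ _ => rfl)
    (fun _ => rfl) (fun _ => rfl) ?_
  · intro c c' h
    have h1 : δ c = δ c' := by
      have := congrArg δ h
      rwa [hδ, hδ] at this
    funext i
    have h2 : Coins.shiftY (δ c) c i = Coins.shiftY (δ c') c' i := congrFun h i
    rw [h1] at h2
    cases i <;> simpa [Coins.shiftY] using h2
  · intro c k hk
    rw [Finset.mem_Icc] at hk
    have : (Coins.shiftY (δ c) c).y k = c.y k + δ c k := by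
      simp only [Coins.y, Coins.ext]
      rw [dif_pos (by omega), dif_pos (by omega)]
      rfl
    rw [hP, this, pw_add]
    simp only [mul_comm, mul_left_comm]

variable (𝒢 ℋ A κ) in
/-- The elements from which the simulator obtains `U_k`. -/
def simP (I : 𝒢.Inst) (D Z : (𝒢.grp I).G) (m : ℕ) (c : Coins (𝒢.grp I) L) (k : ℕ) :
    (𝒢.grp I).G :=
  (𝒢.grp I).pw Z (c.α ^ k) * (𝒢.grp I).pw D (c.mask m k)

theorem gameValue_simP (hg₃ : Subgroup.zpowers g₃ = (𝒢.grp I).sub (𝒢.grp I).p₃)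
    (D Z : (𝒢.grp I).G) (m : ℕ)
    (Y Y' : (𝒢.grp I).sub (𝒢.grp I).p₃) :
    gameValue ℋ A κ L g g₃ C₁ (simP 𝒢 I (D * Y) (Z * Y') m) =
      gameValue ℋ A κ L g g₃ C₁ (simP 𝒢 I D Z m) := by
  have hmem : ∀ Y : (𝒢.grp I).sub (𝒢.grp I).p₃, ∃ s, Y.1 = (𝒢.grp I).pw g₃ s := by
    intro Y
    have hy : Y.1 ∈ Subgroup.zpowers g₃ := by rw [hg₃]; exact Y.2
    rw [← mem_powers_iff_mem_zpowers] at hy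
    obtain ⟨n, hn⟩ := hy
    exact ⟨n, hn.symm.trans (pw_natCast g₃ n).symm⟩
  obtain ⟨s, hs⟩ := hmem Y
  obtain ⟨s', hs'⟩ := hmem Y'
  rw [← gameValue_absorb (simP 𝒢 I D Z m) (fun c k => s' * c.α ^ k + s * c.mask m k)
    (fun _ _ => rfl) (fun _ _ => rfl)]
  congr 1
  funext c k
  rw [simP, simP, hs, hs', mul_pw, mul_pw, pw_add, pw_mul, pw_mul]
  simp only [mul_assoc, mul_comm, mul_left_comm]

end Games

/-! ### The change of base of one mask -/

open Data BilinearGroup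

/-- A coordinate may be used as fresh randomness by a function that does not depend on it. -/
theorem mean_resample {ι X : Type} [Finite ι] [DecidableEq ι] [Finite X] (i : ι)
    (F : X → (ι → X) → ℝ) (hF : ∀ s c s', F s (Function.update c i s') = F s c) :
    (mean fun s => mean fun c => F s c) = mean fun c => F (c i) c := by
  have hinv : Function.Injective fun q : X × (ι → X) => (q.2 i, Function.update q.2 i q.1) := by
    intro q q' h
    simp only [Prod.mk.injEq] at h
    have h1 : q.1 = q'.1 := by simpa using congrFun h.2 i
    refine Prod.ext h1 (funext fun j => ?_)
    by_cases hj : j = i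
    · rw [hj]; exact h.1
    · simpa [hj] using congrFun h.2 j
  rcases isEmpty_or_nonempty X with hX | hX
  · have := Fintype.ofFinite X
    have := Fintype.ofFinite ι
    have : IsEmpty (ι → X) := ⟨fun c => hX.elim (c i)⟩
    simp [mean_eq_sum]
  · rw [← mean_prod fun q : X × (ι → X) => F q.1 q.2, ← mean_injective hinv, mean_prod]
    simp [hF]

section Swap

variable {𝒢 : GroupGenerator} {ℋ : HashFamily 𝒢} {A : SSAdversary} {κ L : ℕ} {I : 𝒢.Inst}
variable {g g₃ C₁ : (𝒢.grp I).G}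

theorem gameValue_resample [DecidableEq (CoinIdx L)] (i : CoinIdx L)
    (hi : i = .x ∨ ∃ l, i = .ρ l)
    (P : ZMod (𝒢.grp I).N → Coins (𝒢.grp I) L → ℕ → (𝒢.grp I).G)
    (hP : ∀ s c s', P s (Function.update c i s') = P s c) :
    (mean fun s => gameValue ℋ A κ L g g₃ C₁ (P s)) =
      gameValue ℋ A κ L g g₃ C₁ fun c => P (c i) c := by
  unfold gameValue
  rw [mean_comm]
  refine mean_congr fun ω => ?_
  refine mean_resample i (fun s (c : Coins (𝒢.grp I) L) => ind (won ℋ A κ ω (c.view g g₃ C₁ (P s c))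
      ((𝒢.grp I).e C₁ (P s c (L + 1) * (𝒢.grp I).pw g₃ (c.y (L + 1)))))) ?_
  intro s (c : Coins (𝒢.grp I) L) s'
  have h : ∀ j : CoinIdx L, j ≠ i → Function.update c i s' j = c j :=
    fun j hj => Function.update_of_ne hj _ _
  have hy : Coins.y (Function.update c i s') = c.y := by
    funext k
    unfold Coins.y
    congr 1
    funext k
    exact h _ (by rcases hi with rfl | ⟨l, rfl⟩ <;> simp)
  have hγ : Coins.γ (Function.update c i s') = c.γ := by
    funext k
    unfold Coins.γ
    congr 1
    funext k
    exact h _ (by rcases hi with rfl | ⟨l, rfl⟩ <;> simp)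
  have hw : Coins.w (Function.update c i s') = c.w := by
    funext j k
    unfold Coins.w
    congr 1
    funext j
    congr 1
    funext k
    exact h _ (by rcases hi with rfl | ⟨l, rfl⟩ <;> simp)
  have hα : Coins.α (Function.update c i s') = c.α :=
    h _ (by rcases hi with rfl | ⟨l, rfl⟩ <;> simp)
  simp only [Coins.view, hP, hy, hγ, hw, hα]

/-- The random exponents with the parts of the exponents `α` and `a m` modulo `p₂` exchanged;
`ε` is the idempotent that projects to this part. -/
def Coins.swap {B : BilinearGroup} (ε : ZMod B.N) (m : Fin (2 * L + 2)) (c : Coins B L) :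
    Coins B L
  | .α => c .α + ε * (c (.a m) - c .α)
  | .a l => if l = m then c (.a m) + ε * (c .α - c (.a m)) else c (.a l)
  | i => c i

theorem Coins.swap_swap {B : BilinearGroup} {ε : ZMod B.N} (hε : ε * ε = ε)
    (m : Fin (2 * L + 2)) (c : Coins B L) : (c.swap ε m).swap ε m = c := by
  funext i
  cases i with
  | α =>
    simp only [swap, if_pos]
    linear_combination (-2 * c (.a m) + 2 * c .α) * hε
  | a l =>
    by_cases h : l = m
    · subst h
      simp only [swap, if_pos]
      linear_combination (2 * c (.a l) - 2 * c .α) * hε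
    · simp only [swap, if_neg h]
  | _ => rfl

theorem Coins.mask_congr {B : BilinearGroup} {c c' : Coins B L} {m : ℕ} (hm : m ≤ 2 * L)
    (hρ : ∀ l : Fin (2 * L + 2), l.1 < m → c (.ρ l) = c' (.ρ l))
    (ha : ∀ l : Fin (2 * L + 2), l.1 < m → c (.a l) = c' (.a l)) (k : ℕ) :
    c.mask m k = c'.mask m k := by
  refine Finset.sum_congr rfl fun l hl => ?_
  rw [Finset.mem_range] at hl
  simp only [ρ, a, ext, dif_pos (show l < 2 * L + 2 by omega)]
  rw [hρ _ hl, ha _ hl]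

theorem Coins.mask_succ {B : BilinearGroup} (c : Coins B L) {m : ℕ} (hm : m < 2 * L + 2) (k : ℕ) :
    c.mask (m + 1) k = c.mask m k + c (.ρ ⟨m, hm⟩) * c (.a ⟨m, hm⟩) ^ k := by
  rw [mask, Finset.sum_range_succ]
  simp only [ρ, a, ext, dif_pos hm]
  rfl

/-- A random element of order `p₂` in the basis of the parameters `U_k` is as good as one more
mask: its exponents `α ^ k` matter only modulo `p₂`, where `α` is independent of all else that the
adversary sees. -/
theorem mean_gameValue_simP (hg : g ∈ (𝒢.grp I).sub (𝒢.grp I).p₁)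
    (X₂ : (𝒢.grp I).sub (𝒢.grp I).p₁) (R₂ : (𝒢.grp I).sub (𝒢.grp I).p₂) (hR₂ : R₂.1 ≠ 1) {m : ℕ}
    (hm : m < 2 * L) :
    (mean fun R₃ : (𝒢.grp I).sub (𝒢.grp I).p₂ =>
      gameValue ℋ A κ L g g₃ C₁ (simP 𝒢 I R₂ (X₂.1 * R₃.1) m)) =
      gameValue ℋ A κ L g g₃ C₁ (simP 𝒢 I R₂ X₂ (m + 1)) := by
  classical
  have hm' : m < 2 * L + 2 := by omega
  -- `R₃` is a random power of `R₂`, and the coefficient `ρ m`, not used by the first `m` masks,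
  -- may serve as its exponent
  rw [← equidist_pw (zpowers_eq_sub (𝒢.grp I).prime₂ dvd₂ R₂.2 hR₂) R₂.2]
  rw [gameValue_resample (.ρ ⟨m, hm'⟩) (Or.inr ⟨_, rfl⟩)
    (fun s => simP 𝒢 I R₂.1 (X₂.1 * (𝒢.grp I).pw R₂.1 s) m)]
  · obtain ⟨ε, hε₁, hε₂, hε⟩ := (𝒢.grp I).exists_idempotent
    have hα : ∀ c : Coins (𝒢.grp I) L, ∀ k : ℕ, ∀ x ∈ (𝒢.grp I).sub (𝒢.grp I).p₁,
        (𝒢.grp I).pw x ((c.swap ε ⟨m, hm'⟩).α ^ k) = (𝒢.grp I).pw x (c.α ^ k) := by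
      intro c k x hx
      refine pw_eq_of_cast_eq dvd₁ hx ?_
      simp only [Coins.α, Coins.swap, map_pow, map_add, map_mul, hε₁, zero_mul, add_zero]
    refine gameValue_eq_of_injective (fun c => c.swap ε ⟨m, hm'⟩)
      (Function.LeftInverse.injective (g := fun c : Coins (𝒢.grp I) L => c.swap ε ⟨m, hm'⟩)
        (Coins.swap_swap hε _))
      (fun c k _ => hα c k g hg) (fun _ => rfl) (fun _ => rfl) ?_
    intro c k _
    have h1 : (c.swap ε ⟨m, hm'⟩).mask m k = c.mask m k :=
      Coins.mask_congr (c := c.swap ε ⟨m, hm'⟩) (c' := c) hm.le (fun _ _ => rfl)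
        (fun l hl => if_neg fun h : l = ⟨m, hm'⟩ => by rw [h] at hl; exact lt_irrefl _ hl) k
    have h2 : (𝒢.grp I).pw R₂.1 (c (.ρ ⟨m, hm'⟩) * (c.swap ε ⟨m, hm'⟩).α ^ k) =
        (𝒢.grp I).pw R₂.1 (c (.ρ ⟨m, hm'⟩) * c (.a ⟨m, hm'⟩) ^ k) := by
      refine pw_eq_of_cast_eq dvd₂ R₂.2 ?_
      simp only [Coins.α, Coins.swap, map_pow, map_add, map_mul, map_sub, hε₂]
      ring
    have h3 : (c.swap ε ⟨m, hm'⟩) (.ρ ⟨m, hm'⟩) = c (.ρ ⟨m, hm'⟩) := rfl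
    have h4 : (c.swap ε ⟨m, hm'⟩).y = c.y := rfl
    simp only [simP, h1, h3, h4, mul_pw]
    rw [hα c k _ X₂.2, ← pw_mul, h2, Coins.mask_succ c hm', pw_add]
    simp only [mul_assoc, mul_comm, mul_left_comm]
  · intro s (c : Coins (𝒢.grp I) L) s'
    funext k
    have h1 : Coins.mask (Function.update c (.ρ ⟨m, hm'⟩) s') m k = c.mask m k :=
      Coins.mask_congr hm.le
        (fun l hl => Function.update_of_ne (fun h => by
          injection h with h; rw [h] at hl; exact lt_irrefl _ hl) _ _)
        (fun l _ => Function.update_of_ne (fun h => by injection h) _ _) k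
    have h2 : Coins.α (Function.update c (.ρ ⟨m, hm'⟩) s') = c.α :=
      Function.update_of_ne (by simp) _ _
    rw [simP, simP, h1, h2]

end Swap

/-! ### The last game -/

theorem mean_finset_sum {α ι : Type} [Finite α] (s : Finset ι) (f : ι → α → ℝ) :
    (mean fun a => ∑ i ∈ s, f i a) = ∑ i ∈ s, mean (f i) := by
  have := Fintype.ofFinite α
  simp only [mean_eq_sum, ← Finset.sum_div]
  rw [Finset.sum_comm]

theorem mean_ite_eq_zero {G H : Type} [AddGroup G] [AddGroup H] [Finite G] [Finite H]
    [DecidableEq H] {φ : G → H} (h : ∀ x y, φ (x + y) = φ x + φ y)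
    (hs : Function.Surjective φ) :
    (mean fun x => if φ x = 0 then (1 : ℝ) else 0) = (Nat.card H : ℝ)⁻¹ := by
  rw [Equidist.of_surjective_add h hs fun y => if y = 0 then (1 : ℝ) else 0, ← mean_ite_eq (0 : H)]
  exact mean_congr fun y => by simp only [eq_comm]

/-- Weights exist with which the masks with bases `a` combine to one in `U_{L+1}` alone,
modulo `p₂`. -/
def Coins.Good {B : BilinearGroup} (L : ℕ) (a : ℕ → ZMod B.N) : Prop :=
  ∃ w : ℕ → ZMod B.N, ∀ k ∈ Finset.Icc 1 (2 * L),
    ZMod.castHom dvd₂ (ZMod B.p₂) (∑ l ∈ Finset.range (2 * L), w l * a l ^ k) =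
      if k = L + 1 then 1 else 0

/-- The bases are good when they are distinct and non-zero modulo `p₂`, because a Vandermonde
matrix is then invertible. -/
theorem Coins.good_of_injective {B : BilinearGroup} {L : ℕ} {a : ℕ → ZMod B.N}
    (h0 : ∀ l : Fin (2 * L), ZMod.castHom dvd₂ (ZMod B.p₂) (a l) ≠ 0)
    (h1 : ∀ l l' : Fin (2 * L), l ≠ l' →
      ZMod.castHom dvd₂ (ZMod B.p₂) (a l) ≠ ZMod.castHom dvd₂ (ZMod B.p₂) (a l')) :
    Coins.Good L a := by
  have := Fact.mk B.prime₂
  obtain ⟨b, hb⟩ : ∃ b : Fin (2 * L) → ZMod B.p₂,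
      b = fun l => ZMod.castHom dvd₂ (ZMod B.p₂) (a l.1) := ⟨_, rfl⟩
  have hinj : Function.Injective b := by
    intro l l' h
    by_contra hne
    rw [hb] at h
    exact h1 l l' hne h
  let M : Matrix (Fin (2 * L)) (Fin (2 * L)) (ZMod B.p₂) :=
    (Matrix.diagonal b * Matrix.vandermonde b).transpose
  have hdet : IsUnit M.det := by
    rw [Matrix.det_transpose, Matrix.det_mul, Matrix.det_diagonal, isUnit_iff_ne_zero]
    refine mul_ne_zero (Finset.prod_ne_zero_iff.2 fun l _ => ?_)
      (Matrix.det_vandermonde_ne_zero_iff.2 hinj)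
    rw [hb]
    exact h0 l
  let δ : Fin (2 * L) → ZMod B.p₂ := fun k => if k.1 + 1 = L + 1 then 1 else 0
  let v := M⁻¹.mulVec δ
  have hv : M.mulVec v = δ := by
    rw [Matrix.mulVec_mulVec, Matrix.mul_nonsing_inv _ hdet, Matrix.one_mulVec]
  choose w hw using fun l => ZMod.castHom_surjective (dvd₂ (B := B)) (v l)
  refine ⟨fun l => if h : l < 2 * L then w ⟨l, h⟩ else 0, fun k hk => ?_⟩
  rw [Finset.mem_Icc] at hk
  have h := congrFun hv ⟨k - 1, by omega⟩
  simp only [δ, Nat.sub_add_cancel hk.1] at h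
  rw [← h, Finset.sum_range, map_sum, Matrix.mulVec, dotProduct]
  refine Finset.sum_congr rfl fun l _ => ?_
  simp only [M]
  rw [dif_pos l.2, map_mul, map_pow, hw, Matrix.transpose_apply, Matrix.diagonal_mul,
    Matrix.vandermonde_apply, ← pow_succ', hb, Nat.sub_add_cancel hk.1, mul_comm]

theorem Coins.mean_not_good {B : BilinearGroup} {L : ℕ} [DecidablePred (Coins.Good (B := B) L)] :
    (mean fun c : Coins B L => if Coins.Good L c.a then (0 : ℝ) else 1) ≤
      (2 * L + 4 * L ^ 2) / B.p₂ := by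
  classical
  have := Fact.mk B.prime₂
  have hcard : (Nat.card (ZMod B.p₂) : ℝ)⁻¹ = 1 / B.p₂ := by rw [Nat.card_zmod, one_div]
  obtain ⟨b, hb⟩ : ∃ b : Fin (2 * L) → Coins B L → ZMod B.p₂,
      b = fun l c => ZMod.castHom dvd₂ (ZMod B.p₂) (c.a l) := ⟨_, rfl⟩
  have hb' : ∀ l : Fin (2 * L), ∀ c : Coins B L,
      b l c = ZMod.castHom dvd₂ (ZMod B.p₂) (c (.a ⟨l.1, by omega⟩)) := by
    intro l c
    rw [hb]
    simp only [a, ext, dif_pos (show l.1 < 2 * L + 2 by omega)]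
  have h0 : ∀ l, (mean fun c => if b l c = 0 then (1 : ℝ) else 0) = 1 / B.p₂ := by
    intro l
    rw [← hcard]
    refine mean_ite_eq_zero (fun x y => ?_) fun z => ?_
    · rw [hb', hb', hb', ← map_add]; rfl
    · obtain ⟨s, hs⟩ := ZMod.castHom_surjective (dvd₂ (B := B)) z
      exact ⟨fun _ => s, by rw [hb', hs]⟩
  have h1 : ∀ l l', l ≠ l' →
      (mean fun c => if b l c - b l' c = 0 then (1 : ℝ) else 0) = 1 / B.p₂ := by
    intro l l' hne
    rw [← hcard]
    refine mean_ite_eq_zero (φ := fun c => b l c - b l' c) (fun x y => ?_) fun z => ?_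
    · have : ∀ l, b l (x + y) = b l x + b l y := fun l => by
        rw [hb', hb', hb', ← map_add]; rfl
      rw [this, this]; ring
    · obtain ⟨s, hs⟩ := ZMod.castHom_surjective (dvd₂ (B := B)) z
      refine ⟨Function.update 0 (.a ⟨l.1, by omega⟩) s, ?_⟩
      simp only [hb', Function.update_self]
      rw [Function.update_of_ne (by simpa [Fin.ext_iff] using hne ∘ Fin.ext ∘ Eq.symm), hs]
      simp
  calc (mean fun c : Coins B L => if Coins.Good L c.a then (0 : ℝ) else 1)
      ≤ mean fun c : Coins B L => (∑ l, if b l c = 0 then (1 : ℝ) else 0) +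
          ∑ q ∈ (Finset.univ : Finset (Fin (2 * L))).offDiag,
            if b q.1 c - b q.2 c = 0 then (1 : ℝ) else 0 := by
        refine mean_mono fun c => ?_
        have hn0 : ∀ l ∈ Finset.univ, (0 : ℝ) ≤ if b l c = 0 then (1 : ℝ) else 0 :=
          fun _ _ => by split <;> norm_num
        have hn1 : ∀ q ∈ (Finset.univ : Finset (Fin (2 * L))).offDiag,
            (0 : ℝ) ≤ if b q.1 c - b q.2 c = 0 then (1 : ℝ) else 0 :=
          fun _ _ => by split <;> norm_num
        split
        · exact add_nonneg (Finset.sum_nonneg hn0) (Finset.sum_nonneg hn1)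
        · rename_i hbad
          by_cases hz : ∃ l, b l c = 0
          · obtain ⟨l, hl⟩ := hz
            have := Finset.single_le_sum hn0 (Finset.mem_univ l)
            rw [if_pos hl] at this
            linarith [Finset.sum_nonneg hn1]
          · by_cases hq : ∃ l l', l ≠ l' ∧ b l c = b l' c
            · obtain ⟨l, l', hne, hl⟩ := hq
              have := Finset.single_le_sum hn1 (a := (l, l')) (by simpa using hne)
              rw [if_pos (by simpa [sub_eq_zero] using hl)] at this
              linarith [Finset.sum_nonneg hn0]
            · push Not at hz hq
              refine absurd (Coins.good_of_injective (fun l => ?_) fun l l' hne => ?_) hbad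
              · have := hz l; rwa [hb] at this
              · have := hq l l' hne; rwa [hb] at this
    _ = (2 * L) * (1 / B.p₂) + ((2 * L) * (2 * L) - 2 * L : ℕ) * (1 / B.p₂) := by
        rw [mean_add, mean_finset_sum, mean_finset_sum, Finset.sum_congr rfl fun l _ => h0 l,
          Finset.sum_congr rfl fun q hq => h1 q.1 q.2 (Finset.mem_offDiag.1 hq).2.2]
        simp [Finset.offDiag_card]
    _ ≤ (2 * L) * (1 / B.p₂) + ((2 * L) * (2 * L) : ℕ) * (1 / B.p₂) := by
        gcongr; omega
    _ = (2 * L + 4 * L ^ 2) / B.p₂ := by push_cast; ring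

section Last

open BilinearGroup

variable {𝒢 : GroupGenerator} {ℋ : HashFamily 𝒢} {A : SSAdversary} {κ L : ℕ} {I : 𝒢.Inst}

theorem mean_bool (f : Bool → ℝ) : mean f = (f true + f false) / 2 := by
  rw [mean_eq_sum, Fintype.sum_bool, Fintype.card_bool]
  norm_num

theorem mean_won (X : View (𝒢.grp I)) (t : (𝒢.grp I).GT) :
    (mean fun ω : Seeds ℋ A κ L I => ind (won ℋ A κ ω X t)) = 1 / 2 +
      1 / 2 * mean fun r : Fin (A.coins.eval (κ + L)) → Bool =>
        (mean fun key : Fin (ℋ.keyLen κ I) → Bool => mean fun ck : Fin κ → Bool =>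
          ind (A.play κ L (List.ofFn r) (List.ofFn key) X (List.ofFn ck))) -
        mean fun key : Fin (ℋ.keyLen κ I) → Bool =>
          ind (A.play κ L (List.ofFn r) (List.ofFn key) X (List.ofFn (ℋ.hash κ I key t))) := by
  have h : ∀ b : Bool, ind (b == true) = ind b ∧ ind (b == false) = 1 - ind b := by
    intro b; cases b <;> simp [ind]
  obtain ⟨q, hq⟩ : ∃ q : ℝ, q = 1 / 2 := ⟨_, rfl⟩
  rw [mean_prod, ← mean_mul_left, ← hq,
    ← mean_const (α := Fin (A.coins.eval (κ + L)) → Bool) q, ← mean_add]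
  refine mean_congr fun r => ?_
  rw [mean_prod, ← mean_sub, ← mean_mul_left,
    ← mean_const (α := Fin (ℋ.keyLen κ I) → Bool) q, ← mean_add]
  refine mean_congr fun key => ?_
  rw [mean_prod, ← mean_const (α := Fin κ → Bool) q, ← mean_const (α := Fin κ → Bool)
    (ind (A.play κ L (List.ofFn r) (List.ofFn key) X (List.ofFn (ℋ.hash κ I key t)))),
    ← mean_sub, ← mean_mul_left, ← mean_add]
  refine mean_congr fun ck => ?_
  simp only [mean_bool, won, if_true, Bool.false_eq_true, if_false, (h _).1, (h _).2, mean_const]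
  rw [hq]
  ring

/-- If the hashed element is random among `card T` elements that look alike to the adversary,
then its hash value is nearly as good as a random key. -/
theorem abs_mean_won_sub_half (X : View (𝒢.grp I)) {T : Type} [Finite T] [Nonempty T]
    (v : T → (𝒢.grp I).GT) (hv : Function.Injective v) :
    |(mean fun x => mean fun ω : Seeds ℋ A κ L I => ind (won ℋ A κ ω X (v x))) - 1 / 2| ≤
      1 / 4 * √(2 ^ κ / Nat.card T) := by
  simp only [mean_won]
  rw [mean_add, mean_const, add_sub_cancel_left, mean_mul_left, mean_comm, abs_mul]
  have h : |mean fun r : Fin (A.coins.eval (κ + L)) → Bool => mean fun x : T =>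
        (mean fun key : Fin (ℋ.keyLen κ I) → Bool => mean fun ck : Fin κ → Bool =>
          ind (A.play κ L (List.ofFn r) (List.ofFn key) X (List.ofFn ck))) -
        mean fun key : Fin (ℋ.keyLen κ I) → Bool =>
          ind (A.play κ L (List.ofFn r) (List.ofFn key) X
            (List.ofFn (ℋ.hash κ I key (v x))))| ≤ 1 / 2 * √(2 ^ κ / Nat.card T) := by
    refine (abs_mean_le _).trans ?_
    rw [← mean_const (α := Fin (A.coins.eval (κ + L)) → Bool) (1 / 2 * √(2 ^ κ / Nat.card T))]
    refine mean_mono fun r => ?_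
    have := leftover_hash (ℋ.hash κ I) v hv (fun x y => ℋ.pairwise_indep κ I x y)
      (fun key ck => ind (A.play κ L (List.ofFn r) (List.ofFn key) X (List.ofFn ck)))
      fun _ _ => ⟨ind_nonneg _, ind_le_one _⟩
    rw [mean_sub, mean_const, abs_sub_comm, mean_comm fun (x : T) key => _]
    simpa [Nat.card_eq_fintype_card] using this
  rw [abs_of_pos (by norm_num : (0 : ℝ) < 1 / 2)]
  linarith

/-- The random exponents with the coefficients of the masks shifted by multiples of `w`. -/
def Coins.shiftρ {B : BilinearGroup} (w : ℕ → ZMod B.N) (x : ZMod B.N) (c : Coins B L) :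
    Coins B L
  | .ρ l => c (.ρ l) + x * w l
  | i => c i

theorem Coins.mask_shiftρ {B : BilinearGroup} (w : ℕ → ZMod B.N) (x : ZMod B.N) (c : Coins B L)
    (k : ℕ) : (c.shiftρ w x).mask (2 * L) k =
      c.mask (2 * L) k + x * ∑ l ∈ Finset.range (2 * L), w l * c.a l ^ k := by
  rw [mask, mask, Finset.mul_sum, ← Finset.sum_add_distrib]
  refine Finset.sum_congr rfl fun l hl => ?_
  rw [Finset.mem_range] at hl
  have h1 : (c.shiftρ w x).ρ l = c.ρ l + x * w l := by
    simp only [ρ, ext, dif_pos (show l < 2 * L + 2 by omega)]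
    rfl
  have h2 : (c.shiftρ w x).a l = c.a l := rfl
  rw [h1, h2]
  ring

/-- With `2 L` masks, `U_{L+1}` is independent modulo `p₂` of all the other parameters, so that
the session key is hashed from an element with `p₂` equally likely values. -/
theorem abs_gameValue_sub_half {g g₃ : (𝒢.grp I).G} (hL : 1 ≤ L)
    (hg : g ∈ (𝒢.grp I).sub (𝒢.grp I).p₁) (X₁ : (𝒢.grp I).sub (𝒢.grp I).p₁)
    (R₁ R₂ : (𝒢.grp I).sub (𝒢.grp I).p₂) (hR₁ : R₁.1 ≠ 1) (hR₂ : R₂.1 ≠ 1) (Z : (𝒢.grp I).G) :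
    |gameValue ℋ A κ L g g₃ (X₁.1 * R₁.1) (simP 𝒢 I R₂ Z (2 * L)) - 1 / 2| ≤
      1 / 4 * √(2 ^ κ / (𝒢.grp I).p₂) + 1 / 2 * ((2 * L + 4 * L ^ 2) / (𝒢.grp I).p₂) := by
  classical
  obtain ⟨C₁, hC₁⟩ : ∃ C₁, C₁ = X₁.1 * R₁.1 := ⟨_, rfl⟩
  rw [← hC₁]
  have hg2 : ∀ R : (𝒢.grp I).sub (𝒢.grp I).p₂, (𝒢.grp I).e g R = 1 := fun R =>
    e_eq_one ((Nat.coprime_primes (𝒢.grp I).prime₁ (𝒢.grp I).prime₂).2 (𝒢.grp I).ne₁₂) hg R.2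
  have hC2 : ∀ R : (𝒢.grp I).sub (𝒢.grp I).p₂, (𝒢.grp I).e C₁ R = 1 → R = 1 := by
    intro R h
    by_contra hne
    refine e_ne_one R₁.2 R.2 hR₁ (fun h1 => hne (Subtype.ext h1)) ?_
    rwa [hC₁, map_mul, MonoidHom.mul_apply, e_eq_one ((Nat.coprime_primes (𝒢.grp I).prime₁
      (𝒢.grp I).prime₂).2 (𝒢.grp I).ne₁₂) X₁.2 R.2, one_mul] at h
  -- weights that exist for good bases
  have hex : ∀ a, ∃ w : ℕ → ZMod (𝒢.grp I).N, Coins.Good L a → ∀ k ∈ Finset.Icc 1 (2 * L),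
      ZMod.castHom dvd₂ (ZMod (𝒢.grp I).p₂) (∑ l ∈ Finset.range (2 * L), w l * a l ^ k) =
        if k = L + 1 then 1 else 0 := by
    intro a
    by_cases h : Coins.Good L a
    · exact h.imp fun w hw _ => hw
    · exact ⟨0, fun h' => absurd h' h⟩
  choose W hW using hex
  -- with these weights, shifting the coefficients by `x` changes `U_{L+1}` by `R₂ ^ x` and no other
  -- parameter
  let T : ZMod (𝒢.grp I).N → Coins (𝒢.grp I) L → Coins (𝒢.grp I) L :=
    fun x c => c.shiftρ (W c.a) x
  have hT : ∀ x, Function.Injective (T x) := by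
    intro x c c' h
    have ha : c.a = c'.a  := (congrArg Coins.a h : (T x c).a = (T x c').a)
    funext i
    have h2 := congrFun h i
    simp only [T, ha] at h2
    cases i <;> simpa [Coins.shiftρ] using h2
  let P := simP (L := L) 𝒢 I R₂.1 Z (2 * L)
  let t : Coins (𝒢.grp I) L → (𝒢.grp I).GT := fun c =>
    (𝒢.grp I).e C₁ (P c (L + 1) * (𝒢.grp I).pw g₃ (c.y (L + 1)))
  let V : View (𝒢.grp I) → (𝒢.grp I).GT → ℝ := fun X t =>
    mean fun ω : Seeds ℋ A κ L I => ind (won ℋ A κ ω X t)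
  have hV : ∀ X t, 0 ≤ V X t ∧ V X t ≤ 1 := fun X t =>
    ⟨mean_nonneg fun _ => ind_nonneg _, mean_le_one fun _ => ind_le_one _⟩
  have hP : ∀ x c k, P (T x c) k = P c k * (𝒢.grp I).pw R₂.1
      (x * ∑ l ∈ Finset.range (2 * L), W c.a l * c.a l ^ k) := by
    intro x c k
    simp only [P, simP, T, Coins.mask_shiftρ, pw_add, mul_assoc]
    rfl
  have hgood : ∀ c, Coins.Good L c.a → ∀ x, V ((T x c).view g g₃ C₁ (P (T x c))) (t (T x c)) =
      V (c.view g g₃ C₁ (P c)) (t c * (𝒢.grp I).e C₁ ((𝒢.grp I).pw R₂.1 x)) := by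
    intro c hc x
    have hne : ∀ k ∈ Finset.Icc 1 (2 * L), k ≠ L + 1 → P (T x c) k = P c k := by
      intro k hk hkL
      rw [hP, pw_eq_of_cast_eq dvd₂ R₂.2 (b := 0), pw_zero, mul_one]
      rw [map_mul, hW c.a hc k hk, if_neg hkL, mul_zero, map_zero]
    have heq : P (T x c) (L + 1) = P c (L + 1) * (𝒢.grp I).pw R₂.1 x := by
      rw [hP, pw_eq_of_cast_eq dvd₂ R₂.2 (b := x)]
      rw [map_mul, hW c.a hc _ (Finset.mem_Icc.2 ⟨by omega, by omega⟩), if_pos rfl, mul_one]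
    have hagree : ((T x c).view g g₃ C₁ (P (T x c))).Agree L (c.view g g₃ C₁ (P c)) := by
      refine Coins.view_agree (fun _ _ => rfl) rfl rfl (fun k hk hkL => ?_) ?_
      · rw [hne k hk hkL]; rfl
      · have h := hg2 ⟨_, pw_mem R₂.2 x⟩
        rw [heq, map_mul, map_mul, map_mul, h, mul_one]; rfl
    have ht : t (T x c) = t c * (𝒢.grp I).e C₁ ((𝒢.grp I).pw R₂.1 x) := by
      simp only [t, heq, map_mul]
      rw [mul_right_comm]; rfl
    rw [ht]
    exact mean_congr fun ω => by rw [won_congr hagree]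
  have h1 : gameValue ℋ A κ L g g₃ C₁ (simP 𝒢 I R₂ Z (2 * L)) - 1 / 2 =
      mean fun c => (mean fun x => V ((T x c).view g g₃ C₁ (P (T x c))) (t (T x c))) - 1 / 2 := by
    rw [mean_sub, mean_const, mean_comm, gameValue, mean_comm]
    congr 1
    symm
    rw [← mean_const (α := ZMod (𝒢.grp I).N) (mean fun c : Coins (𝒢.grp I) L => _)]
    exact mean_congr fun x => mean_injective (hT x) fun c => V (c.view g g₃ C₁ (P c)) (t c)
  rw [h1]
  refine (abs_mean_le _).trans ?_
  calc _ ≤ mean fun c : Coins (𝒢.grp I) L => 1 / 4 * √(2 ^ κ / (𝒢.grp I).p₂) +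
        1 / 2 * (if Coins.Good L c.a then (0 : ℝ) else 1) := ?_
    _ ≤ _ := by
      rw [mean_add, mean_const, mean_mul_left]
      gcongr
      exact Coins.mean_not_good
  refine mean_mono fun c => ?_
  by_cases hc : Coins.Good L c.a
  · rw [if_pos hc, mul_zero, add_zero]
    have h2 := abs_mean_won_sub_half (ℋ := ℋ) (A := A) (κ := κ) (L := L) (c.view g g₃ C₁ (P c))
      (fun R : (𝒢.grp I).sub (𝒢.grp I).p₂ => t c * (𝒢.grp I).e C₁ R) (by
        intro R R' h
        have h3 : (𝒢.grp I).e C₁ ((R * R'⁻¹ : (𝒢.grp I).sub (𝒢.grp I).p₂) : (𝒢.grp I).G) = 1 := by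
          have := mul_left_cancel h
          rw [Subgroup.coe_mul, map_mul, this, ← map_mul, Subgroup.coe_inv]; simp
        exact mul_inv_eq_one.1 (hC2 _ h3))
    rw [card_sub dvd₂] at h2
    rw [mean_congr (hgood c hc), equidist_pw (zpowers_eq_sub (𝒢.grp I).prime₂ dvd₂ R₂.2 hR₂) R₂.2
      fun R : (𝒢.grp I).sub (𝒢.grp I).p₂ =>
        V (c.view g g₃ C₁ (P c)) (t c * (𝒢.grp I).e C₁ R)]
    exact h2
  · rw [if_neg hc]
    have h3 := mean_nonneg fun x => (hV ((T x c).view g g₃ C₁ (P (T x c))) (t (T x c))).1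
    have h4 := mean_le_one fun x => (hV ((T x c).view g g₃ C₁ (P (T x c))) (t (T x c))).2
    have h5 : 0 ≤ 1 / 4 * √(2 ^ κ / ((𝒢.grp I).p₂ : ℝ)) := by positivity
    rw [abs_le]
    constructor <;> linarith

end Last

/-! ### The hybrid argument for a fixed group -/

section Hybrid

open BilinearGroup

variable {𝒢 : GroupGenerator} (ℋ : HashFamily 𝒢) (A : SSAdversary) (κ L : ℕ) (I : 𝒢.Inst)

/-- The probability that the adversary guesses right when it plays against the simulator on a
challenge of the subgroup decision problem. -/
noncomputable def sdValue (b : Bool) : ℝ :=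
  mean fun g₁ : (𝒢.grp I).Gens (𝒢.grp I).p₁ => mean fun g₃ : (𝒢.grp I).Gens (𝒢.grp I).p₃ =>
  mean fun X₁ : (𝒢.grp I).sub (𝒢.grp I).p₁ => mean fun R₁ : (𝒢.grp I).sub (𝒢.grp I).p₂ =>
    gameValue ℋ A κ L g₁.1 g₃.1 (if b then X₁.1 * R₁.1 else X₁.1)
      fun c => simP 𝒢 I g₁.1 ((𝒢.grp I).pw g₁.1 c.x) 0 c

/-- The probability that the adversary guesses right when it plays against the simulator with `m`
masks on a challenge of the general subgroup decision problem. -/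
noncomputable def gsdValue (b : Bool) (m : ℕ) : ℝ :=
  mean fun g₁ : (𝒢.grp I).Gens (𝒢.grp I).p₁ => mean fun g₃ : (𝒢.grp I).Gens (𝒢.grp I).p₃ =>
  mean fun X₁ : (𝒢.grp I).sub (𝒢.grp I).p₁ => mean fun X₂ : (𝒢.grp I).sub (𝒢.grp I).p₁ =>
  mean fun R₁ : (𝒢.grp I).sub (𝒢.grp I).p₂ => mean fun R₂ : (𝒢.grp I).sub (𝒢.grp I).p₂ =>
  mean fun R₃ : (𝒢.grp I).sub (𝒢.grp I).p₂ => mean fun Y₁ : (𝒢.grp I).sub (𝒢.grp I).p₃ =>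
  mean fun Y₂ : (𝒢.grp I).sub (𝒢.grp I).p₃ =>
    gameValue ℋ A κ L g₁.1 g₃.1 (X₁.1 * R₁.1) (simP 𝒢 I (R₂.1 * Y₁.1)
      (if b then X₂.1 * R₃.1 * Y₂.1 else X₂.1 * Y₂.1) m)

variable {ℋ A κ L I}

theorem gsdValue_false (m : ℕ) : gsdValue ℋ A κ L I false m =
    mean fun g₁ : (𝒢.grp I).Gens (𝒢.grp I).p₁ => mean fun g₃ : (𝒢.grp I).Gens (𝒢.grp I).p₃ =>
    mean fun X₁ : (𝒢.grp I).sub (𝒢.grp I).p₁ => mean fun X₂ : (𝒢.grp I).sub (𝒢.grp I).p₁ =>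
    mean fun R₁ : (𝒢.grp I).sub (𝒢.grp I).p₂ => mean fun R₂ : (𝒢.grp I).sub (𝒢.grp I).p₂ =>
      gameValue ℋ A κ L g₁.1 g₃.1 (X₁.1 * R₁.1) (simP 𝒢 I R₂.1 X₂.1 m) := by
  refine mean_congr fun g₁ => mean_congr fun g₃ => mean_congr fun X₁ => mean_congr fun X₂ =>
    mean_congr fun R₁ => mean_congr fun R₂ => ?_
  simp only [Bool.false_eq_true, if_false, gameValue_simP g₃.2, mean_const]

theorem gsdValue_true (m : ℕ) : gsdValue ℋ A κ L I true m =
    mean fun g₁ : (𝒢.grp I).Gens (𝒢.grp I).p₁ => mean fun g₃ : (𝒢.grp I).Gens (𝒢.grp I).p₃ =>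
    mean fun X₁ : (𝒢.grp I).sub (𝒢.grp I).p₁ => mean fun X₂ : (𝒢.grp I).sub (𝒢.grp I).p₁ =>
    mean fun R₁ : (𝒢.grp I).sub (𝒢.grp I).p₂ => mean fun R₂ : (𝒢.grp I).sub (𝒢.grp I).p₂ =>
    mean fun R₃ : (𝒢.grp I).sub (𝒢.grp I).p₂ =>
      gameValue ℋ A κ L g₁.1 g₃.1 (X₁.1 * R₁.1) (simP 𝒢 I R₂.1 (X₂.1 * R₃.1) m) := by
  refine mean_congr fun g₁ => mean_congr fun g₃ => mean_congr fun X₁ => mean_congr fun X₂ =>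
    mean_congr fun R₁ => mean_congr fun R₂ => mean_congr fun R₃ => ?_
  simp only [if_true, gameValue_simP g₃.2, mean_const]

theorem abs_mean_sub_mean_le_const {α : Type} [Finite α] [Nonempty α] {f g : α → ℝ} {ε : ℝ}
    (h : ∀ a, |f a - g a| ≤ ε) : |mean f - mean g| ≤ ε := by
  refine (abs_mean_sub_mean_le f g).trans ?_
  rw [← mean_const (α := α) ε]
  exact mean_mono h

theorem abs_mean_sub_le_const {α : Type} [Finite α] [Nonempty α] {f : α → ℝ} {q ε : ℝ}
    (h : ∀ a, |f a - q| ≤ ε) : |mean f - q| ≤ ε := by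
  rw [← mean_const (α := α) q]
  exact abs_mean_sub_mean_le_const h

theorem mean_ite_one {B : BilinearGroup} [DecidablePred fun R : B.sub B.p₂ => R.1 = 1] :
    (mean fun R : B.sub B.p₂ => if R.1 = 1 then (1 : ℝ) else 0) = 1 / B.p₂ := by
  classical
  have hcard := mean_ite_eq (1 : B.sub B.p₂)
  rw [card_sub dvd₂, ← one_div] at hcard
  rw [← hcard]
  refine mean_congr fun R => ?_
  by_cases h : R = 1
  · simp [h]
  · rw [if_neg fun h' : R.1 = 1 => h (Subtype.ext h'), if_neg (Ne.symm h)]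

theorem abs_gsdValue_true_sub_gsdValue_succ {m : ℕ} (hm : m < 2 * L) :
    |gsdValue ℋ A κ L I true m - gsdValue ℋ A κ L I false (m + 1)| ≤ 1 / (𝒢.grp I).p₂ := by
  classical
  rw [gsdValue_true, gsdValue_false]
  refine abs_mean_sub_mean_le_const fun g₁ => abs_mean_sub_mean_le_const fun g₃ =>
    abs_mean_sub_mean_le_const fun X₁ => abs_mean_sub_mean_le_const fun X₂ =>
    abs_mean_sub_mean_le_const fun R₁ => ?_
  rw [← mean_ite_one]
  exact abs_mean_sub_mean_le_of_eq (fun R : (𝒢.grp I).sub (𝒢.grp I).p₂ => R.1 = 1)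
    (fun R => ⟨mean_nonneg fun _ => gameValue_nonneg _, mean_le_one fun _ => gameValue_le_one _⟩)
    (fun R => ⟨gameValue_nonneg _, gameValue_le_one _⟩)
    fun R hR => mean_gameValue_simP g₁.mem X₂ R hR hm

theorem abs_gsdValue_sub_half (hL : 1 ≤ L) :
    |gsdValue ℋ A κ L I false (2 * L) - 1 / 2| ≤
      1 / 4 * √(2 ^ κ / (𝒢.grp I).p₂) + (L + 2 * L ^ 2 + 2) / (𝒢.grp I).p₂ := by
  classical
  rw [gsdValue_false]
  refine abs_mean_sub_le_const fun g₁ => abs_mean_sub_le_const fun g₃ =>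
    abs_mean_sub_le_const fun X₁ => abs_mean_sub_le_const fun X₂ => ?_
  obtain ⟨E, hE⟩ : ∃ E, E = 1 / 4 * √(2 ^ κ / ((𝒢.grp I).p₂ : ℝ)) +
    1 / 2 * ((2 * L + 4 * L ^ 2) / (𝒢.grp I).p₂) := ⟨_, rfl⟩
  have hE0 : 0 ≤ E := by rw [hE]; positivity
  calc _ = |mean fun R₁ : (𝒢.grp I).sub (𝒢.grp I).p₂ =>
        mean fun R₂ : (𝒢.grp I).sub (𝒢.grp I).p₂ =>
        gameValue ℋ A κ L g₁.1 g₃.1 (X₁.1 * R₁.1) (simP 𝒢 I R₂.1 X₂.1 (2 * L)) - 1 / 2| := by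
        simp only [mean_sub, mean_const]
    _ ≤ mean fun R₁ : (𝒢.grp I).sub (𝒢.grp I).p₂ =>
        mean fun R₂ : (𝒢.grp I).sub (𝒢.grp I).p₂ =>
        (E + (if R₁.1 = 1 then (1 : ℝ) else 0)) + (if R₂.1 = 1 then (1 : ℝ) else 0) := by
        refine (abs_mean_le _).trans (mean_mono fun R₁ => (abs_mean_le _).trans
          (mean_mono fun R₂ => ?_))
        have h0 := gameValue_nonneg (ℋ := ℋ) (A := A) (κ := κ) (g := g₁.1) (g₃ := g₃.1)
          (C₁ := X₁.1 * R₁.1) (simP (L := L) 𝒢 I R₂.1 X₂.1 (2 * L))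
        have h1 := gameValue_le_one (ℋ := ℋ) (A := A) (κ := κ) (g := g₁.1) (g₃ := g₃.1)
          (C₁ := X₁.1 * R₁.1) (simP (L := L) 𝒢 I R₂.1 X₂.1 (2 * L))
        by_cases hR₁ : R₁.1 = 1
        · rw [if_pos hR₁, abs_le]
          constructor <;> split <;> linarith
        · by_cases hR₂ : R₂.1 = 1
          · rw [if_pos hR₂, if_neg hR₁, abs_le]
            constructor <;> linarith
          · rw [if_neg hR₁, if_neg hR₂, add_zero, add_zero, hE]
            exact abs_gameValue_sub_half hL g₁.mem X₁ R₁ R₂ hR₁ hR₂ X₂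
    _ = E + 1 / (𝒢.grp I).p₂ + 1 / (𝒢.grp I).p₂ := by
        simp only [mean_add, mean_const, mean_ite_one]
    _ = _ := by rw [hE]; ring

theorem sdValue_true : sdValue ℋ A κ L I true = gsdValue ℋ A κ L I false 0 := by
  classical
  have h0 : ∀ (D D' Z : (𝒢.grp I).G), simP (L := L) 𝒢 I D Z 0 = simP 𝒢 I D' Z 0 := by
    intro D D' Z
    funext c k
    simp [simP, Coins.mask]
  rw [gsdValue_false, sdValue]
  refine mean_congr fun g₁ => mean_congr fun g₃ => mean_congr fun X₁ => ?_
  rw [mean_comm]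
  refine mean_congr fun R₁ => ?_
  simp only [h0 _ g₁.1, mean_const, if_true]
  rw [← equidist_pw g₁.2 g₁.mem]
  refine (gameValue_resample .x (Or.inl rfl)
    (fun s => simP 𝒢 I g₁.1 ((𝒢.grp I).pw g₁.1 s) 0) fun s c s' => ?_).symm
  funext k
  have h2 : Coins.α (Function.update (c : Coins (𝒢.grp I) L) .x s') = Coins.α c :=
    Function.update_of_ne (fun h => by injection h) _ _
  rw [simP, simP, h2]
  simp [Coins.mask]

/-- The hybrid argument: each of the games in which the number of masks grows from `0` to `2 L` is
linked to the next by a challenge of the general subgroup decision problem, and the last one is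
nearly fair. -/
theorem abs_sdValue_sub_half (hL : 1 ≤ L) :
    |(sdValue ℋ A κ L I true - 1 / 2) - ∑ m ∈ Finset.range (2 * L),
      (gsdValue ℋ A κ L I false m - gsdValue ℋ A κ L I true m)| ≤
      1 / 4 * √(2 ^ κ / (𝒢.grp I).p₂) + (3 * L + 2 * L ^ 2 + 2) / (𝒢.grp I).p₂ := by
  have h1 := abs_gsdValue_sub_half (ℋ := ℋ) (A := A) (κ := κ) (I := I) hL
  have h2 : |∑ m ∈ Finset.range (2 * L),
      (gsdValue ℋ A κ L I true m - gsdValue ℋ A κ L I false (m + 1))| ≤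
      2 * L * (1 / (𝒢.grp I).p₂) := by
    refine (Finset.abs_sum_le_sum_abs _ _).trans ?_
    refine (Finset.sum_le_card_nsmul _ _ _ fun m hm =>
      abs_gsdValue_true_sub_gsdValue_succ (Finset.mem_range.1 hm)).trans (le_of_eq ?_)
    simp
  -- the telescoping sum
  have h3 : sdValue ℋ A κ L I true - gsdValue ℋ A κ L I false (2 * L) =
      (∑ m ∈ Finset.range (2 * L), (gsdValue ℋ A κ L I false m - gsdValue ℋ A κ L I true m)) +
      ∑ m ∈ Finset.range (2 * L),
        (gsdValue ℋ A κ L I true m - gsdValue ℋ A κ L I false (m + 1)) := by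
    rw [sdValue_true, ← Finset.sum_add_distrib, ← Finset.sum_range_sub']
    exact Finset.sum_congr rfl fun _ _ => by ring
  have h4 : (3 * (L : ℝ) + 2 * L ^ 2 + 2) / (𝒢.grp I).p₂ =
      (L + 2 * L ^ 2 + 2) / (𝒢.grp I).p₂ + 2 * L * (1 / (𝒢.grp I).p₂) := by ring
  rw [h4]
  rw [abs_le] at *
  constructor <;> linarith

end Hybrid

/-! ### The real game -/

open Data BilinearGroup

theorem Finset.sort_eq_of_pairwise {s : Finset ℕ} {l : List ℕ} (hl : l.Pairwise (· < ·))
    (h : ∀ a, a ∈ l ↔ a ∈ s) : s.sort (· ≤ ·) = l := by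
  have hs : s = l.toFinset := by ext a; rw [List.mem_toFinset, h]
  rw [hs]
  exact (List.toFinset_sort (r := (· ≤ ·)) (hl.imp fun h => h.ne)).2 (hl.imp fun h => h.le)

theorem Finset.sort_Icc (n : ℕ) : (Finset.Icc 1 n).sort (· ≤ ·) = List.range' 1 n :=
  Finset.sort_eq_of_pairwise List.pairwise_lt_range' fun _ => mem_range'_iff

theorem Finset.sort_Icc_erase (n m : ℕ) : ((Finset.Icc 1 n).erase m).sort (· ≤ ·) =
    (List.range' 1 n).filter fun k => k ≠ m :=
  Finset.sort_eq_of_pairwise (List.Pairwise.filter _ List.pairwise_lt_range') fun a => by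
    rw [List.mem_filter, mem_range'_iff, Finset.mem_erase, and_comm]
    simp

theorem Finset.map_sort_subtype {L : ℕ} (S : Finset (User L)) {l : List ℕ}
    (hl : l.Pairwise (· < ·)) (h : ∀ a : ℕ, a ∈ l ↔ ∃ ha : a ∈ Finset.Icc 1 L, ⟨a, ha⟩ ∈ S) :
    (S.sort (· ≤ ·)).map Subtype.val = l := by
  have hp : ((S.sort (· ≤ ·)).map Subtype.val).Pairwise (· < ·) := by
    rw [List.pairwise_map]
    exact (S.sortedLT_sort).pairwise
  have h1 := Finset.sort_eq_of_pairwise (s := l.toFinset) hl fun a => by rw [List.mem_toFinset]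
  rw [← h1]
  refine (Finset.sort_eq_of_pairwise hp fun a => ?_).symm
  rw [List.mem_toFinset, h]
  simp

theorem map_selectedUsers {L : ℕ} (S : Finset (User L)) (o : Data) {l : List ℕ}
    (hl : l.Pairwise (· < ·)) (h : ∀ a : ℕ, a ∈ l ↔ ∃ ha : a ∈ Finset.Icc 1 L, ⟨a, ha⟩ ∈ S) :
    ((decodeSet L o ∩ S).sort (· ≤ ·)).map Subtype.val = selectedUsers o l := by
  refine Finset.map_sort_subtype _ (hl.filter _) fun a => ?_
  rw [selectedUsers, List.mem_filter, h]
  simp only [decodeSet, Finset.mem_inter, Finset.mem_filter, Finset.mem_univ, true_and]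
  exact ⟨fun ⟨⟨h1, h2⟩, h3⟩ => ⟨h1, h3, h2⟩, fun ⟨h1, h3, h2⟩ => ⟨⟨h1, h2⟩, h3⟩⟩

theorem encElems_elems {B : BilinearGroup} (s : Finset ℕ) (f : s → B.G) (F : ℕ → B.G)
    (h : ∀ k : s, f k = F k.1) :
    (DBESS.elems B s f).map (Sum.elim B.enc B.encT) =
      (s.sort (· ≤ ·)).map fun k => B.enc (F k) := by
  rw [DBESS.elems, List.map_map, ← List.attach_map_val (f := fun k => B.enc (F k))]
  refine List.map_congr_left fun k _ => ?_
  rw [Function.comp_apply, Sum.elim_inl, h]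

section Real

variable {𝒢 : GroupGenerator} {ℋ : HashFamily 𝒢} {κ L : ℕ}

/-- The view `X` shows the public parameters `pp`. -/
structure View.ShowsPP (pp : DBESS.PP ℋ κ L) (X : View pp.B) : Prop where
  g : pp.g = X.g
  Y : pp.Y = X.Y
  A : ∀ k, pp.A k = X.A k.1
  U : ∀ k, pp.U k = X.U k.1
  Ω : pp.Ω = X.Ω

/-- The view `X` shows the public key `k` of user `j`. -/
structure View.ShowsUPK {pp : DBESS.PP ℋ κ L} (X : View pp.B) (j : User L) (k : DBESS.UPK pp j) :
    Prop where
  V : k.V = X.V j.1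
  W : ∀ i, k.W i = X.W j.1 i.1

theorem View.ShowsPP.encPP {pp : DBESS.PP ℋ κ L} {X : View pp.B} (h : X.ShowsPP pp) :
    (dbeSS ℋ).encPP pp = X.encPP L (List.ofFn pp.key) := by
  rw [View.encPP, ← Finset.sort_Icc, ← Finset.sort_Icc_erase, ← encElems_elems _ _ _ h.A,
    ← encElems_elems _ _ _ h.U, ← h.g, ← h.Y, ← h.Ω]
  change list [pp.B.desc, list (pp.elements.map _), _] = _
  rw [DBESS.PP.elements]
  simp only [List.map_append, List.map_cons, List.map_nil, Sum.elim_inl, Sum.elim_inr]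

theorem View.ShowsUPK.encUPK {pp : DBESS.PP ℋ κ L} {X : View pp.B} {j : User L}
    {k : DBESS.UPK pp j} (h : X.ShowsUPK j k) :
    Data.cons (unary j.1) ((dbeSS ℋ).encUPK pp j k) = X.encUPK L j.1 := by
  rw [View.encUPK, ← Finset.sort_Icc_erase, ← encElems_elems _ _ _ h.W, ← h.V]
  rfl

theorem View.encUPKs_eq {pp : DBESS.PP ℋ κ L} {X : View pp.B} (S : Finset (User L))
    (upk : ∀ j : S, DBESS.UPK pp j.1) (h : ∀ j : S, X.ShowsUPK j.1 (upk j)) :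
    (dbeSS ℋ).encUPKs pp S upk =
      list (((S.sort (· ≤ ·)).map Subtype.val).map (X.encUPK L)) := by
  rw [List.map_map, ← List.attach_map_val]
  refine congrArg list ?_
  refine List.map_congr_left fun j _ => ?_
  exact (h ⟨j.1, (Finset.mem_sort _).1 j.2⟩).encUPK

end Real

open Data BilinearGroup

theorem unif_apply {α : Type} [Finite α] [Nonempty α] (a : α) :
    unif α a = (Nat.card α : ENNReal)⁻¹ := by
  refine (@PMF.uniformOfFintype_apply α (Fintype.ofFinite α) _ a).trans ?_
  rw [@Nat.card_eq_fintype_card α (Fintype.ofFinite α)]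

theorem unif_bind_bind {α β γ : Type} [Finite α] [Nonempty α] [Finite β] [Nonempty β]
    (k : α → β → PMF γ) :
    ((unif α).bind fun a => (unif β).bind (k a)) = (unif (α × β)).bind fun q => k q.1 q.2 := by
  ext c
  simp only [PMF.bind_apply, unif_apply, Nat.card_prod, Nat.cast_mul]
  rw [ENNReal.tsum_prod']
  refine tsum_congr fun a => ?_
  rw [← ENNReal.tsum_mul_left]
  refine tsum_congr fun b => ?_
  rw [ENNReal.mul_inv (Or.inr (ENNReal.natCast_ne_top _)) (Or.inl (ENNReal.natCast_ne_top _)),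
    mul_assoc]

section RealGame

variable {𝒢 : GroupGenerator} (ℋ : HashFamily 𝒢) (A : SSAdversary) (κ L : ℕ)

/-- The public parameters as a function of the random choices of the setup. -/
def realPP (I : 𝒢.Inst) (g g₃ : (𝒢.grp I).G) (α : ZMod (𝒢.grp I).N) (u : (𝒢.grp I).G)
    (Y : Finset.Icc 1 (2 * L) → (𝒢.grp I).sub (𝒢.grp I).p₃) (key : Fin (ℋ.keyLen κ I) → Bool) :
    DBESS.PP ℋ κ L :=
  let U : ℕ → (𝒢.grp I).G := fun k =>
    u ^ (α ^ k).val * (if h : k ∈ Finset.Icc 1 (2 * L) then (Y ⟨k, h⟩).1 else 1)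
  { I := I
    g := g
    Y := g₃
    A := fun k => g ^ (α ^ k.1).val
    U := fun k => U k.1
    Ω := (𝒢.grp I).e g (U (L + 1))
    key := key }

/-- The setup of the scheme on the groups `I`. -/
noncomputable def setupOf (I : 𝒢.Inst) : PMF (DBESS.PP ℋ κ L) :=
  (unif ((𝒢.grp I).Gens (𝒢.grp I).p₁)).bind fun g₁ =>
  (unif ((𝒢.grp I).Gens (𝒢.grp I).p₃)).bind fun g₃ =>
  (unif (ZMod (𝒢.grp I).N)).bind fun α =>
  (unif ((𝒢.grp I).sub (𝒢.grp I).p₁)).bind fun u =>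
  (unif (Finset.Icc 1 (2 * L) → (𝒢.grp I).sub (𝒢.grp I).p₃)).bind fun Y =>
  (unif (Fin (ℋ.keyLen κ I) → Bool)).bind fun key =>
    PMF.pure (realPP ℋ κ L I g₁.1 g₃.1 α u.1 Y key)

variable {ℋ κ L} in
/-- The key pair of a user as a function of the random choices of the key generation. -/
def realKeys (pp : DBESS.PP ℋ κ L) (i : User L)
    (x : ZMod pp.B.N × (Finset.Icc 1 L → pp.B.sub pp.B.p₃)) : DBESS.USK pp × DBESS.UPK pp i :=
  ({ K := pp.U' (L + 1 - i.1) (DBESS.mem_sub i.2) ^ x.1.val *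
      (x.2 ⟨L + 1 - i.1, DBESS.mem_sub i.2⟩).1 },
   { V := pp.g ^ x.1.val
     W := fun k => pp.U' k.1 (Finset.mem_of_mem_erase k.2) ^ x.1.val *
       (x.2 ⟨k.1, Finset.mem_of_mem_erase k.2⟩).1 })

theorem genKey_eq (pp : DBESS.PP ℋ κ L) (i : User L) :
    DBESS.genKey pp i = (unif _).map (realKeys pp i) :=
  unif_bind_bind fun γ Y => PMF.pure (realKeys pp i (γ, Y))

/-- The initial set of the adversary with random bits `r`. -/
def realS₀ (r : Fin (A.coins.eval (κ + L)) → Bool) : Finset (User L) :=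
  decodeSet L (A.answer₁ κ L (List.ofFn r)).hd

variable {κ L}

/-- The second answer of the adversary in the real game. -/
noncomputable def realAnswer₂ (r : Fin (A.coins.eval (κ + L)) → Bool) (pp : DBESS.PP ℋ κ L)
    (upk : ∀ j : realS₀ A κ L r, DBESS.UPK pp j.1) : Data :=
  A.query (list [(A.answer₁ κ L (List.ofFn r)).tl, (dbeSS ℋ).encPP pp,
    (dbeSS ℋ).encUPKs pp (realS₀ A κ L r) upk])

/-- Whether the adversary guesses right in the real game after its second answer `o₂`. -/
def realGuess (r : Fin (A.coins.eval (κ + L)) → Bool) (pp : DBESS.PP ℋ κ L)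
    (upk : ∀ j : realS₀ A κ L r, DBESS.UPK pp j.1) (t : ZMod pp.B.N) (rk : Fin κ → Bool)
    (μ : Bool) (o₂ : Data) : Bool :=
  let S := decodeSet L o₂.hd ∩ realS₀ A κ L r
  (A.guess (list [o₂.tl, list [pp.B.enc (pp.g ^ t.val), pp.B.enc
      ((∏ j : S, pp.A j.1 * (upk ⟨j.1, (Finset.mem_inter.1 j.2).2⟩).V) ^ t.val)],
    bits (List.ofFn (if μ then rk else ℋ.hash κ pp.I pp.key (pp.Ω ^ t.val)))])).toBool == μ

/-- Whether the adversary guesses right in the real game. -/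
noncomputable def realWon (r : Fin (A.coins.eval (κ + L)) → Bool) (pp : DBESS.PP ℋ κ L)
    (upk : ∀ j : realS₀ A κ L r, DBESS.UPK pp j.1) (t : ZMod pp.B.N) (rk : Fin κ → Bool)
    (μ : Bool) : Bool :=
  realGuess ℋ A r pp upk t rk μ (realAnswer₂ ℋ A r pp upk)

/-- The real game from the setup on. -/
noncomputable def realRun (r : Fin (A.coins.eval (κ + L)) → Bool) (pp : DBESS.PP ℋ κ L) :
    PMF Bool :=
  (pmfPi fun j : realS₀ A κ L r => DBESS.genKey pp j.1).bind fun keys =>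
  (unif (ZMod pp.B.N)).bind fun t => (unif (Fin κ → Bool)).bind fun rk =>
  (unif Bool).bind fun μ => PMF.pure (realWon ℋ A r pp (fun j => (keys j).2) t rk μ)

theorem ssExp_eq : (dbeSS ℋ).ssExp A κ L =
    (unif _).bind fun r => ((𝒢.dist κ).bind (setupOf ℋ κ L)).bind (realRun ℋ A r) := by
  have h : (dbeSS ℋ).ssExp A κ L = (unif _).bind fun r =>
      ((𝒢.dist κ).bind (setupOf ℋ κ L)).bind fun pp =>
        (pmfPi fun j : realS₀ A κ L r => DBESS.genKey pp j.1).bind fun keys =>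
        ((unif (ZMod pp.B.N)).bind fun t => PMF.pure
          (({ C₁ := pp.g ^ t.val
              C₂ := (∏ j : (decodeSet L (realAnswer₂ ℋ A r pp fun j => (keys j).2).hd ∩
                realS₀ A κ L r : Finset (User L)), pp.A j.1 *
                  (keys ⟨j.1, (Finset.mem_inter.1 j.2).2⟩).2.V) ^ t.val } : DBESS.Header pp),
            ℋ.hash κ pp.I pp.key (pp.Ω ^ t.val))).bind fun c =>
        (unif (Fin κ → Bool)).bind fun rk =>
        (unif Bool).bind fun μ => PMF.pure
          ((A.guess (list [(realAnswer₂ ℋ A r pp fun j => (keys j).2).tl,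
            list [pp.B.enc c.1.C₁, pp.B.enc c.1.C₂],
            bits (List.ofFn (if μ then rk else c.2))])).toBool == μ) := rfl
  rw [h]
  simp only [PMF.bind_bind, PMF.pure_bind]
  rfl

end RealGame

section RealSampling

open BilinearGroup

variable {B : BilinearGroup} {L : ℕ}

/-- The random choices of the exponents and of the elements of order `p₃` in the real game with
initial set `S`: those of the setup, and those of the key generation for each user in `S`. -/
abbrev RealCoins (B : BilinearGroup) (L : ℕ) (S : Finset (User L)) : Type :=
  (ZMod B.N × B.sub B.p₁ × (Finset.Icc 1 (2 * L) → B.sub B.p₃)) ×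
    (S → ZMod B.N × (Finset.Icc 1 L → B.sub B.p₃))

/-- The random choices of the real game that correspond to the coins of the simulator. -/
def Coins.toReal (S : Finset (User L)) (g : B.Gens B.p₁) (g₃ : B.Gens B.p₃) (c : Coins B L) :
    RealCoins B L S :=
  ((c.α, ⟨B.pw g.1 c.x, pw_mem g.mem _⟩, fun k => ⟨B.pw g₃.1 (c.y k), pw_mem g₃.mem _⟩),
    fun j => (c.γ j.1 - c.α ^ j.1.1, fun k =>
      ⟨B.pw g₃.1 (c.w j.1 k + c.y k * c.α ^ j.1.1 - c.y (k + j.1)), pw_mem g₃.mem _⟩))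

/-- The secrets of the users and the blindings of their public keys, shifted from those of the
simulator to those of the real game. -/
def Coins.shiftReal (c : Coins B L) : Coins B L
  | .γ j => c (.γ j) - c .α ^ j.1
  | .w j k => c (.w j k) + c.y k * c .α ^ j.1 - c.y (k + j)
  | i => c i

theorem Coins.shiftReal_injective : Function.Injective (Coins.shiftReal (B := B) (L := L)) := by
  intro c c' h
  have h' : ∀ i, c.shiftReal i = c'.shiftReal i := fun i => congrFun h i
  have hα : c .α = c' .α := h' .α
  have hy : c.y = c'.y := by
    funext k
    unfold y
    congr 1
    funext i
    exact h' (.y i)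
  funext i
  have hi := h' i
  cases i <;> simp only [shiftReal] at hi
  case γ j => rwa [hα, sub_left_inj] at hi
  case w j k => rwa [hα, hy, sub_left_inj, add_left_inj] at hi
  all_goals exact hi

theorem Coins.equidist_toReal (S : Finset (User L)) (g : B.Gens B.p₁) (g₃ : B.Gens B.p₃) :
    Equidist (Coins.toReal S g g₃) := by
  classical
  let Ψ : Coins B L → RealCoins B L S := fun c =>
    ((c.α, ⟨B.pw g.1 c.x, pw_mem g.mem _⟩, fun k => ⟨B.pw g₃.1 (c.y k), pw_mem g₃.mem _⟩),
      fun j => (c.γ j.1, fun k => ⟨B.pw g₃.1 (c.w j.1 k), pw_mem g₃.mem _⟩))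
  have hext : ∀ (f f' : Fin (2 * L + 2) → ZMod B.N) (k : ℕ),
      ext (fun i => f i + f' i) k = ext f k + ext f' k := by
    intro f f' k
    unfold ext
    split <;> simp
  have hpw : ∀ {p : ℕ} (x : B.Gens p) (z : B.sub p), ∃ s, B.pw x.1 s = z.1 := by
    intro p x z
    have hz : z.1 ∈ Subgroup.zpowers x.1 := by
      have hx : Subgroup.zpowers x.1 = B.sub p := x.2
      rw [hx]; exact z.2
    rw [← mem_powers_iff_mem_zpowers] at hz
    obtain ⟨n, hn⟩ := hz
    exact ⟨n, (pw_natCast _ n).trans hn⟩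
  have hΨ : Equidist Ψ := by
    refine Equidist.of_surjective_mul (H := (Multiplicative (ZMod B.N) × B.sub B.p₁ ×
      (Finset.Icc 1 (2 * L) → B.sub B.p₃)) ×
        (S → Multiplicative (ZMod B.N) × (Finset.Icc 1 L → B.sub B.p₃))) (φ := Ψ) ?_ ?_
    · intro c c'
      refine Prod.ext (Prod.ext rfl (Prod.ext ?_ ?_)) ?_
      · exact Subtype.ext (pw_add _ _ _)
      · funext k
        refine Subtype.ext ?_
        change B.pw g₃.1 (y (c + c') k) = _
        rw [show y (c + c') k = c.y k + c'.y k from hext _ _ k, pw_add]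
        rfl
      · funext j
        refine Prod.ext ?_ (funext fun k => Subtype.ext ?_)
        · exact hext (fun i => c (.γ i)) (fun i => c' (.γ i)) j.1
        · change B.pw g₃.1 (w (c + c') j.1 k) = _
          have : w (c + c') j.1 k = c.w j.1 k + c'.w j.1 k := by
            unfold w
            rw [← hext]
            congr 1
            funext i
            exact hext _ _ _
          rw [this, pw_add]
          rfl
    · rintro ⟨⟨a, u, Y⟩, Z⟩
      choose s hs using fun z => hpw g z
      choose s₃ hs₃ using fun z => hpw g₃ z
      let c : Coins B L
        | .α => a
        | .x => s u
        | .y k => if h : k.1 ∈ Finset.Icc 1 (2 * L) then s₃ (Y ⟨k, h⟩) else 0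
        | .γ j => if h : ∃ h' : j.1 ∈ Finset.Icc 1 L, ⟨j, h'⟩ ∈ S then (Z ⟨⟨j, h.1⟩, h.2⟩).1 else 0
        | .w j k => if h : ∃ h' : j.1 ∈ Finset.Icc 1 L, ⟨j, h'⟩ ∈ S then
            if h'' : k.1 ∈ Finset.Icc 1 L then s₃ ((Z ⟨⟨j, h.1⟩, h.2⟩).2 ⟨k, h''⟩) else 0 else 0
        | _ => 0
      refine ⟨c, Prod.ext (Prod.ext rfl (Prod.ext ?_ (funext fun k => Subtype.ext ?_))) ?_⟩
      · exact Subtype.ext (hs u)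
      · have hk := Finset.mem_Icc.1 k.2
        have : c.y k = s₃ (Y k) := by
          unfold y ext
          rw [dif_pos (by omega)]
          exact dif_pos k.2
        change B.pw g₃.1 (c.y k) = _
        rw [this, hs₃]
      · funext j
        have hj := Finset.mem_Icc.1 j.1.2
        have hjS : ∃ h' : j.1.1 ∈ Finset.Icc 1 L, (⟨j.1.1, h'⟩ : User L) ∈ S := ⟨j.1.2, j.2⟩
        refine Prod.ext ?_ (funext fun k => Subtype.ext ?_)
        · change c.γ j.1 = _
          unfold γ ext
          rw [dif_pos (by omega)]
          exact dif_pos hjS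
        · have hk := Finset.mem_Icc.1 k.2
          have : c.w j.1 k = s₃ ((Z j).2 k) := by
            unfold w
            rw [ext, dif_pos (by omega), ext, dif_pos (by omega)]
            exact (dif_pos hjS).trans (dif_pos k.2)
          change B.pw g₃.1 (c.w j.1 k) = _
          rw [this, hs₃]
  have h := hΨ.comp (Equidist.of_bijective (φ := Coins.shiftReal (B := B) (L := L))
    ⟨Coins.shiftReal_injective, Finite.surjective_of_injective Coins.shiftReal_injective⟩)
  convert h using 2 with c
  have hγ : ∀ j : User L, (c.shiftReal).γ j = c.γ j - c.α ^ j.1 := by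
    intro j
    have hj := Finset.mem_Icc.1 j.2
    unfold γ ext
    rw [dif_pos (by omega), dif_pos (by omega)]
    rfl
  have hw : ∀ (j : User L) (k : Finset.Icc 1 L),
      (c.shiftReal).w j k = c.w j k + c.y k * c.α ^ j.1 - c.y (k + j) := by
    intro j k
    have hj := Finset.mem_Icc.1 j.2
    have hk := Finset.mem_Icc.1 k.2
    unfold w
    rw [ext, dif_pos (by omega), ext, dif_pos (by omega), ext, dif_pos (by omega), ext,
      dif_pos (by omega)]
    rfl
  simp only [Ψ, toReal, hγ, hw]
  rfl

end RealSampling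

section RealView

open Data BilinearGroup

theorem BilinearGroup.pw_list_sum {B : BilinearGroup} (x : B.G) (l : List (ZMod B.N)) :
    B.pw x l.sum = (l.map (B.pw x)).prod := by
  induction l with
  | nil => simp
  | cons a l ih => rw [List.sum_cons, pw_add, ih, List.map_cons, List.prod_cons]

theorem mean_rearrange {a b c d e f h : Type} [Finite a] [Finite b] [Finite c] [Finite d]
    [Finite e] [Finite f] [Finite h] (F : (a × b × c) × e → d → h → f → ℝ) :
    (mean fun x : a => mean fun y : b => mean fun z : c => mean fun k : d => mean fun v : e =>
      mean fun t : f => mean fun s : h => F ((x, y, z), v) k s t) =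
    mean fun t : f => mean fun q : d × h => mean fun p : (a × b × c) × e => F p q.1 q.2 t := by
  calc _ = mean fun p : a × b × c => mean fun k => mean fun v => mean fun u : f × h =>
        F (p, v) k u.2 u.1 := by simp only [mean_prod]
    _ = mean fun k => mean fun p : a × b × c => mean fun v => mean fun u : f × h =>
        F (p, v) k u.2 u.1 := mean_comm _
    _ = mean fun k => mean fun u : f × h => mean fun q : (a × b × c) × e =>
        F q k u.2 u.1 := by
      refine mean_congr fun k => ?_
      exact (mean_prod fun q : (a × b × c) × e => mean fun u : f × h => F q k u.2 u.1).symm.trans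
        (mean_comm _)
    _ = mean fun k => mean fun t => mean fun s => mean fun q : (a × b × c) × e =>
        F q k s t := mean_congr fun k => mean_prod _
    _ = mean fun t => mean fun k => mean fun s => mean fun q : (a × b × c) × e =>
        F q k s t := mean_comm _
    _ = _ := mean_congr fun t =>
        (mean_prod fun q : d × h => mean fun p : (a × b × c) × e => F p q.1 q.2 t).symm

variable {𝒢 : GroupGenerator} {ℋ : HashFamily 𝒢} {A : SSAdversary} {κ L : ℕ} {I : 𝒢.Inst}

theorem prod_map_sort {G : Type} [CommGroup G] (S : Finset (User L)) (f : ℕ → G) :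
    ∏ j : S, f j.1.1 = (((S.sort (· ≤ ·)).map Subtype.val).map f).prod := by
  rw [Finset.prod_coe_sort S fun j => f j.1, List.map_map, ← Finset.prod_map_toList]
  exact (((S.sort_perm_toList _).map _).prod_eq).symm

variable (g : (𝒢.grp I).Gens (𝒢.grp I).p₁) (g₃ : (𝒢.grp I).Gens (𝒢.grp I).p₃)

/-- The public parameters of the real game that correspond to the coins of the simulator. -/
def Coins.realPP (ℋ : HashFamily 𝒢) {κ : ℕ} (S : Finset (User L)) (key : Fin (ℋ.keyLen κ I) → Bool)
    (q : RealCoins (𝒢.grp I) L S) : DBESS.PP ℋ κ L :=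
  _root_.realPP ℋ κ L I g.1 g₃.1 q.1.1 q.1.2.1.1 q.1.2.2 key

/-- The public keys of the real game that correspond to the coins of the simulator. -/
def Coins.realUPK (S : Finset (User L)) (key : Fin (ℋ.keyLen κ I) → Bool)
    (q : RealCoins (𝒢.grp I) L S) (j : S) : DBESS.UPK (Coins.realPP g g₃ ℋ S key q) j.1 :=
  (realKeys (Coins.realPP g g₃ ℋ S key q) j.1 (q.2 j)).2

/-- The simulator with a header in the subgroup of order `p₁` and without masks plays the real
game. -/
theorem realWon_eq_won (hL : 1 ≤ L) (c : Coins (𝒢.grp I) L)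
    (t : ZMod (𝒢.grp I).N) (ω : Seeds ℋ A κ L I) :
    realWon ℋ A ω.1
      (Coins.realPP g g₃ ℋ (realS₀ A κ L ω.1) ω.2.1 (c.toReal (realS₀ A κ L ω.1) g g₃))
      (Coins.realUPK g g₃ (realS₀ A κ L ω.1) ω.2.1 (c.toReal (realS₀ A κ L ω.1) g g₃))
      t ω.2.2.1 ω.2.2.2 =
    won ℋ A κ ω (c.view g.1 g₃.1 ((𝒢.grp I).pw g.1 t)
        (simP 𝒢 I g.1 ((𝒢.grp I).pw g.1 c.x) 0 c))
      ((𝒢.grp I).e ((𝒢.grp I).pw g.1 t) (simP 𝒢 I g.1 ((𝒢.grp I).pw g.1 c.x) 0 c (L + 1) *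
        (𝒢.grp I).pw g₃.1 (c.y (L + 1)))) := by
  obtain ⟨r, key, rk, μ⟩ := ω
  obtain ⟨S, hS⟩ : ∃ S, S = realS₀ A κ L r := ⟨_, rfl⟩
  obtain ⟨X, hX⟩ : ∃ X, X = c.view g.1 g₃.1 ((𝒢.grp I).pw g.1 t)
    (simP 𝒢 I g.1 ((𝒢.grp I).pw g.1 c.x) 0 c) := ⟨_, rfl⟩
  have hsim : ∀ k, simP 𝒢 I g.1 ((𝒢.grp I).pw g.1 c.x) 0 c k =
      (𝒢.grp I).pw ((𝒢.grp I).pw g.1 c.x) (c.α ^ k) := by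
    intro k
    simp [simP, Coins.mask]
  have hXU : ∀ k, X.U k = (𝒢.grp I).pw ((𝒢.grp I).pw g.1 c.x) (c.α ^ k) *
      (𝒢.grp I).pw g₃.1 (c.y k) := by
    intro k
    rw [hX, ← hsim]
    rfl
  have hU : ∀ k, k ∈ Finset.Icc 1 (2 * L) → (𝒢.grp I).pw ((𝒢.grp I).pw g.1 c.x) (c.α ^ k) *
      (if h : k ∈ Finset.Icc 1 (2 * L) then ((c.toReal S g g₃).1.2.2 ⟨k, h⟩).1 else 1) =
        X.U k := by
    intro k hk
    rw [dif_pos hk, hXU]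
    rfl
  have hΩ : (𝒢.grp I).e g.1 (X.U (L + 1)) =
      (Coins.realPP g g₃ ℋ S key (c.toReal S g g₃)).Ω := by
    rw [← hU (L + 1) (Finset.mem_Icc.2 ⟨by omega, by omega⟩)]
    rfl
  have hPP : View.ShowsPP (Coins.realPP g g₃ ℋ S key (c.toReal S g g₃)) X := by
    refine ⟨?_, ?_, fun k => ?_, fun k => hU k.1 (Finset.mem_of_mem_erase k.2), ?_⟩
    · rw [hX]; rfl
    · rw [hX]; rfl
    · rw [hX]; rfl
    · rw [← hΩ, hX]; rfl
  have hUPK : ∀ j : S, View.ShowsUPK (pp := Coins.realPP g g₃ ℋ S key (c.toReal S g g₃)) X j.1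
      (Coins.realUPK g g₃ S key (c.toReal S g g₃) j) := by
    intro j
    refine ⟨?_, fun k => ?_⟩
    · rw [hX]
      exact pw_sub _ _ _
    · have hk := Finset.mem_Icc.1 (Finset.mem_of_mem_erase k.2)
      have h1 := hU k.1 (Finset.mem_Icc.2 ⟨by omega, by omega⟩)
      have h2 : X.W j.1 k = (𝒢.grp I).pw (X.U k) (c.γ j.1) * (X.U (k + j.1))⁻¹ *
          (𝒢.grp I).pw g₃.1 (c.w j.1 k) := by rw [hX]; rfl
      have h3 : (Coins.realUPK g g₃ S key (c.toReal S g g₃) j).W k =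
          (𝒢.grp I).pw (X.U k) (c.γ j.1 - c.α ^ j.1.1) *
            (𝒢.grp I).pw g₃.1 (c.w j.1 k + c.y k * c.α ^ j.1.1 - c.y (k + j.1)) := by
        rw [← h1]; rfl
      rw [h2, h3, hXU, hXU, pw_sub, pw_sub, pw_add, mul_pw _ _ (c.α ^ j.1.1), ← pw_mul _ (c.α ^ _),
        ← pow_add, ← pw_mul _ (c.y _), mul_inv, mul_inv]
      generalize (𝒢.grp I).pw _ (c.γ j.1) = a₁
      generalize (𝒢.grp I).pw _ (c.α ^ (k.1 + j.1.1)) = a₂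
      generalize (𝒢.grp I).pw g₃.1 (c.y k * c.α ^ j.1.1) = a₃
      generalize (𝒢.grp I).pw g₃.1 (c.w j.1 k) = a₄
      generalize (𝒢.grp I).pw g₃.1 (c.y (k.1 + j.1.1)) = a₅
      calc _ = a₁ * a₂⁻¹ * (a₃⁻¹ * (a₃ * (a₄ * a₅⁻¹))) := by
            simp only [mul_assoc, mul_comm, mul_left_comm]
        _ = _ := by
            rw [inv_mul_cancel_left]
            simp only [mul_assoc, mul_comm, mul_left_comm]
  have hS₀ : (S.sort (· ≤ ·)).map Subtype.val = A.users₁ κ L (List.ofFn r) := by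
    have h := map_selectedUsers (Finset.univ : Finset (User L)) (A.answer₁ κ L (List.ofFn r)).hd
      (l := List.range' 1 L) List.pairwise_lt_range' fun a => by
        rw [mem_range'_iff]; simp
    rw [Finset.inter_univ] at h
    rw [hS]
    exact h
  have hans : realAnswer₂ ℋ A r (Coins.realPP g g₃ ℋ (realS₀ A κ L r) key
      (c.toReal (realS₀ A κ L r) g g₃)) (Coins.realUPK g g₃ (realS₀ A κ L r) key
        (c.toReal (realS₀ A κ L r) g g₃)) = A.answer₂ κ L (List.ofFn r) (List.ofFn key) X := by
    subst hS
    rw [realAnswer₂, SSAdversary.answer₂, hPP.encPP, View.encUPKs_eq _ _ hUPK, hS₀]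
    rfl
  have hS₁ : ∀ o, ((decodeSet L o ∩ S).sort (· ≤ ·)).map Subtype.val =
      selectedUsers o (A.users₁ κ L (List.ofFn r)) := by
    intro o
    refine map_selectedUsers S o ?_ fun a => ?_
    · exact List.Pairwise.filter _ List.pairwise_lt_range'
    · rw [← hS₀]
      simp
  have hC₂ : ∀ o : Data, ((∏ j : (decodeSet L o ∩ S : Finset (User L)),
      (Coins.realPP g g₃ ℋ S key (c.toReal S g g₃)).A j.1 *
        (Coins.realUPK g g₃ S key (c.toReal S g g₃) ⟨j.1, (Finset.mem_inter.1 j.2).2⟩).V) ^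
          t.val : (𝒢.grp I).G) = X.C₂ (selectedUsers o (A.users₁ κ L (List.ofFn r))) := by
    intro o
    have h1 : ∀ j : (decodeSet L o ∩ S : Finset (User L)),
        (Coins.realPP g g₃ ℋ S key (c.toReal S g g₃)).A j.1 *
          (Coins.realUPK g g₃ S key (c.toReal S g g₃) ⟨j.1, (Finset.mem_inter.1 j.2).2⟩).V =
        (𝒢.grp I).pw g.1 (c.γ j.1.1) := by
      intro j
      change (𝒢.grp I).pw g.1 (c.α ^ j.1.1) * (𝒢.grp I).pw g.1 (c.γ j.1 - c.α ^ j.1.1) = _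
      rw [← pw_add, add_sub_cancel]
    rw [Finset.prod_congr rfl fun j _ => h1 j]
    have h2 := prod_map_sort (decodeSet L o ∩ S) fun j => (𝒢.grp I).pw g.1 (c.γ j)
    rw [hS₁] at h2
    rw [hX]
    change (𝒢.grp I).pw _ t = (𝒢.grp I).pw ((𝒢.grp I).pw g.1 t)
      ((selectedUsers o (A.users₁ κ L (List.ofFn r))).map c.γ).sum
    rw [pw_comm, pw_list_sum, List.map_map]
    exact congrArg _ h2
  have hCK : (Coins.realPP g g₃ ℋ S key (c.toReal S g g₃)).Ω ^ t.val =
      (𝒢.grp I).e ((𝒢.grp I).pw g.1 t) (simP 𝒢 I g.1 ((𝒢.grp I).pw g.1 c.x) 0 c (L + 1) *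
        (𝒢.grp I).pw g₃.1 (c.y (L + 1))) := by
    rw [hsim, ← hXU, e_pw_left, hΩ]
    rfl
  rw [← hX, ← hCK]
  subst hS
  have hC₁ : X.C₁ = (𝒢.grp I).pw g.1 t := by rw [hX]; rfl
  refine (congrArg (realGuess ℋ A r
    (Coins.realPP g g₃ ℋ (realS₀ A κ L r) key (c.toReal (realS₀ A κ L r) g g₃))
    (Coins.realUPK g g₃ (realS₀ A κ L r) key (c.toReal (realS₀ A κ L r) g g₃))
    t rk μ) hans).trans ?_
  unfold realGuess won SSAdversary.play SSAdversary.users₂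
  rw [← hC₂, hC₁]
  cases μ <;> rfl

variable (A κ) in
/-- The probability that the adversary guesses right in the real game on a fixed group. -/
theorem mean_realWon (hL : 1 ≤ L) (r : Fin (A.coins.eval (κ + L)) → Bool) :
    (mean fun α : ZMod (𝒢.grp I).N => mean fun u : (𝒢.grp I).sub (𝒢.grp I).p₁ =>
      mean fun Y : Finset.Icc 1 (2 * L) → (𝒢.grp I).sub (𝒢.grp I).p₃ =>
      mean fun key : Fin (ℋ.keyLen κ I) → Bool =>
      mean fun x : realS₀ A κ L r → ZMod (𝒢.grp I).N ×
        (Finset.Icc 1 L → (𝒢.grp I).sub (𝒢.grp I).p₃) =>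
      mean fun t : ZMod (𝒢.grp I).N => mean fun s : (Fin κ → Bool) × Bool =>
        ind (realWon ℋ A r (realPP ℋ κ L I g.1 g₃.1 α u.1 Y key)
          (fun j => (realKeys (realPP ℋ κ L I g.1 g₃.1 α u.1 Y key) j.1 (x j)).2) t s.1 s.2)) =
    mean fun X₁ : (𝒢.grp I).sub (𝒢.grp I).p₁ =>
      mean fun ω : (Fin (ℋ.keyLen κ I) → Bool) × (Fin κ → Bool) × Bool =>
      mean fun c : Coins (𝒢.grp I) L => ind (won ℋ A κ (r, ω) (c.view g.1 g₃.1 X₁.1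
        (simP 𝒢 I g.1 ((𝒢.grp I).pw g.1 c.x) 0 c))
      ((𝒢.grp I).e X₁.1 (simP 𝒢 I g.1 ((𝒢.grp I).pw g.1 c.x) 0 c (L + 1) *
        (𝒢.grp I).pw g₃.1 (c.y (L + 1))))) := by
  let F : RealCoins (𝒢.grp I) L (realS₀ A κ L r) → (Fin (ℋ.keyLen κ I) → Bool) →
      (Fin κ → Bool) × Bool → ZMod (𝒢.grp I).N → ℝ := fun q key s t =>
    ind (realWon ℋ A r (Coins.realPP g g₃ ℋ (realS₀ A κ L r) key q)
      (Coins.realUPK g g₃ (realS₀ A κ L r) key q) t s.1 s.2)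
  have h1 := mean_rearrange F
  refine Eq.trans ?_ (h1.trans ?_)
  · rfl
  · rw [← equidist_pw g.2 g.mem]
    refine mean_congr fun t => mean_congr fun ω => ?_
    rw [← Coins.equidist_toReal (realS₀ A κ L r) g g₃]
    exact mean_congr fun c => congrArg ind (realWon_eq_won g g₃ hL c t (r, ω))

theorem toReal_realRun (r : Fin (A.coins.eval (κ + L)) → Bool) (pp : DBESS.PP ℋ κ L) :
    (realRun ℋ A r pp true).toReal =
      mean fun x : realS₀ A κ L r → ZMod pp.B.N × (Finset.Icc 1 L → pp.B.sub pp.B.p₃) =>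
      mean fun t : ZMod pp.B.N => mean fun s : (Fin κ → Bool) × Bool =>
        ind (realWon ℋ A r pp (fun j => (realKeys pp j.1 (x j)).2) t s.1 s.2) := by
  unfold realRun
  simp only [genKey_eq]
  rw [pmfPi_unif_map, PMF.bind_map, toReal_unif_bind]
  refine mean_congr fun x => ?_
  rw [Function.comp_apply, toReal_unif_bind]
  refine mean_congr fun t => ?_
  rw [toReal_unif_bind, mean_prod]
  refine mean_congr fun rk => ?_
  rw [toReal_unif_bind]
  exact mean_congr fun μ => toReal_pure _ _

/-- The real game is the game against the simulator on a challenge of the subgroup decision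
problem in the subgroup of order `p₁`. -/
theorem toReal_ssExp (ℋ : HashFamily 𝒢) (A : SSAdversary) (κ : ℕ) {L : ℕ} (hL : 1 ≤ L) :
    ((dbeSS ℋ).ssExp A κ L true).toReal =
      expect (𝒢.dist κ) fun I => sdValue ℋ A κ L I false := by
  rw [ssExp_eq]
  simp only [PMF.bind_bind]
  rw [PMF.bind_comm, toReal_bind]
  refine expect_congr fun I _ => ?_
  rw [toReal_unif_bind]
  simp only [setupOf, PMF.bind_bind, PMF.pure_bind, toReal_unif_bind, toReal_realRun]
  calc _ = mean fun r => mean fun g : (𝒢.grp I).Gens (𝒢.grp I).p₁ =>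
        mean fun g₃ : (𝒢.grp I).Gens (𝒢.grp I).p₃ => _ :=
        mean_congr fun r => mean_congr fun g => mean_congr fun g₃ => mean_realWon A κ g g₃ hL r
    _ = _ := ?_
  rw [mean_comm]
  refine mean_congr fun g => ?_
  rw [mean_comm]
  refine mean_congr fun g₃ => ?_
  rw [mean_comm]
  refine mean_congr fun X₁ => ?_
  simp only [Bool.false_eq_true, if_false, mean_const]
  rw [gameValue, mean_prod]

end RealView

/-! ### Sampling from random bits -/

section Table

open Data

theorem table_bound {K M : ℕ} (a b : Fin K) : (a : ℕ) * (K * M) + b * M + M ≤ K * K * M := by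
  have h1 : (a : ℕ) + 1 ≤ K := a.2
  have h2 : (b : ℕ) + 1 ≤ K := b.2
  calc (a : ℕ) * (K * M) + b * M + M = a * (K * M) + (b + 1) * M := by ring
    _ ≤ a * (K * M) + K * M := by gcongr
    _ = (a + 1) * (K * M) := by ring
    _ ≤ K * (K * M) := by gcongr
    _ = K * K * M := by ring

/-- The position of a bit in a table of `K × K` blocks of `M` bits. -/
def tablePos (K M : ℕ) (q : Fin K × Fin K × Fin M) : Fin (K * K * M) :=
  ⟨q.1 * (K * M) + q.2.1 * M + q.2.2, by
    have h := table_bound (M := M) q.1 q.2.1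
    have := q.2.2.2
    omega⟩

theorem tablePos_injective (K M : ℕ) : Function.Injective (tablePos K M) := by
  rintro ⟨a, b, i⟩ ⟨a', b', i'⟩ h
  have key : ∀ {x x' y y' n : ℕ}, y < n → y' < n → x * n + y = x' * n + y' → x = x' ∧ y = y' := by
    intro x x' y y' n hy hy' h
    have h1 : x = x' := by
      have := congrArg (· / n) h
      simp only [mul_comm _ n, Nat.mul_add_div (by omega : 0 < n), Nat.div_eq_of_lt hy,
        Nat.div_eq_of_lt hy', add_zero] at this
      exact this
    subst h1
    exact ⟨rfl, by omega⟩
  have h0 : (a : ℕ) * (K * M) + b * M + i = a' * (K * M) + b' * M + i' := congrArg Fin.val h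
  have h1 : ((a : ℕ) * K + b) * M + i = (a' * K + b') * M + i' := by linarith
  obtain ⟨h2, h3⟩ := key i.2 i'.2 h1
  obtain ⟨h4, h5⟩ := key b.2 b'.2 h2
  rw [Fin.ext h4, Fin.ext h5, Fin.ext h3]

theorem Tools.take_blockBits {K M k : ℕ} (r : Fin (K * K * M) → Bool) (a b : Fin K) (hk : k ≤ M) :
    (Tools.blockBits M (K * M) (List.ofFn r) a b).take k =
      List.ofFn fun i : Fin k => r (tablePos K M (a, b, ⟨i, i.2.trans_le hk⟩)) := by
  refine List.ext_getElem ?_ fun n h1 h2 => ?_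
  · have h := table_bound (M := M) a b
    simp only [Tools.blockBits, List.length_take, List.length_drop, List.length_ofFn]
    omega
  · simp [Tools.blockBits, tablePos]

/-- The bits of the table that are used, apart from those for the exponents. -/
inductive SeedIdx (c k κ M : ℕ) : Type
  | r (i : Fin c)
  | key (i : Fin k)
  | rk (i : Fin κ)
  | μ
  | m (i : Fin M)

/-- The position in the table of a bit that is used. -/
def usedPos {c k κ M L K : ℕ} (hK : 2 * L + 8 ≤ K) (hM : 1 ≤ M) (hc : c ≤ M) (hk : k ≤ M)
    (hκ : κ ≤ M) : SeedIdx c k κ M ⊕ CoinIdx L × Fin M → Fin K × Fin K × Fin M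
  | .inl (.r i) => (⟨0, by omega⟩, ⟨0, by omega⟩, ⟨i, by omega⟩)
  | .inl (.key i) => (⟨0, by omega⟩, ⟨1, by omega⟩, ⟨i, by omega⟩)
  | .inl (.rk i) => (⟨0, by omega⟩, ⟨2, by omega⟩, ⟨i, by omega⟩)
  | .inl .μ => (⟨0, by omega⟩, ⟨3, by omega⟩, ⟨0, by omega⟩)
  | .inl (.m i) => (⟨0, by omega⟩, ⟨4, by omega⟩, i)
  | .inr (q, i) => (⟨q.cell.1, q.cell_lt.2.1.trans_le hK⟩, ⟨q.cell.2, q.cell_lt.2.2.trans_le hK⟩, i)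

theorem usedPos_injective {c k κ M L K : ℕ} (hK : 2 * L + 8 ≤ K) (hM : 1 ≤ M) (hc : c ≤ M)
    (hk : k ≤ M) (hκ : κ ≤ M) : Function.Injective (usedPos (L := L) hK hM hc hk hκ) := by
  have h0 : ∀ q : CoinIdx L, q.cell.1 ≠ 0 := fun q => q.cell_lt.1
  rintro (_ | _) (_ | _) h
  · rename_i i j
    cases i <;> cases j <;>
      simp only [usedPos, Prod.mk.injEq, Fin.mk.injEq] at h <;>
      first
      | rfl
      | (exfalso; omega)
      | (congr 2; first | exact Fin.ext h.2.2 | exact h.2.2)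
  · rename_i i q
    cases i <;> simp only [usedPos, Prod.mk.injEq, Fin.mk.injEq] at h <;>
      exact absurd h.1.symm (h0 q.1)
  · rename_i q i
    cases i <;> simp only [usedPos, Prod.mk.injEq, Fin.mk.injEq] at h <;>
      exact absurd h.1 (h0 q.1)
  · rename_i q q'
    obtain ⟨q, i⟩ := q
    obtain ⟨q', i'⟩ := q'
    simp only [usedPos, Prod.mk.injEq, Fin.mk.injEq] at h
    have h1 : q = q' := CoinIdx.cell_injective (Prod.ext h.1 h.2.1)
    rw [h1, h.2.2]

instance (c k κ M : ℕ) : Finite (SeedIdx c k κ M) :=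
  Finite.of_surjective (fun i : Fin c ⊕ Fin k ⊕ Fin κ ⊕ Unit ⊕ Fin M =>
    (Sum.elim .r (Sum.elim .key (Sum.elim .rk (Sum.elim (fun _ => .μ) .m))) i :
      SeedIdx c k κ M)) fun j => by
    cases j with
    | r i => exact ⟨.inl i, rfl⟩
    | key i => exact ⟨.inr (.inl i), rfl⟩
    | rk i => exact ⟨.inr (.inr (.inl i)), rfl⟩
    | μ => exact ⟨.inr (.inr (.inr (.inl ()))), rfl⟩
    | m i => exact ⟨.inr (.inr (.inr (.inr i))), rfl⟩

/-- The table of random bits, cut into the parts that are used. -/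
def tableParts {c k κ M L K : ℕ} (hK : 2 * L + 8 ≤ K) (hM : 1 ≤ M) (hc : c ≤ M) (hk : k ≤ M)
    (hκ : κ ≤ M) (r : Fin (K * K * M) → Bool) :
    ((Fin c → Bool) × (Fin k → Bool) × (Fin κ → Bool) × Bool) ×
      (Fin M → Bool) × (CoinIdx L → Fin M → Bool) :=
  let f := fun q => r (tablePos K M (usedPos (L := L) hK hM hc hk hκ q))
  ((fun i => f (.inl (.r i)), fun i => f (.inl (.key i)), fun i => f (.inl (.rk i)), f (.inl .μ)),
    fun i => f (.inl (.m i)), fun q i => f (.inr (q, i)))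

theorem equidist_tableParts {c k κ M L K : ℕ} (hK : 2 * L + 8 ≤ K) (hM : 1 ≤ M) (hc : c ≤ M)
    (hk : k ≤ M) (hκ : κ ≤ M) : Equidist (tableParts (L := L) hK hM hc hk hκ) := by
  let split : (SeedIdx c k κ M ⊕ CoinIdx L × Fin M → Bool) →
      ((Fin c → Bool) × (Fin k → Bool) × (Fin κ → Bool) × Bool) ×
        (Fin M → Bool) × (CoinIdx L → Fin M → Bool) := fun f =>
    ((fun i => f (.inl (.r i)), fun i => f (.inl (.key i)), fun i => f (.inl (.rk i)),
      f (.inl .μ)), fun i => f (.inl (.m i)), fun q i => f (.inr (q, i)))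
  have hsplit : Function.Bijective split := by
    refine Function.bijective_iff_has_inverse.2 ⟨fun p => Sum.elim (fun
      | .r i => p.1.1 i
      | .key i => p.1.2.1 i
      | .rk i => p.1.2.2.1 i
      | .μ => p.1.2.2.2
      | .m i => p.2.1 i) fun q => p.2.2 q.1 q.2, fun f => ?_, fun p => rfl⟩
    funext q
    rcases q with (_ | _ | _ | _ | _) | ⟨_, _⟩ <;> rfl
  exact (Equidist.of_bijective hsplit).comp (Equidist.comp_injective
    ((tablePos_injective K M).comp (usedPos_injective hK hM hc hk hκ)))

variable {B : BilinearGroup}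

/-- The exponents and the number of masks, computed from random bits. -/
def readParts (B : BilinearGroup) (L n : ℕ) {X : Type} {M : ℕ}
    (q : X × (Fin M → Bool) × (CoinIdx L → Fin M → Bool)) : X × ZMod n × Coins B L :=
  (q.1, (natOfBits (List.ofFn q.2.1) : ZMod n),
    fun i => (natOfBits (List.ofFn (q.2.2 i)) : ZMod B.N))

theorem CoinIdx.card_le (L : ℕ) [Fintype (CoinIdx L)] :
    Fintype.card (CoinIdx L) ≤ (2 * L + 8) * (2 * L + 8) := by
  have := Fintype.card_le_of_injective
    (fun i : CoinIdx L => ((⟨i.cell.1, i.cell_lt.2.1⟩, ⟨i.cell.2, i.cell_lt.2.2⟩) :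
      Fin (2 * L + 8) × Fin (2 * L + 8)))
    fun i j h => CoinIdx.cell_injective (by simpa [Prod.ext_iff] using h)
  simpa using this

theorem nearUniform_readParts (L n : ℕ) [NeZero n] {X : Type} [Finite X] [Nonempty X] (M : ℕ) :
    NearUniform (readParts B L n (X := X) (M := M))
      ((n + (2 * L + 8) ^ 2 * B.N) / 2 ^ M) := by
  have := Fintype.ofFinite (CoinIdx L)
  have h := (Equidist.id (α := X)).nearUniform.prodMap
    ((NearUniform.natOfBits M n).prodMap ((NearUniform.natOfBits M B.N).pi (ι := CoinIdx L)))
  refine NearUniform.mono h ?_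
  have hc : (Fintype.card (CoinIdx L) : ℝ) ≤ (2 * L + 8) * (2 * L + 8) := by
    exact_mod_cast CoinIdx.card_le L
  rw [zero_add, add_div, mul_div_assoc, sq]
  gcongr

end Table

/-! ### The simulator plays the games -/

section Simulation

open Data BilinearGroup

variable {𝒢 : GroupGenerator} {ℋ : HashFamily 𝒢} {L : ℕ → ℕ} (T : Tools ℋ L) (A : SSAdversary)
variable {κ K M : ℕ} {I : 𝒢.Inst} (hK : 2 * L κ + 8 ≤ K) (hM : 1 ≤ M)
variable (hc : A.coins.eval (κ + L κ) ≤ M) (hk : ℋ.keyLen κ I ≤ M) (hκ : κ ≤ M)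
variable (r : Fin (K * K * M) → Bool)

/-- The random exponents that the simulator reads from its random bits. -/
def readCoins (B : BilinearGroup) : Coins B (L κ) := fun i =>
  (natOfBits (List.ofFn ((tableParts (c := A.coins.eval (κ + L κ)) (k := ℋ.keyLen κ I)
    hK hM hc hk hκ r).2.2 i)) : ZMod B.N)

theorem readCoins_eq (B : BilinearGroup) (i : CoinIdx (L κ)) :
    readCoins A hK hM hc hk hκ r B i =
      (Tools.exponents M (K * M) (List.ofFn r) i.cell.1 i.cell.2 : ZMod B.N) := by
  have h := Tools.take_blockBits r ⟨i.cell.1, i.cell_lt.2.1.trans_le hK⟩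
    ⟨i.cell.2, i.cell_lt.2.2.trans_le hK⟩ le_rfl
  rw [Tools.exponents, readCoins]
  congr 2
  refine h.symm.trans (List.take_of_length_le ?_)
  rw [Tools.blockBits, List.length_take]
  exact min_le_left _ _

theorem readCoins_ext (B : BilinearGroup) (f : Fin (2 * L κ + 2) → CoinIdx (L κ)) (a k : ℕ)
    (hf : ∀ i, (f i).cell = (a, i.1)) (hk' : k < 2 * L κ + 2) :
    Coins.ext (fun i => readCoins A hK hM hc hk hκ r B (f i)) k =
      (Tools.exponents M (K * M) (List.ofFn r) a k : ZMod B.N) := by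
  rw [Coins.ext, dif_pos hk', readCoins_eq, hf]

theorem BilinearGroup.pw_mask {B : BilinearGroup} {L : ℕ} (D : B.G) (c : Coins B L) (m k : ℕ) :
    B.pw D (c.mask m k) =
      ((List.range m).map fun l => B.pw D (c.ρ l * c.a l ^ k)).prod := by
  have : c.mask m k = ((List.range m).map fun l => c.ρ l * c.a l ^ k).sum := rfl
  rw [this, pw_list_sum, List.map_map]
  rfl

/-- The parameters `U_k` of the simulator, in terms of the exponents that it reads. -/
theorem simView_U {m : ℕ} (hm : m ≤ 2 * L κ) (g g₃ C₁ D Z : (𝒢.grp I).G) {k : ℕ}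
    (hkL : k < 2 * L κ + 2) :
    (Tools.envView L κ M (K * M) (List.ofFn r) I g g₃ C₁ D Z m).U k =
      simP 𝒢 I D Z m (readCoins A hK hM hc hk hκ r (𝒢.grp I)) k *
        (𝒢.grp I).pw g₃ ((readCoins A hK hM hc hk hκ r (𝒢.grp I)).y k) := by
  have hα : (readCoins A hK hM hc hk hκ r (𝒢.grp I)).α =
      (Tools.exponents M (K * M) (List.ofFn r) 1 0 : ZMod (𝒢.grp I).N) := readCoins_eq ..
  rw [simP, pw_mask, hα, Coins.y, readCoins_ext A hK hM hc hk hκ r _ _ 2 _ (fun _ => rfl) hkL,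
    ← Nat.cast_pow, pw_natCast, pw_natCast]
  have hl : (List.range m).map (fun l => (𝒢.grp I).pw D
      ((readCoins A hK hM hc hk hκ r (𝒢.grp I)).ρ l *
        (readCoins A hK hM hc hk hκ r (𝒢.grp I)).a l ^ k)) =
      (List.range m).map fun l => (D ^ Tools.exponents M (K * M) (List.ofFn r) 4 l) ^
        Tools.exponents M (K * M) (List.ofFn r) 5 l ^ k := by
    refine List.map_congr_left fun l hl => ?_
    rw [List.mem_range] at hl
    rw [Coins.ρ, Coins.a, readCoins_ext A hK hM hc hk hκ r _ _ 4 _ (fun _ => rfl) (by omega),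
      readCoins_ext A hK hM hc hk hκ r _ _ 5 _ (fun _ => rfl) (by omega),
      ← Nat.cast_pow, ← Nat.cast_mul, pw_natCast, pow_mul]
  rw [hl]
  rfl

theorem agree_envView {m : ℕ} (hm : m ≤ 2 * L κ) (g g₃ C₁ D Z : (𝒢.grp I).G) :
    (Tools.envView L κ M (K * M) (List.ofFn r) I g g₃ C₁ D Z m).Agree (L κ)
      ((readCoins A hK hM hc hk hκ r (𝒢.grp I)).view g g₃ C₁
        (simP 𝒢 I D Z m (readCoins A hK hM hc hk hκ r (𝒢.grp I)))) := by
  have hα : (readCoins A hK hM hc hk hκ r (𝒢.grp I)).α =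
      (Tools.exponents M (K * M) (List.ofFn r) 1 0 : ZMod (𝒢.grp I).N) := readCoins_eq ..
  have hγ : ∀ x : (𝒢.grp I).G, ∀ j ∈ Finset.Icc 1 (L κ),
      (𝒢.grp I).pw x ((readCoins A hK hM hc hk hκ r (𝒢.grp I)).γ j) =
        x ^ Tools.exponents M (K * M) (List.ofFn r) 3 j := by
    intro x j hj
    rw [Finset.mem_Icc] at hj
    rw [Coins.γ, readCoins_ext A hK hM hc hk hκ r _ _ 3 _ (fun _ => rfl) (by omega), pw_natCast]
  have hA : ∀ k, g ^ Tools.exponents M (K * M) (List.ofFn r) 1 0 ^ k =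
      (𝒢.grp I).pw g ((readCoins A hK hM hc hk hκ r (𝒢.grp I)).α ^ k) := by
    intro k
    rw [hα, ← Nat.cast_pow, pw_natCast]
  have hU := fun k hk' => simView_U A hK hM hc hk hκ r hm g g₃ C₁ D Z (k := k) hk'
  refine ⟨rfl, rfl, fun k _ => hA k, fun k hk' _ => hU k ?_, ?_, fun j hj => ?_,
    fun j hj k hk' _ => ?_, rfl, fun S hS => ?_⟩
  · rw [Finset.mem_Icc] at hk'
    omega
  · exact congrArg ((𝒢.grp I).e g) (hU _ (by omega))
  · refine congrArg₂ (· * ·) (hγ g j hj).symm (congrArg _ (hA j))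
  · have hj' := Finset.mem_Icc.1 hj
    rw [Finset.mem_Icc] at hk'
    have hw : (𝒢.grp I).pw g₃ ((readCoins A hK hM hc hk hκ r (𝒢.grp I)).w j k) =
        g₃ ^ Tools.exponents M (K * M) (List.ofFn r) (6 + j) k := by
      rw [Coins.w, Coins.ext, dif_pos (by omega),
        readCoins_ext A hK hM hc hk hκ r _ _ (6 + j) _ (fun _ => rfl) (by omega), pw_natCast]
    refine congrArg₂ (· * ·) (congrArg₂ (· * ·) ?_ (congrArg _ (hU _ (by omega)))) hw.symm
    refine (hγ _ j hj).symm.trans (congrArg (fun x => (𝒢.grp I).pw x _) (hU _ (by omega)))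
  · refine Eq.trans ?_ (pw_list_sum _ _).symm
    rw [List.map_map]
    exact congrArg List.prod (List.map_congr_left fun j hj => (hγ C₁ j (hS j hj)).symm)

/-- The simulator wins if the adversary does, with the view and the seeds that the random bits
of the simulator determine. -/
theorem sim_eq_won {m : ℕ} (hm : m ≤ 2 * L κ) (g g₃ C₁ D Z : (𝒢.grp I).G) :
    (T.sim A (Tools.simEnv L κ M (K * M) (List.ofFn r) I g g₃ C₁ D Z m)).toBool =
      won (L := L κ) ℋ A κ (tableParts (L := L κ) hK hM hc hk hκ r).1
        ((readCoins A hK hM hc hk hκ r (𝒢.grp I)).view g g₃ C₁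
          (simP 𝒢 I D Z m (readCoins A hK hM hc hk hκ r (𝒢.grp I))))
        ((𝒢.grp I).e C₁ (simP 𝒢 I D Z m (readCoins A hK hM hc hk hκ r (𝒢.grp I)) (L κ + 1) *
          (𝒢.grp I).pw g₃ ((readCoins A hK hM hc hk hκ r (𝒢.grp I)).y (L κ + 1)))) := by
  have h0 := Tools.take_blockBits r ⟨0, by omega⟩ ⟨0, by omega⟩ hc
  have h1 := Tools.take_blockBits r ⟨0, by omega⟩ ⟨1, by omega⟩ hk
  have h2 := Tools.take_blockBits r ⟨0, by omega⟩ ⟨2, by omega⟩ hκ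
  have h3 := Tools.take_blockBits r ⟨0, by omega⟩ ⟨3, by omega⟩ hM
  have h3' : (Tools.blockBits M (K * M) (List.ofFn r) 0 3).headD false =
      (tableParts (L := L κ) hK hM hc hk hκ r).1.2.2.2 := by
    have : (Tools.blockBits M (K * M) (List.ofFn r) 0 3).headD false =
        ((Tools.blockBits M (K * M) (List.ofFn r) 0 3).take 1).headD false := by
      cases Tools.blockBits M (K * M) (List.ofFn r) 0 3 <;> rfl
    rw [this, h3]
    rfl
  rw [T.sim_env A κ M (K * M) (List.ofFn r) I g g₃ C₁ D Z m
    (tableParts (L := L κ) (c := A.coins.eval (κ + L κ)) hK hM hc hk hκ r).1.2.1 h1.symm, h3']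
  rw [h0, h2, won, (agree_envView A hK hM hc hk hκ r hm g g₃ C₁ D Z).play,
    simView_U A hK hM hc hk hκ r hm g g₃ C₁ D Z (by omega)]
  rfl

end Simulation

/-! ### The attacks -/

section Attack

open Data BilinearGroup

variable {𝒢 : GroupGenerator} {ℋ : HashFamily 𝒢} {L : ℕ → ℕ} (T : Tools ℋ L) (A : SSAdversary)

/-- A function `F` of the random bits of the simulator that depends on them only through the seeds
and exponents read from them has nearly the same average as the game with uniform exponents. -/
theorem abs_mean_won_sub_le {κ K M : ℕ} {I : 𝒢.Inst} (hK : 2 * L κ + 8 ≤ K) (hM : 1 ≤ M)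
    (hc : A.coins.eval (κ + L κ) ≤ M) (hk : ℋ.keyLen κ I ≤ M) (hκ : κ ≤ M) (n : ℕ) [NeZero n]
    (g g₃ C₁ : (𝒢.grp I).G) (P : ZMod n → Coins (𝒢.grp I) (L κ) → ℕ → (𝒢.grp I).G)
    (F : (Fin (K * K * M) → Bool) → ℝ)
    (hF : ∀ r (m : ZMod n) (c : Coins (𝒢.grp I) (L κ)),
      m = (natOfBits (List.ofFn (tableParts (L := L κ) (c := A.coins.eval (κ + L κ))
        (k := ℋ.keyLen κ I) hK hM hc hk hκ r).2.1) : ZMod n) →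
      c = readCoins A hK hM hc hk hκ r (𝒢.grp I) →
      F r = ind (won ℋ A κ (tableParts (L := L κ) hK hM hc hk hκ r).1 (c.view g g₃ C₁ (P m c))
        ((𝒢.grp I).e C₁ (P m c (L κ + 1) * (𝒢.grp I).pw g₃ (c.y (L κ + 1)))))) :
    |mean F - mean fun m => gameValue ℋ A κ (L κ) g g₃ C₁ (P m)| ≤
      (n + (2 * L κ + 8) ^ 2 * (𝒢.grp I).N) / 2 ^ M := by
  obtain ⟨f, hf⟩ : ∃ f : Seeds ℋ A κ (L κ) I × ZMod n × Coins (𝒢.grp I) (L κ) → ℝ, ∀ ω m c,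
      f (ω, m, c) = ind (won ℋ A κ ω (c.view g g₃ C₁ (P m c))
        ((𝒢.grp I).e C₁ (P m c (L κ + 1) * (𝒢.grp I).pw g₃ (c.y (L κ + 1))))) :=
    ⟨fun q => ind (won ℋ A κ q.1 (q.2.2.view g g₃ C₁ (P q.2.1 q.2.2))
      ((𝒢.grp I).e C₁ (P q.2.1 q.2.2 (L κ + 1) * (𝒢.grp I).pw g₃ (q.2.2.y (L κ + 1))))),
      fun _ _ _ => rfl⟩
  have h := (nearUniform_readParts (B := 𝒢.grp I) (L κ) n (X := Seeds ℋ A κ (L κ) I) M).comp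
    (equidist_tableParts (L := L κ) hK hM hc hk hκ).nearUniform f
    fun q => by rw [hf]; exact ⟨ind_nonneg _, ind_le_one _⟩
  rw [add_zero] at h
  have h1 : mean F = mean fun r => f (readParts (𝒢.grp I) (L κ) n
      (tableParts (L := L κ) hK hM hc hk hκ r)) :=
    mean_congr fun r => (hF r _ _ rfl rfl).trans (hf _ _ _).symm
  have h2 : (mean fun m => gameValue ℋ A κ (L κ) g g₃ C₁ (P m)) = mean f := by
    rw [mean_prod f]
    unfold gameValue
    rw [mean_comm]
    refine mean_congr fun ω => ?_
    rw [mean_prod]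
    exact mean_congr fun m => mean_congr fun c => (hf _ _ _).symm
  rw [h1, h2]
  exact h

theorem mean_ofFn_congr {n n' : ℕ} (h : n = n') (F : List Bool → ℝ) :
    (mean fun r : Fin n → Bool => F (List.ofFn r)) =
      mean fun r : Fin n' → Bool => F (List.ofFn r) := by
  subst h; rfl

theorem Distinguisher.toReal_output (D : Distinguisher) (κ : ℕ) (x : Data) :
    (D.output κ x true).toReal = mean fun r : Fin (D.coins.eval κ) → Bool =>
      ind (D.run (list [unary κ, bits (List.ofFn r), x])).toBool := by
  refine (toReal_unif_bind _ _).trans (mean_congr fun r => ?_)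
  exact toReal_pure _ _

variable {qK qM : Polynomial ℕ} {κ : ℕ} {I : 𝒢.Inst}

/-- The polynomials `qK` and `qM` are large enough for the table of random bits. -/
structure LargeEnough (ℋ : HashFamily 𝒢) (A : SSAdversary) (L : ℕ → ℕ) (qK qM : Polynomial ℕ)
    (κ : ℕ) (I : 𝒢.Inst) : Prop where
  users : 2 * L κ + 8 ≤ qK.eval κ
  pos : 1 ≤ qM.eval κ
  coins : A.coins.eval (κ + L κ) ≤ qM.eval κ
  key : ℋ.keyLen κ I ≤ qM.eval κ
  param : κ ≤ qM.eval κ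
  size : 2 * (𝒢.grp I).desc.size + 3 * qK.eval κ ≤ qM.eval κ

/-- A bound on the statistical distance of the randomness of the simulator from uniform: there are
at most `(2 L + 8) ^ 2` exponents modulo `N`, besides the number of masks modulo `2 L`. -/
noncomputable def simError (L : ℕ → ℕ) (qM : Polynomial ℕ) (κ : ℕ) (I : 𝒢.Inst) : ℝ :=
  (2 * L κ + (2 * L κ + 8) ^ 2 * (𝒢.grp I).N) / 2 ^ qM.eval κ

theorem abs_attackSD_sub_le (hL : 1 ≤ L κ) (h : LargeEnough ℋ A L qK qM κ I)
    (g g₃ Z : (𝒢.grp I).G) :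
    |((T.attackSD A qK qM).output κ (list [(𝒢.grp I).desc, (𝒢.grp I).enc g, (𝒢.grp I).enc g₃,
        (𝒢.grp I).enc Z]) true).toReal -
      gameValue ℋ A κ (L κ) g g₃ Z fun c => simP 𝒢 I g ((𝒢.grp I).pw g c.x) 0 c| ≤
    simError L qM κ I := by
  have : NeZero (2 * L κ) := ⟨by omega⟩
  have hn : (T.attackSD A qK qM).coins.eval κ = qK.eval κ * qK.eval κ * qM.eval κ := by
    simp [Tools.attackSD]
  have h0 := (Distinguisher.toReal_output _ _ _).trans (mean_ofFn_congr hn fun l =>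
    ind ((T.attackSD A qK qM).run (list [unary κ, bits l, list [(𝒢.grp I).desc,
      (𝒢.grp I).enc g, (𝒢.grp I).enc g₃, (𝒢.grp I).enc Z]])).toBool)
  rw [h0, simError]
  have h1 := abs_mean_won_sub_le A h.users h.pos h.coins h.key h.param (2 * L κ) g g₃ Z
    (fun _ c => simP 𝒢 I g ((𝒢.grp I).pw g c.x) 0 c) _ fun r m c _ hc => by
    have hx : g ^ Tools.exponents (qM.eval κ) ((qK * qM).eval κ) (List.ofFn r) 1 1 =
        (𝒢.grp I).pw g c.x := by
      rw [hc, Coins.x, readCoins_eq, pw_natCast, Polynomial.eval_mul]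
      rfl
    have h2 := sim_eq_won T A h.users h.pos h.coins h.key h.param r (Nat.zero_le _) g g₃ Z g
      ((𝒢.grp I).pw g c.x)
    rw [← hc, ← hx, ← Polynomial.eval_mul, ← T.envSD_eq, hx] at h2
    exact congrArg ind h2
  rw [mean_const] at h1
  push_cast at h1
  exact h1

theorem abs_attackGSD_sub_le (hL : 1 ≤ L κ) [NeZero (2 * L κ)] (h : LargeEnough ℋ A L qK qM κ I)
    (g g₃ C₁ D Z : (𝒢.grp I).G) :
    |((T.attackGSD A qK qM).output κ (list [(𝒢.grp I).desc, (𝒢.grp I).enc g, (𝒢.grp I).enc g₃,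
        (𝒢.grp I).enc C₁, (𝒢.grp I).enc D, (𝒢.grp I).enc Z]) true).toReal -
      mean fun m : ZMod (2 * L κ) => gameValue ℋ A κ (L κ) g g₃ C₁ (simP 𝒢 I D Z m.val)| ≤
    simError L qM κ I := by
  have hn : (T.attackGSD A qK qM).coins.eval κ = qK.eval κ * qK.eval κ * qM.eval κ := by
    simp [Tools.attackGSD]
  have h0 := (Distinguisher.toReal_output _ _ _).trans (mean_ofFn_congr hn fun l =>
    ind ((T.attackGSD A qK qM).run (list [unary κ, bits l, list [(𝒢.grp I).desc,
      (𝒢.grp I).enc g, (𝒢.grp I).enc g₃, (𝒢.grp I).enc C₁, (𝒢.grp I).enc D,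
      (𝒢.grp I).enc Z]])).toBool)
  rw [h0, simError]
  have h1 := abs_mean_won_sub_le A h.users h.pos h.coins h.key h.param (2 * L κ) g g₃ C₁
    (fun m => simP 𝒢 I D Z m.val)
    (fun r => ind ((T.attackGSD A qK qM).run (list [unary κ, bits (List.ofFn r),
      list [(𝒢.grp I).desc, (𝒢.grp I).enc g, (𝒢.grp I).enc g₃, (𝒢.grp I).enc C₁,
        (𝒢.grp I).enc D, (𝒢.grp I).enc Z]])).toBool) fun r m c hm hc => by
    have hb := Tools.take_blockBits r ⟨0, by have := h.users; omega⟩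
      ⟨4, by have := h.users; omega⟩ le_rfl
    have hm' : Tools.exponents (qM.eval κ) (qK.eval κ * qM.eval κ) (List.ofFn r) 0 4 %
        (2 * L κ) = m.val := by
      rw [hm, ZMod.val_natCast, Tools.exponents]
      congr 2
      refine Eq.trans (List.take_of_length_le ?_).symm hb
      rw [Tools.blockBits, List.length_take]
      exact min_le_left _ _
    have h2 := sim_eq_won T A h.users h.pos h.coins h.key h.param r (ZMod.val_lt m).le g g₃ C₁ D Z
    rw [← hc] at h2
    refine congrArg ind (Eq.trans ?_ h2)
    change (T.sim A (T.envGSD qK qM _)).toBool = _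
    rw [T.envGSD_eq (hL := hL), Polynomial.eval_mul, hm']
  push_cast at h1
  exact h1

theorem BilinearGroup.N_le (B : BilinearGroup) : B.N ≤ 2 ^ B.desc.size := by
  refine (Nat.lt_size_self B.N).le.trans (Nat.pow_le_pow_right two_pos ?_)
  have h := size_le_of_mem (x := bits B.N.bits)
    (l := [bits B.N.bits, B.params, B.enc B.gen, B.encT B.genT]) List.mem_cons_self
  have h2 := len_le_size (bits B.N.bits)
  rw [len_bits, Nat.size_eq_bits_len] at h2
  exact h2.trans h

theorem simError_le (h : LargeEnough ℋ A L qK qM κ I) :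
    simError L qM κ I ≤ 2 / ((2 * L κ + 8) * (𝒢.grp I).p₂) := by
  have hp : (1 : ℝ) ≤ (𝒢.grp I).p₂ := by exact_mod_cast (𝒢.grp I).prime₂.one_lt.le
  have hpN : ((𝒢.grp I).p₂ : ℝ) ≤ (𝒢.grp I).N := by
    exact_mod_cast Nat.le_of_dvd (Nat.pos_of_neZero _) dvd₂
  have hN : ((𝒢.grp I).N : ℝ) ≤ 2 ^ (𝒢.grp I).desc.size := by
    exact_mod_cast (𝒢.grp I).N_le
  have hK : (2 * L κ + 8 : ℝ) ≤ 2 ^ qK.eval κ := by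
    exact_mod_cast h.users.trans Nat.lt_two_pow_self.le
  have hl : (0 : ℝ) ≤ L κ := Nat.cast_nonneg _
  obtain ⟨l, hl'⟩ : ∃ l : ℝ, l = 2 * L κ + 8 := ⟨_, rfl⟩
  have hM : l ^ 3 * ((𝒢.grp I).N : ℝ) ^ 2 ≤ 2 ^ qM.eval κ := by
    calc l ^ 3 * ((𝒢.grp I).N : ℝ) ^ 2
        ≤ (2 ^ qK.eval κ) ^ 3 * (2 ^ (𝒢.grp I).desc.size) ^ 2 := by
          rw [hl']; gcongr
      _ = 2 ^ (2 * (𝒢.grp I).desc.size + 3 * qK.eval κ) := by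
          rw [← pow_mul, ← pow_mul, ← pow_add]; congr 1; ring
      _ ≤ 2 ^ qM.eval κ := pow_le_pow_right₀ (by norm_num) h.size
  have hl8 : 8 ≤ l := by linarith
  rw [simError, ← hl', div_le_div_iff₀ (by positivity) (by positivity)]
  have h1 : 2 * (L κ : ℝ) ≤ l ^ 2 * (𝒢.grp I).N := by nlinarith
  calc (2 * L κ + l ^ 2 * ((𝒢.grp I).N : ℝ)) * (l * (𝒢.grp I).p₂)
      ≤ (l ^ 2 * (𝒢.grp I).N + l ^ 2 * ((𝒢.grp I).N : ℝ)) * (l * (𝒢.grp I).N) := by gcongr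
    _ = 2 * (l ^ 3 * ((𝒢.grp I).N : ℝ) ^ 2) := by ring
    _ ≤ 2 * 2 ^ qM.eval κ := by gcongr

/-- An efficiently computable number of users is polynomially bounded. -/
theorem EfficientCount.exists_le (hL : EfficientCount L) :
    ∃ q : Polynomial ℕ, ∀ κ, L κ ≤ q.eval κ := by
  obtain ⟨f, hf, hfL⟩ := hL
  obtain ⟨qf, hqf⟩ := hf.size_le
  refine ⟨qf.comp (2 * .X + 1), fun κ => ?_⟩
  have h1 := hqf (unary κ)
  rw [hfL, size_unary, size_unary] at h1
  simp only [Polynomial.eval_comp, Polynomial.eval_add, Polynomial.eval_mul,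
    Polynomial.eval_ofNat, Polynomial.eval_X, Polynomial.eval_one]
  omega

/-- Polynomials that are large enough exist. -/
theorem exists_largeEnough (ℋ : HashFamily 𝒢) (hL : EfficientCount L) :
    ∃ qK qM : Polynomial ℕ, ∀ κ, ∀ I ∈ (𝒢.dist κ).support, LargeEnough ℋ A L qK qM κ I := by
  obtain ⟨qL, hqL⟩ := hL.exists_le
  obtain ⟨qd, hqd⟩ := 𝒢.desc_size
  obtain ⟨fk, -, ⟨qk, hqk⟩, hfk⟩ := ℋ.keyLen_eff
  let qK : Polynomial ℕ := 2 * qL + 8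
  let qk' : Polynomial ℕ := qk.comp (2 * .X + qd + 10)
  refine ⟨qK, 1 + A.coins.comp (.X + qL) + qk' + .X + 2 * qd + 3 * qK, fun κ I hI => ?_⟩
  have hd := hqd κ I hI
  have hk : ℋ.keyLen κ I ≤ qk'.eval κ := by
    have h1 := hqk (list [unary κ, (𝒢.grp I).desc]) .nil
    rw [hfk (κ, I), size_unary] at h1
    have h2 : (list [unary κ, (𝒢.grp I).desc]).size ≤ 2 * κ + qd.eval κ + 10 := by
      simp only [list, List.foldr_cons, List.foldr_nil, size, size_unary]
      omega
    have h3 := qk.eval_mono_nat h2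
    have h4 : (ℋ.keyLen (κ, I).1 (κ, I).2) = ℋ.keyLen κ I := rfl
    simp only [qk', Polynomial.eval_comp, Polynomial.eval_add, Polynomial.eval_mul,
      Polynomial.eval_ofNat, Polynomial.eval_X]
    omega
  have hc : A.coins.eval (κ + L κ) ≤ (A.coins.comp (.X + qL)).eval κ := by
    rw [Polynomial.eval_comp, Polynomial.eval_add, Polynomial.eval_X]
    exact A.coins.eval_mono_nat (by have := hqL κ; omega)
  have hLK := hqL κ
  constructor <;> simp only [qK, Polynomial.eval_add, Polynomial.eval_mul, Polynomial.eval_ofNat,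
    Polynomial.eval_X, Polynomial.eval_one] <;> omega

end Attack

/-! ### The bound on the advantage -/

section Advantage

open Data BilinearGroup

theorem mean_zmod_val (n : ℕ) [NeZero n] (f : ℕ → ℝ) :
    (mean fun m : ZMod n => f m.val) = (∑ m ∈ Finset.range n, f m) / n := by
  rw [mean_eq_sum, ZMod.card]
  congr 1
  exact Finset.sum_nbij ZMod.val (fun m _ => Finset.mem_range.2 (ZMod.val_lt m))
    (fun _ _ _ _ h => ZMod.val_injective n h)
    (fun k hk => ⟨k, Finset.mem_coe.2 (Finset.mem_univ _),
      ZMod.val_natCast_of_lt (Finset.mem_range.1 (Finset.mem_coe.1 hk))⟩) fun _ _ => rfl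

variable {𝒢 : GroupGenerator} {ℋ : HashFamily 𝒢} {L : ℕ → ℕ} (T : Tools ℋ L) (A : SSAdversary)
variable {qK qM : Polynomial ℕ} {κ : ℕ} {I : 𝒢.Inst}

theorem toReal_sdExp (D : Distinguisher) (κ : ℕ) (b : Bool) :
    (𝒢.sdExp D κ b true).toReal = expect (𝒢.dist κ) fun I =>
      mean fun g₁ : (𝒢.grp I).Gens (𝒢.grp I).p₁ => mean fun g₃ : (𝒢.grp I).Gens (𝒢.grp I).p₃ =>
      mean fun X₁ : (𝒢.grp I).sub (𝒢.grp I).p₁ => mean fun R₁ : (𝒢.grp I).sub (𝒢.grp I).p₂ =>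
        (D.output κ (list [(𝒢.grp I).desc, (𝒢.grp I).enc g₁.1, (𝒢.grp I).enc g₃.1,
          (𝒢.grp I).enc (if b then X₁.1 * R₁.1 else X₁.1)]) true).toReal :=
  (toReal_bind _ _ _).trans <| expect_congr fun _ _ =>
    (toReal_unif_bind _ _).trans <| mean_congr fun _ =>
    (toReal_unif_bind _ _).trans <| mean_congr fun _ =>
    (toReal_unif_bind _ _).trans <| mean_congr fun _ => toReal_unif_bind _ _

theorem toReal_gsdExp (D : Distinguisher) (κ : ℕ) (b : Bool) :
    (𝒢.gsdExp D κ b true).toReal = expect (𝒢.dist κ) fun I =>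
      mean fun g₁ : (𝒢.grp I).Gens (𝒢.grp I).p₁ => mean fun g₃ : (𝒢.grp I).Gens (𝒢.grp I).p₃ =>
      mean fun X₁ : (𝒢.grp I).sub (𝒢.grp I).p₁ => mean fun X₂ : (𝒢.grp I).sub (𝒢.grp I).p₁ =>
      mean fun R₁ : (𝒢.grp I).sub (𝒢.grp I).p₂ => mean fun R₂ : (𝒢.grp I).sub (𝒢.grp I).p₂ =>
      mean fun R₃ : (𝒢.grp I).sub (𝒢.grp I).p₂ => mean fun Y₁ : (𝒢.grp I).sub (𝒢.grp I).p₃ =>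
      mean fun Y₂ : (𝒢.grp I).sub (𝒢.grp I).p₃ =>
        (D.output κ (list [(𝒢.grp I).desc, (𝒢.grp I).enc g₁.1, (𝒢.grp I).enc g₃.1,
          (𝒢.grp I).enc (X₁.1 * R₁.1), (𝒢.grp I).enc (R₂.1 * Y₁.1),
          (𝒢.grp I).enc (if b then X₂.1 * R₃.1 * Y₂.1 else X₂.1 * Y₂.1)]) true).toReal :=
  (toReal_bind _ _ _).trans <| expect_congr fun _ _ =>
    (toReal_unif_bind _ _).trans <| mean_congr fun _ =>
    (toReal_unif_bind _ _).trans <| mean_congr fun _ =>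
    (toReal_unif_bind _ _).trans <| mean_congr fun _ =>
    (toReal_unif_bind _ _).trans <| mean_congr fun _ =>
    (toReal_unif_bind _ _).trans <| mean_congr fun _ =>
    (toReal_unif_bind _ _).trans <| mean_congr fun _ =>
    (toReal_unif_bind _ _).trans <| mean_congr fun _ =>
    (toReal_unif_bind _ _).trans <| mean_congr fun _ => toReal_unif_bind _ _

theorem sdValue_mem (ℋ : HashFamily 𝒢) (A : SSAdversary) (κ L : ℕ) (I : 𝒢.Inst) (b : Bool) :
    0 ≤ sdValue ℋ A κ L I b ∧ sdValue ℋ A κ L I b ≤ 1 :=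
  ⟨mean_nonneg fun _ => mean_nonneg fun _ => mean_nonneg fun _ => mean_nonneg fun _ =>
    gameValue_nonneg _,
  mean_le_one fun _ => mean_le_one fun _ => mean_le_one fun _ => mean_le_one fun _ =>
    gameValue_le_one _⟩

theorem gsdValue_mem (ℋ : HashFamily 𝒢) (A : SSAdversary) (κ L : ℕ) (I : 𝒢.Inst) (b : Bool)
    (m : ℕ) : 0 ≤ gsdValue ℋ A κ L I b m ∧ gsdValue ℋ A κ L I b m ≤ 1 :=
  ⟨mean_nonneg fun _ => mean_nonneg fun _ => mean_nonneg fun _ => mean_nonneg fun _ =>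
    mean_nonneg fun _ => mean_nonneg fun _ => mean_nonneg fun _ => mean_nonneg fun _ =>
    mean_nonneg fun _ => gameValue_nonneg _,
  mean_le_one fun _ => mean_le_one fun _ => mean_le_one fun _ => mean_le_one fun _ =>
    mean_le_one fun _ => mean_le_one fun _ => mean_le_one fun _ => mean_le_one fun _ =>
    mean_le_one fun _ => gameValue_le_one _⟩

/-- The average of the games with a random number of masks. -/
noncomputable def gsdMean (ℋ : HashFamily 𝒢) (A : SSAdversary) (κ L : ℕ) (I : 𝒢.Inst) (b : Bool) :
    ℝ :=
  (∑ m ∈ Finset.range (2 * L), gsdValue ℋ A κ L I b m) / (2 * L)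

theorem expect_le_of_dist {α : Type} {p : PMF α} {f g ε : α → ℝ}
    (hf : ∃ C, ∀ a ∈ p.support, |f a| ≤ C) (hε : ∃ C, ∀ a ∈ p.support, |ε a| ≤ C)
    (hg : ∃ C, ∀ a ∈ p.support, |g a| ≤ C)
    (h : ∀ a ∈ p.support, |f a - g a| ≤ ε a) : |expect p f - expect p g| ≤ expect p ε := by
  rw [← expect_sub hf hg]
  exact abs_expect_le hε h

theorem bounded_of_mem {α : Type} {p : PMF α} {f : α → ℝ}
    (h : ∀ a, 0 ≤ f a ∧ f a ≤ 1) : ∃ C, ∀ a ∈ p.support, |f a| ≤ C :=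
  ⟨1, fun a _ => by rw [abs_of_nonneg (h a).1]; exact (h a).2⟩

theorem toReal_mem {p : PMF Bool} : 0 ≤ (p true).toReal ∧ (p true).toReal ≤ 1 :=
  ⟨ENNReal.toReal_nonneg,
    ENNReal.toReal_le_of_le_ofReal zero_le_one (by simpa using p.coe_le_one _)⟩

/-- A bound on the error of the simulation, small enough to remain of order `1 / p₂` when it is
multiplied by `2 L`. -/
noncomputable def simBound (L : ℕ → ℕ) (κ : ℕ) (I : 𝒢.Inst) : ℝ :=
  2 / ((2 * L κ + 8) * (𝒢.grp I).p₂)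

theorem bounded_simBound {p : PMF 𝒢.Inst} :
    ∃ C, ∀ I ∈ p.support, |simBound L κ I| ≤ C := by
  refine ⟨1, fun I _ => ?_⟩
  have hp : (1 : ℝ) ≤ (𝒢.grp I).p₂ := by exact_mod_cast (𝒢.grp I).prime₂.one_lt.le
  have hl : (0 : ℝ) ≤ L κ := Nat.cast_nonneg _
  rw [simBound, abs_of_nonneg (by positivity), div_le_one (by positivity)]
  nlinarith

theorem abs_sdExp_sub_le (hL : 1 ≤ L κ)
    (h : ∀ I ∈ (𝒢.dist κ).support, LargeEnough ℋ A L qK qM κ I) (b : Bool) :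
    |(𝒢.sdExp (T.attackSD A qK qM) κ b true).toReal -
      expect (𝒢.dist κ) (fun I => sdValue ℋ A κ (L κ) I b)| ≤
        expect (𝒢.dist κ) (simBound L κ) := by
  rw [toReal_sdExp]
  refine expect_le_of_dist (bounded_of_mem fun I => ?_) bounded_simBound
    (bounded_of_mem fun I => sdValue_mem ..) fun I hI => ?_
  · exact ⟨mean_nonneg fun _ => mean_nonneg fun _ => mean_nonneg fun _ => mean_nonneg fun _ =>
      toReal_mem.1, mean_le_one fun _ => mean_le_one fun _ => mean_le_one fun _ =>
      mean_le_one fun _ => toReal_mem.2⟩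
  · exact abs_mean_sub_mean_le_const fun g₁ => abs_mean_sub_mean_le_const fun g₃ =>
      abs_mean_sub_mean_le_const fun X₁ => abs_mean_sub_mean_le_const fun R₁ =>
      (abs_attackSD_sub_le T A hL (h I hI) _ _ _).trans (simError_le A (h I hI))

theorem mean_gsdValue {X : Type} [Finite X] (ℋ : HashFamily 𝒢) (A : SSAdversary) (κ L : ℕ)
    (I : 𝒢.Inst) (b : Bool) (v : X → ℕ) :
    (mean fun m : X => gsdValue ℋ A κ L I b (v m)) =
      mean fun g₁ : (𝒢.grp I).Gens (𝒢.grp I).p₁ => mean fun g₃ : (𝒢.grp I).Gens (𝒢.grp I).p₃ =>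
      mean fun X₁ : (𝒢.grp I).sub (𝒢.grp I).p₁ => mean fun X₂ : (𝒢.grp I).sub (𝒢.grp I).p₁ =>
      mean fun R₁ : (𝒢.grp I).sub (𝒢.grp I).p₂ => mean fun R₂ : (𝒢.grp I).sub (𝒢.grp I).p₂ =>
      mean fun R₃ : (𝒢.grp I).sub (𝒢.grp I).p₂ => mean fun Y₁ : (𝒢.grp I).sub (𝒢.grp I).p₃ =>
      mean fun Y₂ : (𝒢.grp I).sub (𝒢.grp I).p₃ => mean fun m =>
        gameValue ℋ A κ L g₁.1 g₃.1 (X₁.1 * R₁.1) (simP 𝒢 I (R₂.1 * Y₁.1)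
          (if b then X₂.1 * R₃.1 * Y₂.1 else X₂.1 * Y₂.1) (v m)) := by
  unfold gsdValue
  exact (mean_comm _).trans <| mean_congr fun _ => (mean_comm _).trans <| mean_congr fun _ =>
    (mean_comm _).trans <| mean_congr fun _ => (mean_comm _).trans <| mean_congr fun _ =>
    (mean_comm _).trans <| mean_congr fun _ => (mean_comm _).trans <| mean_congr fun _ =>
    (mean_comm _).trans <| mean_congr fun _ => (mean_comm _).trans <| mean_congr fun _ =>
    mean_comm _

theorem abs_gsdExp_sub_le (hL : 1 ≤ L κ)
    (h : ∀ I ∈ (𝒢.dist κ).support, LargeEnough ℋ A L qK qM κ I) (b : Bool) :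
    |(𝒢.gsdExp (T.attackGSD A qK qM) κ b true).toReal -
      expect (𝒢.dist κ) (fun I => gsdMean ℋ A κ (L κ) I b)| ≤
        expect (𝒢.dist κ) (simBound L κ) := by
  have hn : NeZero (2 * L κ) := ⟨by omega⟩
  have hm : ∀ I, gsdMean ℋ A κ (L κ) I b =
      mean fun m : ZMod (2 * L κ) => gsdValue ℋ A κ (L κ) I b m.val := by
    intro I
    rw [mean_zmod_val, gsdMean]
    push_cast
    rfl
  rw [toReal_gsdExp]
  refine expect_le_of_dist (bounded_of_mem fun I => ?_) bounded_simBound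
    (bounded_of_mem fun I => ?_) fun I hI => ?_
  · exact ⟨mean_nonneg fun _ => mean_nonneg fun _ => mean_nonneg fun _ => mean_nonneg fun _ =>
      mean_nonneg fun _ => mean_nonneg fun _ => mean_nonneg fun _ => mean_nonneg fun _ =>
      mean_nonneg fun _ => toReal_mem.1, mean_le_one fun _ => mean_le_one fun _ =>
      mean_le_one fun _ => mean_le_one fun _ => mean_le_one fun _ => mean_le_one fun _ =>
      mean_le_one fun _ => mean_le_one fun _ => mean_le_one fun _ => toReal_mem.2⟩
  · rw [hm]
    exact ⟨mean_nonneg fun _ => (gsdValue_mem ..).1, mean_le_one fun _ => (gsdValue_mem ..).2⟩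
  · rw [hm, mean_gsdValue]
    exact abs_mean_sub_mean_le_const fun g₁ => abs_mean_sub_mean_le_const fun g₃ =>
      abs_mean_sub_mean_le_const fun X₁ => abs_mean_sub_mean_le_const fun X₂ =>
      abs_mean_sub_mean_le_const fun R₁ => abs_mean_sub_mean_le_const fun R₂ =>
      abs_mean_sub_mean_le_const fun R₃ => abs_mean_sub_mean_le_const fun Y₁ =>
      abs_mean_sub_mean_le_const fun Y₂ =>
      (abs_attackGSD_sub_le T A hL (h I hI) _ _ _ _ _).trans (simError_le A (h I hI))

end Advantage

section Bound

variable {𝒢 : GroupGenerator} {ℋ : HashFamily 𝒢} {L : ℕ → ℕ}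

theorem one_le_p₂ (I : 𝒢.Inst) : (1 : ℝ) ≤ (𝒢.grp I).p₂ := by
  exact_mod_cast (𝒢.grp I).prime₂.one_lt.le

theorem bounded_bound {p : PMF 𝒢.Inst} (a b x : ℝ) (hx : 0 ≤ x) :
    ∃ C, ∀ I ∈ p.support, |a / ((𝒢.grp I).p₂ : ℝ) + b * √(x / (𝒢.grp I).p₂)| ≤ C := by
  refine ⟨|a| + |b| * √x, fun I _ => ?_⟩
  have hp := one_le_p₂ I
  refine (abs_add_le _ _).trans (add_le_add ?_ ?_)
  · rw [abs_div, Nat.abs_cast]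
    exact div_le_self (abs_nonneg _) hp
  · rw [abs_mul, abs_of_nonneg (Real.sqrt_nonneg _)]
    gcongr
    exact div_le_self hx hp

/-- The advantage against the scheme is bounded by those of the two attacks. -/
theorem advSS_le (hcount : EfficientCount L) (hL : ∀ κ, 1 ≤ L κ) (A : SSAdversary) :
    ∃ B₁ B₂ : Distinguisher, ∀ κ : ℕ,
      (dbeSS ℋ).advSS A κ (L κ) ≤
        𝒢.advSD B₁ κ + 2 * (L κ : ℝ) * 𝒢.advGSD B₂ κ +
          expect (𝒢.dist κ) (fun I => 11 * (L κ : ℝ) ^ 2 / ((𝒢.grp I).p₂ : ℝ) +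
            1 / 2 * Real.sqrt (2 ^ κ / ((𝒢.grp I).p₂ : ℝ))) := by
  obtain ⟨T⟩ := Tools.nonempty ℋ hcount
  obtain ⟨qK, qM, hq⟩ := exists_largeEnough (A := A) ℋ hcount
  refine ⟨T.attackSD A qK qM, T.attackGSD A qK qM, fun κ => ?_⟩
  have hl : (1 : ℝ) ≤ L κ := by exact_mod_cast hL κ
  have hl0 : (0 : ℝ) < 2 * L κ := by linarith
  have hS := fun b => abs_sdExp_sub_le T A (hL κ) (hq κ) b
  have hG := fun b => abs_gsdExp_sub_le T A (hL κ) (hq κ) b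
  have hbS : ∀ b, ∃ C, ∀ I ∈ (𝒢.dist κ).support, |sdValue ℋ A κ (L κ) I b| ≤ C :=
    fun b => bounded_of_mem fun I => sdValue_mem ..
  have hgm : ∀ b I, 0 ≤ gsdMean ℋ A κ (L κ) I b ∧ gsdMean ℋ A κ (L κ) I b ≤ 1 := by
    intro b I
    rw [gsdMean]
    refine ⟨div_nonneg (Finset.sum_nonneg fun _ _ => (gsdValue_mem ..).1) hl0.le,
      (div_le_one hl0).2 ?_⟩
    refine (Finset.sum_le_card_nsmul _ _ 1 fun m _ => (gsdValue_mem ..).2).trans (le_of_eq ?_)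
    simp
  have hbG : ∀ b, ∃ C, ∀ I ∈ (𝒢.dist κ).support, |gsdMean ℋ A κ (L κ) I b| ≤ C :=
    fun b => bounded_of_mem (hgm b)
  -- the hybrid argument, averaged over the group
  have hhyb : |(expect (𝒢.dist κ) (fun I => sdValue ℋ A κ (L κ) I true) - 1 / 2) -
      2 * L κ * (expect (𝒢.dist κ) (fun I => gsdMean ℋ A κ (L κ) I false) -
        expect (𝒢.dist κ) fun I => gsdMean ℋ A κ (L κ) I true)| ≤
      expect (𝒢.dist κ) fun I => (3 * (L κ : ℝ) + 2 * (L κ : ℝ) ^ 2 + 2) / (𝒢.grp I).p₂ +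
        1 / 4 * √(2 ^ κ / (𝒢.grp I).p₂) := by
    have h : ∀ I, sdValue ℋ A κ (L κ) I true - 1 / 2 -
        2 * L κ * (gsdMean ℋ A κ (L κ) I false - gsdMean ℋ A κ (L κ) I true) =
        (sdValue ℋ A κ (L κ) I true - 1 / 2) - ∑ m ∈ Finset.range (2 * L κ),
          (gsdValue ℋ A κ (L κ) I false m - gsdValue ℋ A κ (L κ) I true m) := by
      intro I
      rw [gsdMean, gsdMean, Finset.sum_sub_distrib]
      field_simp
    have hb₁ : ∃ C, ∀ I ∈ (𝒢.dist κ).support, |sdValue ℋ A κ (L κ) I true - 1 / 2| ≤ C :=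
      (hbS true).imp' (· + 1 / 2) fun C hC I hI =>
        (abs_sub _ _).trans (add_le_add (hC I hI) (by norm_num))
    have hb₂ : ∃ C, ∀ I ∈ (𝒢.dist κ).support,
        |gsdMean ℋ A κ (L κ) I false - gsdMean ℋ A κ (L κ) I true| ≤ C :=
      ⟨1, fun I _ => abs_sub_le_iff.2
        ⟨by linarith [(hgm false I).2, (hgm true I).1],
          by linarith [(hgm true I).2, (hgm false I).1]⟩⟩
    have hb₃ : ∃ C, ∀ I ∈ (𝒢.dist κ).support,
        |2 * L κ * (gsdMean ℋ A κ (L κ) I false - gsdMean ℋ A κ (L κ) I true)| ≤ C :=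
      hb₂.imp' (2 * (L κ : ℝ) * ·) fun C hC I hI => by
        rw [abs_mul, abs_of_pos hl0]
        exact mul_le_mul_of_nonneg_left (hC I hI) hl0.le
    rw [← expect_sub (hbG false) (hbG true), ← expect_mul_left,
      ← expect_const (p := 𝒢.dist κ) (1 / 2), ← expect_sub (hbS true) ⟨1 / 2, by norm_num⟩,
      ← expect_sub hb₁ hb₃]
    refine abs_expect_le (bounded_bound _ _ _ (by positivity)) fun I _ => ?_
    rw [h, add_comm]
    exact abs_sdValue_sub_half (hL κ)
  have hsum : (4 * L κ + 2) * expect (𝒢.dist κ) (simBound L κ) +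
      (expect (𝒢.dist κ) fun I => (3 * (L κ : ℝ) + 2 * (L κ : ℝ) ^ 2 + 2) / (𝒢.grp I).p₂ +
        1 / 4 * √(2 ^ κ / (𝒢.grp I).p₂)) ≤
      expect (𝒢.dist κ) (fun I => 11 * (L κ : ℝ) ^ 2 / ((𝒢.grp I).p₂ : ℝ) +
            1 / 2 * Real.sqrt (2 ^ κ / ((𝒢.grp I).p₂ : ℝ))) := by
    have hb₁ : ∃ C, ∀ I ∈ (𝒢.dist κ).support, |(4 * L κ + 2) * simBound L κ I| ≤ C :=
      bounded_simBound.imp' ((4 * (L κ : ℝ) + 2) * ·) fun C hC I hI => by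
        rw [abs_mul, abs_of_pos (by positivity)]
        exact mul_le_mul_of_nonneg_left (hC I hI) (by positivity)
    have hb₂ := bounded_bound (p := 𝒢.dist κ) (3 * (L κ : ℝ) + 2 * (L κ : ℝ) ^ 2 + 2) (1 / 4)
      (2 ^ κ) (by positivity)
    rw [← expect_mul_left, ← expect_add hb₁ hb₂]
    obtain ⟨C₁, hC₁⟩ := hb₁
    obtain ⟨C₂, hC₂⟩ := hb₂
    refine expect_mono ⟨C₁ + C₂, fun I hI => (abs_add_le _ _).trans
      (add_le_add (hC₁ I hI) (hC₂ I hI))⟩ (bounded_bound _ _ _ (by positivity)) fun I _ => ?_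
    have hp : (0 : ℝ) < (𝒢.grp I).p₂ := zero_lt_one.trans_le (one_le_p₂ I)
    have h1 : (4 * L κ + 2) * simBound L κ I ≤ 4 / (𝒢.grp I).p₂ := by
      rw [simBound, mul_div_assoc', div_le_div_iff₀ (by positivity) hp]
      nlinarith
    -- the constant is `11` because `3 L + 2 L ^ 2 + 6 ≤ (3 + 2 + 6) L ^ 2`
    have h2 : (3 * (L κ : ℝ) + 2 * (L κ : ℝ) ^ 2 + 2) / (𝒢.grp I).p₂ + 4 / (𝒢.grp I).p₂ ≤
        11 * (L κ : ℝ) ^ 2 / (𝒢.grp I).p₂ := by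
      rw [← add_div]
      gcongr
      nlinarith
    have h3 := Real.sqrt_nonneg (2 ^ κ / ((𝒢.grp I).p₂ : ℝ))
    linarith
  have hSS := toReal_ssExp ℋ A κ (hL κ)
  have hadvS : |(𝒢.sdExp (T.attackSD A qK qM) κ false true).toReal -
      (𝒢.sdExp (T.attackSD A qK qM) κ true true).toReal| = 𝒢.advSD (T.attackSD A qK qM) κ := by
    rw [GroupGenerator.advSD, toReal_false, toReal_false, abs_sub_comm]
    congr 1; ring
  have hadvG : |(𝒢.gsdExp (T.attackGSD A qK qM) κ false true).toReal -
      (𝒢.gsdExp (T.attackGSD A qK qM) κ true true).toReal| =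
        𝒢.advGSD (T.attackGSD A qK qM) κ := by
    rw [GroupGenerator.advGSD, toReal_false, toReal_false, abs_sub_comm]
    congr 1; ring
  rw [DBEScheme.advSS, hSS, ← hadvS, ← hadvG]
  have h1 := hS false
  have h2 := hS true
  have h3 := hG false
  have h4 := hG true
  refine le_trans ?_ (add_le_add_right hsum _)
  generalize expect (𝒢.dist κ) (simBound L κ) = ε at *
  generalize expect (𝒢.dist κ) (fun I => sdValue ℋ A κ (L κ) I true) = s₁ at *
  generalize expect (𝒢.dist κ) (fun I => sdValue ℋ A κ (L κ) I false) = s₀ at *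
  generalize expect (𝒢.dist κ) (fun I => gsdMean ℋ A κ (L κ) I true) = v₁ at *
  generalize expect (𝒢.dist κ) (fun I => gsdMean ℋ A κ (L κ) I false) = v₀ at *
  generalize (𝒢.sdExp (T.attackSD A qK qM) κ false true).toReal = S₀ at *
  generalize (𝒢.sdExp (T.attackSD A qK qM) κ true true).toReal = S₁ at *
  generalize (𝒢.gsdExp (T.attackGSD A qK qM) κ false true).toReal = G₀ at *
  generalize (𝒢.gsdExp (T.attackGSD A qK qM) κ true true).toReal = G₁ at *
  have h5 : |v₀ - v₁| ≤ |G₀ - G₁| + 2 * ε := by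
    have : v₀ - v₁ = (G₀ - G₁) - (G₀ - v₀) + (G₁ - v₁) := by ring
    rw [this]
    linarith [abs_add_le ((G₀ - G₁) - (G₀ - v₀)) (G₁ - v₁), abs_sub (G₀ - G₁) (G₀ - v₀)]
  have h6 : |s₀ - s₁| ≤ |S₀ - S₁| + 2 * ε := by
    have : s₀ - s₁ = (S₀ - S₁) - (S₀ - s₀) + (S₁ - s₁) := by ring
    rw [this]
    linarith [abs_add_le ((S₀ - S₁) - (S₀ - s₀)) (S₁ - s₁), abs_sub (S₀ - S₁) (S₀ - s₀)]
  have h7 : |s₀ - 1 / 2| ≤ |s₀ - s₁| + |(s₁ - 1 / 2) - 2 * L κ * (v₀ - v₁)| +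
      2 * L κ * |v₀ - v₁| := by
    have : s₀ - 1 / 2 = (s₀ - s₁) + ((s₁ - 1 / 2) - 2 * L κ * (v₀ - v₁)) +
      2 * L κ * (v₀ - v₁) := by ring
    have h8 : |2 * (L κ : ℝ) * (v₀ - v₁)| = 2 * L κ * |v₀ - v₁| := by
      rw [abs_mul, abs_of_pos hl0]
    rw [← h8]
    conv_lhs => rw [this]
    exact abs_add_three _ _ _
  have h9 : 2 * (L κ : ℝ) * |v₀ - v₁| ≤ 2 * L κ * (|G₀ - G₁| + 2 * ε) := by gcongr
  linarith

end Bound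

/-! ### Semi-static security -/

section Negligible

theorem Negligible.sqrt {f : ℕ → ℝ} (h : Negligible f) : Negligible fun κ => √(f κ) := by
  intro n
  have h1 := (h (2 * n)).sqrt
  rw [Real.sqrt_zero] at h1
  refine h1.congr fun κ => ?_
  rw [Real.sqrt_mul (by positivity), mul_comm 2 n, pow_mul, Real.sqrt_sq (by positivity)]

theorem Negligible.polynomial_mul {f : ℕ → ℝ} (h : Negligible f) (q : Polynomial ℕ) :
    Negligible fun κ => ((q.eval κ : ℕ) : ℝ) * f κ := by
  refine (Asymptotics.SuperpolynomialDecay.polynomial_mul h (q.map (Nat.castRingHom ℝ))).congr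
    fun κ => ?_
  rw [Polynomial.eval_natCast_map]
  rfl

/-- Jensen's inequality for the square root. -/
theorem expect_sqrt_le {α : Type} {p : PMF α} {f : α → ℝ} (h0 : ∀ a, 0 ≤ f a)
    (hf : ∃ C, ∀ a ∈ p.support, |f a| ≤ C) : expect p (fun a => √(f a)) ≤ √(expect p f) := by
  have hs : ∃ C, ∀ a ∈ p.support, |√(f a)| ≤ C := hf.imp' Real.sqrt fun C hC a ha => by
    rw [abs_of_nonneg (Real.sqrt_nonneg _)]
    exact Real.sqrt_le_sqrt ((le_abs_self _).trans (hC a ha))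
  set m := expect p fun a => √(f a) with hm
  refine Real.le_sqrt_of_sq_le ?_
  have hm' : ∃ C, ∀ a ∈ p.support, |2 * m * √(f a)| ≤ C := hs.imp' (|2 * m| * ·) fun C hC a ha => by
    rw [abs_mul]
    exact mul_le_mul_of_nonneg_left (hC a ha) (abs_nonneg _)
  -- the mean of the tangent bound `2 * m * √x - m ^ 2 ≤ x`
  have h1 : expect p (fun a => 2 * m * √(f a) - m ^ 2) = m ^ 2 := by
    rw [expect_sub hm' ⟨|m ^ 2|, fun _ _ => le_rfl⟩, expect_mul_left, expect_const, ← hm]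
    ring
  rw [← h1]
  obtain ⟨C, hC⟩ := hm'
  refine expect_mono ⟨C + |m ^ 2|, fun a ha => (abs_sub _ _).trans (by gcongr; exact hC a ha)⟩ hf
    fun a _ => ?_
  nlinarith [sq_nonneg (√(f a) - m), Real.sq_sqrt (h0 a)]

end Negligible

theorem semiStaticallySecure_dbeSS {𝒢 : GroupGenerator} (ℋ : HashFamily 𝒢) (hSD : 𝒢.SD)
    (hGSD : 𝒢.GSD)
    (hη : Negligible fun κ => expect (𝒢.dist κ) fun I => 2 ^ κ / ((𝒢.grp I).p₂ : ℝ)) :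
    (dbeSS ℋ).SemiStaticallySecure := by
  intro L hcount hL A
  obtain ⟨B₁, B₂, hB⟩ := advSS_le (ℋ := ℋ) hcount hL A
  obtain ⟨q, hq⟩ := hcount.exists_le
  have hneg := ((hSD B₁).add ((hGSD B₂).polynomial_mul (2 * q))).add
    ((hη.polynomial_mul (11 * q ^ 2)).add (hη.sqrt.const_mul (1 / 2)))
  refine Asymptotics.SuperpolynomialDecay.trans_abs_le hneg fun κ => ?_
  rw [DBEScheme.advSS, abs_abs, ← DBEScheme.advSS]
  refine (hB κ).trans (le_trans ?_ (le_abs_self _))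
  have hl : (L κ : ℝ) ≤ (q.eval κ : ℕ) := by exact_mod_cast hq κ
  have hb : ∃ C, ∀ I ∈ (𝒢.dist κ).support, |(2 : ℝ) ^ κ / (𝒢.grp I).p₂| ≤ C :=
    ⟨2 ^ κ, fun I _ => by
      rw [abs_of_nonneg (by positivity)]
      exact div_le_self (by positivity) (one_le_p₂ I)⟩
  have hsq := expect_sqrt_le (fun I => by positivity) hb
  have hE : expect (𝒢.dist κ) (fun I => 11 * (L κ : ℝ) ^ 2 / ((𝒢.grp I).p₂ : ℝ) +
      1 / 2 * √(2 ^ κ / ((𝒢.grp I).p₂ : ℝ))) ≤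
      11 * ((q.eval κ : ℕ) : ℝ) ^ 2 * expect (𝒢.dist κ) (fun I => 2 ^ κ / ((𝒢.grp I).p₂ : ℝ)) +
        1 / 2 * √(expect (𝒢.dist κ) fun I => 2 ^ κ / ((𝒢.grp I).p₂ : ℝ)) := by
    rw [expect_add, expect_mul_left, ← expect_mul_left (11 * ((q.eval κ : ℕ) : ℝ) ^ 2)]
    · refine add_le_add (expect_mono ?_ ?_ fun I _ => ?_) (by gcongr)
      · simpa using bounded_bound (p := 𝒢.dist κ) (11 * (L κ : ℝ) ^ 2) 0 0 le_rfl
      · simpa [mul_div_assoc'] using bounded_bound (p := 𝒢.dist κ)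
          (11 * ((q.eval κ : ℕ) : ℝ) ^ 2 * 2 ^ κ) 0 0 le_rfl
      · rw [mul_div_assoc']
        refine div_le_div_of_nonneg_right ?_ (Nat.cast_nonneg _)
        refine le_trans ?_ (le_mul_of_one_le_right (by positivity) (one_le_pow₀ one_le_two))
        gcongr
    · simpa using bounded_bound (p := 𝒢.dist κ) (11 * (L κ : ℝ) ^ 2) 0 0 le_rfl
    · simpa using bounded_bound (p := 𝒢.dist κ) 0 (1 / 2) (2 ^ κ) (by positivity)
  have hG : 2 * (L κ : ℝ) * 𝒢.advGSD B₂ κ ≤ 2 * ((q.eval κ : ℕ) : ℝ) * 𝒢.advGSD B₂ κ := by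
    have : 0 ≤ 𝒢.advGSD B₂ κ := abs_nonneg _
    gcongr
  simp only [Pi.add_apply, Polynomial.eval_mul, Polynomial.eval_ofNat, Polynomial.eval_pow]
  push_cast
  linarith

/-! ### Sizes -/

theorem length_elems (B : BilinearGroup) (s : Finset ℕ) (f : s → B.G) :
    (DBESS.elems B s f).length = s.card := by
  rw [DBESS.elems, List.length_map, List.length_attach, Finset.length_sort]

theorem length_elements_pp {𝒢 : GroupGenerator} {ℋ : HashFamily 𝒢} {κ L : ℕ} (hL : 1 ≤ L)
    (pp : DBESS.PP ℋ κ L) : pp.elements.length = 3 * L + 2 := by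
  have h : L + 1 ∈ Finset.Icc 1 (2 * L) := Finset.mem_Icc.2 ⟨by omega, by omega⟩
  simp only [DBESS.PP.elements, List.length_append, length_elems, List.length_cons,
    List.length_nil, Finset.card_erase_of_mem h, Nat.card_Icc]
  omega

theorem length_elements_upk {𝒢 : GroupGenerator} {ℋ : HashFamily 𝒢} {κ L : ℕ}
    {pp : DBESS.PP ℋ κ L} {i : User L} (k : DBESS.UPK pp i) : k.elements.length = L := by
  have h := DBESS.mem_self i
  simp only [DBESS.UPK.elements, List.length_cons, length_elems,
    Finset.card_erase_of_mem (DBESS.mem_sub i.2), Nat.card_Icc]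
  rw [Finset.mem_Icc] at h
  omega

theorem mainTheorem1 :
    -- number of group elements in ciphertext headers, keys and public parameters
    (∀ (𝒢 : GroupGenerator) (ℋ : HashFamily 𝒢) (κ L : ℕ), 1 ≤ L →
      ∀ pp : DBESS.PP ℋ κ L,
        pp.elements.length = 3 * L + 2 ∧
        (∀ c : DBESS.Header pp, c.elements.length = 2) ∧
        (∀ k : DBESS.USK pp, k.elements.length = 1) ∧
        (∀ (i : User L) (k : DBESS.UPK pp i), k.elements.length = L)) ∧
    -- the bound on the advantage
    (∃ C : ℝ, ∀ (𝒢 : GroupGenerator) (ℋ : HashFamily 𝒢) (L : ℕ → ℕ),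
      EfficientCount L → (∀ κ, 1 ≤ L κ) →
      ∀ A : SSAdversary, ∃ B₁ B₂ : Distinguisher, ∀ κ : ℕ,
        (dbeSS ℋ).advSS A κ (L κ) ≤
          𝒢.advSD B₁ κ + 2 * (L κ : ℝ) * 𝒢.advGSD B₂ κ +
            expect (𝒢.dist κ) (fun I => C * (L κ : ℝ) ^ 2 / ((𝒢.grp I).p₂ : ℝ) +
              1 / 2 * Real.sqrt (2 ^ κ / ((𝒢.grp I).p₂ : ℝ)))) ∧
    -- semi-static security
    (∀ (𝒢 : GroupGenerator) (ℋ : HashFamily 𝒢), 𝒢.SD → 𝒢.GSD →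
      Negligible (fun κ => expect (𝒢.dist κ) (fun I => 2 ^ κ / ((𝒢.grp I).p₂ : ℝ))) →
      (dbeSS ℋ).SemiStaticallySecure) := by
  refine ⟨fun 𝒢 ℋ κ L hL pp => ⟨length_elements_pp hL pp, fun _ => rfl, fun _ => rfl,
    fun _ k => length_elements_upk k⟩, ⟨11, fun 𝒢 ℋ L hcount hL A => advSS_le hcount hL A⟩,
    fun 𝒢 ℋ hSD hGSD hη => semiStaticallySecure_dbeSS ℋ hSD hGSD hη⟩
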